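/- Let $d\ge 2$, let $\Omega\subset\mathbb R^d$ be a bounded Lipschitz domain, $T>0$ and $\nu\ge 0$. Let $\mathcal C^\infty_{c,\sigma}(\Omega)$ be the space of smooth, compactly supported, divergence-free fields $\Omega\to\mathbb R^d$, and let $L^2_\sigma(\Omega)$ and $H^1_{0,\sigma}(\Omega)$ be its closures in $L^2(\Omega)$ and $H^1(\Omega)$; $L^2_\sigma(\Omega)$ is identified with its dual by the inner product $(\cdot,\cdot)$ of $L^2(\Omega)$. Put * $\mathbb X = L^\infty(0,T;L^2_\sigma(\Omega))\cap L^2(0,T;H^1_{0,\sigma}(\Omega))$ if $\nu>0$, and $\mathbb X = L^\infty(0,T;L^2_\sigma(\Omega))$ if $\nu=0$; * $\mathbb Y=\mathbb X\cap L^2(0,T;H^2(\Omega))\cap L^1(0,T;W^{1,\infty}(\Omega))\cap H^1(0,T;L^2_\sigma(\Omega)^*)$ if $\nu>0$, and the same without $L^2(0,T;H^2(\Omega))$ if $\nu=0$; * $\mathbb Z=L^2(0,T;H^{-1}(\Omega))+L^1(0,T;L^2(\Omega))$ if $\nu>0$, and $\mathbb Z=L^1(0,T;L^2(\Omega))$ if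 $\nu=0$. Let $f\in\mathbb Z$ and $v_0\in L^2_\sigma(\Omega)$. **Weak solutions.** A function $v\in\mathbb X$ is a *weak solution with the strong energy inequality* if $$\tfrac12\|v(t)\|_{L^2}^2-\tfrac12\|v(s)\|_{L^2}^2+\int_s^t\nu\|\nabla v\|_{L^2}^2\,d\tau\le\int_s^t\langle f,v\rangle\,d\tau\quad\text{for a.e. } s<t\text{ in }(0,T)$$ and, for every $\varphi\in \mathcal C^1_c([0,T))\otimes\mathcal C^\infty_{c,\sigma}(\Omega)$, $$-\int_0^T\!\!\int_\Omega v\cdot\partial_t\varphi\,dx\,dt+\int_0^T\!\!\int_\Omega\big(\nu\nabla v:\nabla\varphi-(v\otimes v):\nabla\varphi\big)dx\,dt=\int_0^T\langle f,\varphi\rangle\,dt+\int_\Omega v_0\cdot\varphi(0)\,dx .$$ **Admissible forms.** Put $\mathcal R(v|\tilde v)=\frac12\|v-\tilde v\|_{L^2}^2$. For $\mathcal K:L^2_\sigma(\Omega)\to[0,\infty]$ let $\mathcal D(\mathcal K)=\{\tilde v\in\mathbb X:\mathcal K(\tilde v)\in L^1(0,T)\}$, and, with $u=v-\tilde v$,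 put $$\mathcal W_\nu(v|\tilde v)=\nu\|\nabla u\|_{L^2}^2-\int_\Omega (u\cdot\nabla)u\cdot\tilde v\,dx+\mathcal K(\tilde v)\mathcal R(v|\tilde v)\quad(\nu>0),$$ $$\mathcal W_0(v|\tilde v)=\int_\Omega u\cdot(\nabla\tilde v)_{\rm sym}u\,dx+\mathcal K(\tilde v)\mathcal R(v|\tilde v)\quad(\nu=0).$$ The form $\mathcal K$ is *admissible* if $\mathcal K(0)=0$; if $\mathcal C^1([0,T];\mathcal C^\infty_{c,\sigma}(\Omega))\subset\mathcal D(\mathcal K)$ and there is a topology on $\mathcal D(\mathcal K)$, at least as fine as that of $L^2(0,T;H^1(\Omega))$ for $\nu>0$ and of $L^1(0,T;L^2(\Omega))$ for $\nu=0$, for which $\mathcal K:\mathcal D(\mathcal K)\to L^1(0,T)$ is continuous and $\mathcal C^1([0,T];\mathcal C^\infty_{c,\sigma}(\Omega))$ is dense; and if $\mathcal W_\nu(v|\tilde v)\ge0$ a.e. in $(0,T)$ for all $v\in\mathbb X$ and $\tilde v\in\mathbb Y\cap\mathcal D(\mathcal K)$. **Energy-variational solutions.** For $\tilde v\in\mathbb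 Y$ put $\langle\mathcal A_\nu(\tilde v),u\rangle=(\partial_t\tilde v,u)+\int_\Omega(\tilde v\cdot\nabla)\tilde v\cdot u\,dx+\nu(\nabla\tilde v,\nabla u)-\langle f,u\rangle$. A pair $(v,\xi)\in\mathbb X\times L^\infty(0,T)$ with $\xi\ge0$ on $(0,T)$ is an *energy-variational solution* if for all admissible $\mathcal K$ and all $\tilde v\in\mathbb Y\cap\mathcal D(\mathcal K)$ the integrand below is in $L^1(0,T)$, the function $\tau\mapsto\mathcal R(v(\tau)|\tilde v(\tau))+\xi(\tau)$ has essential one-sided limits at all points of $[0,T]$, whose right limit at $t$ is denoted by $\mathcal R(v(t+)|\tilde v(t))+\xi(t+)$ and whose left limit at $s$ by $\mathcal R(v(s-)|\tilde v(s))+\xi(s-)$ (at the end points $0$ and $T$ both denote the limit from inside $(0,T)$), and $$\mathcal R(v(t+)|\tilde v(t))+\xi(t+)+\int_s^t\Big(\mathcal W_\nu(v|\tilde v)+\langle\mathcal A_\nu(\tilde v),v-\tilde v\rangle-\mathcal K(\tilde v)\big(\mathcal R(v|\tilde v)+\xi\big)\Big)d\tau\le\mathcal R(v(s-)|\tilde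 v(s))+\xi(s-)$$ for all $0\le s\le t\le T$; and if the initial value is attained weakly, i.e. $(v(\tau),u)\to(v_0,u)$ as $\tau\searrow0$ (essential limit) for all $u\in L^2(\Omega)$. **Proposition.** If $v$ is a weak solution with the strong energy inequality, then $(v,0)$ is an energy-variational solution. -/

import Mathlib

open MeasureTheory Filter Topology Set
open scoped ENNReal ContDiff RealInnerProductSpace

noncomputable section

namespace FluidEV

/-- `ℝ^d` with the Euclidean norm. -/
abbrev Vec (d : ℕ) : Type := EuclideanSpace ℝ (Fin d)

/-- `d × d` matrices with the Frobenius norm; the gradient of a vector field has entries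
`(i, j) ↦ ∂_j u_i`. -/
abbrev Mat (d : ℕ) : Type := EuclideanSpace ℝ (Fin d × Fin d)

/-- Bounded Lipschitz domain: a bounded, connected, nonempty open set which, near each of its
boundary points and after a choice of a vertical direction `e`, is the region strictly above the
graph of a Lipschitz function of the component orthogonal to `e`. -/
structure IsBoundedLipschitzDomain {d : ℕ} (Ω : Set (Vec d)) : Prop where
  isOpen : IsOpen Ω
  isConnected : IsConnected Ω
  isBounded : Bornology.IsBounded Ω
  lipschitz_boundary : ∀ x₀ ∈ frontier Ω, ∃ (e : Vec d) (U : Set (Vec d)) (L : NNReal)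
    (γ : Vec d → ℝ), ‖e‖ = 1 ∧ IsOpen U ∧ x₀ ∈ U ∧ LipschitzWith L γ ∧
      ∀ x ∈ U, (x ∈ Ω ↔ γ (x - ⟪e, x⟫ • e) < ⟪e, x⟫)

/-! ### Function spaces in the space variable -/

/-- `L²(Ω)` with values in `ℝ^ι`. -/
abbrev L2 {d : ℕ} (Ω : Set (Vec d)) (ι : Type) [Fintype ι] : Type :=
  Lp (EuclideanSpace ℝ ι) 2 (volume.restrict Ω)

/-- The class in `L²(Ω)` of a square integrable function. -/
def toL2 {d : ℕ} (Ω : Set (Vec d)) {ι : Type} [Fintype ι]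
    (w : Vec d → EuclideanSpace ℝ ι) : L2 Ω ι :=
  open Classical in
  if h : MemLp w 2 (volume.restrict Ω) then h.toLp w else 0

/-- The classical partial derivative `∂_j ψ`. -/
def partialDeriv {d : ℕ} {F : Type} [NormedAddCommGroup F] [NormedSpace ℝ F]
    (j : Fin d) (ψ : Vec d → F) (x : Vec d) : F :=
  fderiv ℝ ψ x (EuclideanSpace.single j 1)

/-- The classical gradient `(i, j) ↦ ∂_j w_i`. -/
def gradField {d : ℕ} (w : Vec d → Vec d) (x : Vec d) : Mat d :=
  WithLp.toLp 2 fun p => partialDeriv p.2 w x p.1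

/-- `C_c^∞(Ω; F)`. -/
def IsTest {d : ℕ} {F : Type} [NormedAddCommGroup F] [NormedSpace ℝ F]
    (Ω : Set (Vec d)) (w : Vec d → F) : Prop :=
  ContDiff ℝ ∞ w ∧ HasCompactSupport w ∧ tsupport w ⊆ Ω

/-- `C_{c,σ}^∞(Ω; ℝ^d)`: smooth solenoidal fields with compact support in `Ω`. -/
def IsSolTest {d : ℕ} (Ω : Set (Vec d)) (w : Vec d → Vec d) : Prop :=
  IsTest Ω w ∧ ∀ x, ∑ i, partialDeriv i w x i = 0

/-- `g` is the weak (distributional) gradient of `u` in `Ω`, both being in `L²(Ω)`. -/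
def HasWeakGrad {d : ℕ} (Ω : Set (Vec d)) {ι : Type} [Fintype ι]
    (u : L2 Ω ι) (g : L2 Ω (ι × Fin d)) : Prop :=
  ∀ ψ : Vec d → ℝ, IsTest Ω ψ → ∀ (i : ι) (j : Fin d),
    ∫ x in Ω, u x i * partialDeriv j ψ x = -∫ x in Ω, g x (i, j) * ψ x

/-- The weak gradient of `u` if it exists in `L²(Ω)` (it is then unique), and `0` otherwise. -/
def wgrad {d : ℕ} {Ω : Set (Vec d)} {ι : Type} [Fintype ι] (u : L2 Ω ι) : L2 Ω (ι × Fin d) :=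
  open Classical in
  if h : ∃ g, HasWeakGrad Ω u g then h.choose else 0

/-- `L²_σ(Ω)`: closure of `C_{c,σ}^∞(Ω; ℝ^d)` in `L²(Ω)`. -/
def L2sigma {d : ℕ} (Ω : Set (Vec d)) : Set (L2 Ω (Fin d)) :=
  closure {u | ∃ w, IsSolTest Ω w ∧ u = toL2 Ω w}

/-- `H¹_{0,σ}(Ω)`: closure of `C_{c,σ}^∞(Ω; ℝ^d)` in the norm of `H¹(Ω)`, a field `u` being
identified with the pair `(u, ∇u)`. -/
def H10sigma {d : ℕ} (Ω : Set (Vec d)) : Set (L2 Ω (Fin d)) :=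
  {u | (u, wgrad u) ∈ closure {p : L2 Ω (Fin d) × L2 Ω (Fin d × Fin d) |
    ∃ w, IsSolTest Ω w ∧ p = (toL2 Ω w, toL2 Ω (gradField w))}}

/-- `H¹_0(Ω; ℝ^d)`, as a closed subspace of pairs `(u, ∇u)` in `L²(Ω) × L²(Ω)`. -/
def H10 {d : ℕ} (Ω : Set (Vec d)) : Submodule ℝ (L2 Ω (Fin d) × L2 Ω (Fin d × Fin d)) :=
  (Submodule.span ℝ {p : L2 Ω (Fin d) × L2 Ω (Fin d × Fin d) |
    ∃ w : Vec d → Vec d, IsTest Ω w ∧ p = (toL2 Ω w, toL2 Ω (gradField w))}).topologicalClosure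

/-- `H^{-1}(Ω; ℝ^d)`, the dual space of `H¹_0(Ω; ℝ^d)`. -/
abbrev Hm1 {d : ℕ} (Ω : Set (Vec d)) : Type := H10 Ω →L[ℝ] ℝ

/-- Duality pairing `⟨F, u⟩` of `F = F₁ + F₂ ∈ H^{-1}(Ω) + L²(Ω)` with `u`. The first part is
only ever used for `u ∈ H¹_0(Ω)`, or with `F₁ = 0`. -/
def pairing {d : ℕ} {Ω : Set (Vec d)} (F : Hm1 Ω × L2 Ω (Fin d)) (u : L2 Ω (Fin d)) : ℝ :=
  open Classical in
  (if h : (u, wgrad u) ∈ H10 Ω then F.1 ⟨(u, wgrad u), h⟩ else 0) + ⟪F.2, u⟫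

/-! ### Function spaces in time and space -/

/-- Lebesgue measure on `(0, T)`. -/
abbrev timeMeasure (T : ℝ) : Measure ℝ := volume.restrict (Ioo 0 T)

/-- The energy space: `L^∞(0,T; L²_σ) ∩ L²(0,T; H¹_{0,σ})` for `ν > 0` and
`L^∞(0,T; L²_σ)` for `ν = 0`. -/
structure MemX {d : ℕ} (Ω : Set (Vec d)) (ν T : ℝ) (v : ℝ → L2 Ω (Fin d)) : Prop where
  memLp_top : MemLp v ⊤ (timeMeasure T)
  mem_L2sigma : ∀ᵐ t ∂timeMeasure T, v t ∈ L2sigma Ω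
  mem_H10sigma : 0 < ν → ∀ᵐ t ∂timeMeasure T, v t ∈ H10sigma Ω
  memLp_grad : 0 < ν → MemLp (fun t => wgrad (v t)) 2 (timeMeasure T)

/-- `w ∈ L²(0,T; (L²_σ)*)` is the weak time derivative of `v`; here `L²_σ` is identified with its
dual space by the inner product of `L²(Ω)`. -/
structure HasWeakTimeDeriv {d : ℕ} {Ω : Set (Vec d)} (T : ℝ)
    (v w : ℝ → L2 Ω (Fin d)) : Prop where
  memLp : MemLp w 2 (timeMeasure T)
  mem_L2sigma : ∀ᵐ t ∂timeMeasure T, w t ∈ L2sigma Ω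
  integral_eq : ∀ φ : ℝ → ℝ, ContDiff ℝ ∞ φ → HasCompactSupport φ → tsupport φ ⊆ Ioo 0 T →
    ∫ t in Ioo 0 T, deriv φ t • v t = -∫ t in Ioo 0 T, φ t • w t

/-- `v ∈ L²(0,T; H²(Ω))`. -/
def MemL2H2 {d : ℕ} {Ω : Set (Vec d)} (T : ℝ) (v : ℝ → L2 Ω (Fin d)) : Prop :=
  (∀ᵐ t ∂timeMeasure T, HasWeakGrad Ω (v t) (wgrad (v t)) ∧
    HasWeakGrad Ω (wgrad (v t)) (wgrad (wgrad (v t)))) ∧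
  MemLp v 2 (timeMeasure T) ∧
  MemLp (fun t => wgrad (v t)) 2 (timeMeasure T) ∧
  MemLp (fun t => wgrad (wgrad (v t))) 2 (timeMeasure T)

/-- `v ∈ L¹(0,T; W^{1,∞}(Ω))`, as a Bochner space: `v` and `∇v` are Bochner integrable with values
in `L^∞(Ω)`. -/
def MemL1W1inf {d : ℕ} {Ω : Set (Vec d)} (T : ℝ) (v : ℝ → L2 Ω (Fin d)) : Prop :=
  (∀ᵐ t ∂timeMeasure T, HasWeakGrad Ω (v t) (wgrad (v t))) ∧
  (∃ V : ℝ → Lp (Vec d) ⊤ (volume.restrict Ω), MemLp V 1 (timeMeasure T) ∧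
    ∀ᵐ t ∂timeMeasure T, V t =ᵐ[volume.restrict Ω] v t) ∧
  (∃ G : ℝ → Lp (Mat d) ⊤ (volume.restrict Ω), MemLp G 1 (timeMeasure T) ∧
    ∀ᵐ t ∂timeMeasure T, G t =ᵐ[volume.restrict Ω] wgrad (v t))

/-- The space of comparison functions: the energy space intersected with
`L¹(0,T; W^{1,∞}) ∩ H¹(0,T; (L²_σ)*)` and, for `ν > 0`, with `L²(0,T; H²)`. -/
structure MemY {d : ℕ} (Ω : Set (Vec d)) (ν T : ℝ) (v : ℝ → L2 Ω (Fin d)) : Prop where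
  memX : MemX Ω ν T v
  memL2H2 : 0 < ν → MemL2H2 T v
  memL1W1inf : MemL1W1inf T v
  timeDeriv : ∃ w, HasWeakTimeDeriv T v w

/-- The space of right-hand sides: `L²(0,T; H^{-1}) + L¹(0,T; L²)` for `ν > 0` and
`L¹(0,T; L²)` for `ν = 0`; a right-hand side is given by its two parts. -/
structure MemZ {d : ℕ} (Ω : Set (Vec d)) (ν T : ℝ) (f : ℝ → Hm1 Ω × L2 Ω (Fin d)) : Prop where
  memLp_fst : 0 < ν → MemLp (fun t => (f t).1) 2 (timeMeasure T)
  fst_eq_zero : ν = 0 → ∀ᵐ t ∂timeMeasure T, (f t).1 = 0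
  memLp_snd : MemLp (fun t => (f t).2) 1 (timeMeasure T)

/-- `C¹([0,T]; C_{c,σ}^∞(Ω; ℝ^d))`: the fields `u t` are solenoidal test fields supported in a
common compact subset of `Ω`, and `u` is continuously differentiable in time, uniformly in space
together with all spatial derivatives. -/
def IsC1SolTest {d : ℕ} (Ω : Set (Vec d)) (T : ℝ) (u : ℝ → Vec d → Vec d) : Prop :=
  (∀ t ∈ Icc 0 T, IsSolTest Ω (u t)) ∧
  (∃ C : Set (Vec d), IsCompact C ∧ C ⊆ Ω ∧ ∀ t ∈ Icc 0 T, tsupport (u t) ⊆ C) ∧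
  ∃ u' : ℝ → Vec d → Vec d, (∀ t ∈ Icc 0 T, ContDiff ℝ ∞ (u' t)) ∧ ∀ k : ℕ,
    ContinuousOn (fun p : ℝ × Vec d => iteratedFDeriv ℝ k (u p.1) p.2) (Icc 0 T ×ˢ univ) ∧
    ContinuousOn (fun p : ℝ × Vec d => iteratedFDeriv ℝ k (u' p.1) p.2) (Icc 0 T ×ˢ univ) ∧
    ∀ t ∈ Icc 0 T, ∀ x, HasDerivWithinAt (fun s => iteratedFDeriv ℝ k (u s) x)
      (iteratedFDeriv ℝ k (u' t) x) (Icc 0 T) t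

/-! ### Relative energy, convection, and the relative form -/

/-- Relative energy `R(v | w) = ½ ‖v - w‖²`. -/
def relEnergy {d : ℕ} {Ω : Set (Vec d)} (v w : L2 Ω (Fin d)) : ℝ := 1 / 2 * ‖v - w‖ ^ 2

/-- `∫_Ω (a · ∇) b · c dx`, where `G` is the gradient of `b`. -/
def convInt {d : ℕ} {Ω : Set (Vec d)} (a : L2 Ω (Fin d)) (G : L2 Ω (Fin d × Fin d))
    (c : L2 Ω (Fin d)) : ℝ :=
  ∫ x in Ω, ∑ i, ∑ j, a x j * G x (i, j) * c x i

/-- `∫_Ω uᵀ · G_sym u dx` with `G_sym = ½ (G + Gᵀ)`. -/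
def symInt {d : ℕ} {Ω : Set (Vec d)} (u : L2 Ω (Fin d)) (G : L2 Ω (Fin d × Fin d)) : ℝ :=
  ∫ x in Ω, ∑ i, ∑ j, u x i * (1 / 2 * (G x (i, j) + G x (j, i))) * u x j

/-- The relative form `W_ν(v | w)` (at a fixed time) belonging to `K`. -/
def relForm {d : ℕ} {Ω : Set (Vec d)} (ν : ℝ) (K : L2 Ω (Fin d) → ℝ≥0∞)
    (v w : L2 Ω (Fin d)) : ℝ :=
  open Classical in
  (if 0 < ν then ν * ‖wgrad v - wgrad w‖ ^ 2 - convInt (v - w) (wgrad v - wgrad w) w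
    else symInt (v - w) (wgrad w)) + (K w).toReal * relEnergy v w

/-- `⟨A_ν(w), u⟩ = ⟨∂_t w + (w · ∇) w - ν Δ w - F, u⟩` (at a fixed time), with the Laplacian in its
weak form; `w'` is the value of the time derivative, `F` that of the right-hand side. -/
def sysOp {d : ℕ} {Ω : Set (Vec d)} (ν : ℝ) (F : Hm1 Ω × L2 Ω (Fin d))
    (w w' u : L2 Ω (Fin d)) : ℝ :=
  ⟪w', u⟫ + convInt w (wgrad w) u + ν * ⟪wgrad w, wgrad u⟫ - pairing F u

/-! ### Admissible forms -/

/-- The domain `D(K)`: all `w` in the energy space with `K(w) ∈ L¹(0,T)`. -/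
def MemDom {d : ℕ} (Ω : Set (Vec d)) (ν T : ℝ) (K : L2 Ω (Fin d) → ℝ≥0∞)
    (w : ℝ → L2 Ω (Fin d)) : Prop :=
  MemX Ω ν T w ∧ AEMeasurable (fun t => K (w t)) (timeMeasure T) ∧
    ∫⁻ t in Ioo 0 T, K (w t) < ⊤

/-- The set `D(K)` as a type; it carries no topology of its own. -/
def Dom {d : ℕ} (Ω : Set (Vec d)) (ν T : ℝ) (K : L2 Ω (Fin d) → ℝ≥0∞) : Type :=
  {w : ℝ → L2 Ω (Fin d) // MemDom Ω ν T K w}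

/-- Distance in `L²(0,T; H¹)` for `ν > 0` and in `L¹(0,T; L²)` for `ν = 0`. -/
def baseDist {d : ℕ} {Ω : Set (Vec d)} (ν T : ℝ) (u w : ℝ → L2 Ω (Fin d)) : ℝ≥0∞ :=
  open Classical in
  if 0 < ν then eLpNorm (fun t => u t - w t) 2 (timeMeasure T) +
      eLpNorm (fun t => wgrad (u t) - wgrad (w t)) 2 (timeMeasure T)
    else eLpNorm (fun t => u t - w t) 1 (timeMeasure T)

/-- `K` is an admissible form. Only the values of `K` on `L²_σ(Ω)` matter. The form vanishes at
`0`; there is a topology on `D(K)` that is at least as fine as that of `L²(0,T; H¹)` (`ν > 0`) or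
`L¹(0,T; L²)` (`ν = 0`), for which `K : D(K) → L¹(0,T)` is continuous and
`C¹([0,T]; C_{c,σ}^∞)` is dense in `D(K)`; and the relative form belonging to `K` is
nonnegative. -/
structure IsAdmissible {d : ℕ} (Ω : Set (Vec d)) (ν T : ℝ) (K : L2 Ω (Fin d) → ℝ≥0∞) :
    Prop where
  map_zero : K 0 = 0
  memDom_of_smooth : ∀ u, IsC1SolTest Ω T u → MemDom Ω ν T K (fun t => toL2 Ω (u t))
  exists_topology : ∃ _τ : TopologicalSpace (Dom Ω ν T K),
    (∀ w : Dom Ω ν T K,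
      Tendsto (fun u : Dom Ω ν T K => baseDist ν T u.1 w.1) (𝓝 w) (𝓝 0)) ∧
    (∀ w : Dom Ω ν T K,
      Tendsto (fun u : Dom Ω ν T K =>
        eLpNorm (fun t => (K (u.1 t)).toReal - (K (w.1 t)).toReal) 1 (timeMeasure T))
        (𝓝 w) (𝓝 0)) ∧
    Dense {w : Dom Ω ν T K |
      ∃ u, IsC1SolTest Ω T u ∧ ∀ᵐ t ∂timeMeasure T, w.1 t = toL2 Ω (u t)}
  relForm_nonneg : ∀ v w, MemX Ω ν T v → MemY Ω ν T w → MemDom Ω ν T K w →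
    ∀ᵐ t ∂timeMeasure T, 0 ≤ relForm ν K (v t) (w t)

/-! ### Solution concepts -/

/-- Essential neighbourhoods of `t+`; at the end point `T` the limit is taken from inside. -/
def plusFilter (T t : ℝ) : Filter ℝ :=
  open Classical in (if t < T then 𝓝[>] t else 𝓝[<] t) ⊓ ae volume

/-- Essential neighbourhoods of `t-`; at the end point `0` the limit is taken from inside. -/
def minusFilter (t : ℝ) : Filter ℝ :=
  open Classical in (if 0 < t then 𝓝[<] t else 𝓝[>] t) ⊓ ae volume

/-- Weak solution with the strong energy inequality, for the right-hand side `f` and the initial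
value `v₀`. The test functions run through `C¹_c([0,T)) ⊗ C_{c,σ}^∞(Ω; ℝ^d)`, that is, through the
finite sums `∑ k, φ_k(t) w_k(x)`. -/
structure IsWeakSolution {d : ℕ} (Ω : Set (Vec d)) (ν T : ℝ)
    (f : ℝ → Hm1 Ω × L2 Ω (Fin d)) (v₀ : L2 Ω (Fin d)) (v : ℝ → L2 Ω (Fin d)) : Prop where
  memX : MemX Ω ν T v
  energy_inequality : ∀ᵐ s ∂timeMeasure T, ∀ᵐ t ∂timeMeasure T, s < t →
    (1 / 2 * ‖v t‖ ^ 2 - 1 / 2 * ‖v s‖ ^ 2) + ∫ τ in s..t, ν * ‖wgrad (v τ)‖ ^ 2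
      ≤ ∫ τ in s..t, pairing (f τ) (v τ)
  weak_formulation : ∀ (n : ℕ) (φ : Fin n → ℝ → ℝ) (w : Fin n → Vec d → Vec d),
    (∀ k, ContDiff ℝ 1 (φ k) ∧ ∃ T' < T, ∀ t, T' ≤ t → φ k t = 0) →
    (∀ k, IsSolTest Ω (w k)) →
    -(∫ t in 0..T, ∫ x in Ω, ⟪v t x, ∑ k, deriv (φ k) t • w k x⟫)
      + ∫ t in 0..T, ∫ x in Ω,
          (ν * ⟪wgrad (v t) x, ∑ k, φ k t • gradField (w k) x⟫
            - ∑ i, ∑ j, v t x i * v t x j * (∑ k, φ k t • gradField (w k) x) (i, j))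
      = (∫ t in 0..T, pairing (f t) (∑ k, φ k t • toL2 Ω (w k)))
        + ∫ x in Ω, ⟪v₀ x, ∑ k, φ k 0 • w k x⟫

/-- Energy-variational solution `(v, ξ)`, for the right-hand side `f` and the initial value `v₀`.
As `v` and `ξ` are determined almost everywhere in time, `R(v(t+) | w(t)) + ξ(t+)` is the essential
limit of `R(v(τ) | w(τ)) + ξ(τ)` as `τ` decreases to `t`, and similarly for `s-`; these limits are
part of the assertion. -/
structure IsEnergyVariationalSolution {d : ℕ} (Ω : Set (Vec d)) (ν T : ℝ)
    (f : ℝ → Hm1 Ω × L2 Ω (Fin d)) (v₀ : L2 Ω (Fin d))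
    (v : ℝ → L2 Ω (Fin d)) (ξ : ℝ → ℝ) : Prop where
  memX : MemX Ω ν T v
  memLp_defect : MemLp ξ ⊤ (timeMeasure T)
  defect_nonneg : ∀ t ∈ Ioo 0 T, 0 ≤ ξ t
  relative_energy_inequality : ∀ K, IsAdmissible Ω ν T K →
    ∀ w w', MemY Ω ν T w → MemDom Ω ν T K w → HasWeakTimeDeriv T w w' →
    IntegrableOn (fun τ => relForm ν K (v τ) (w τ) + sysOp ν (f τ) (w τ) (w' τ) (v τ - w τ)
      - (K (w τ)).toReal * (relEnergy (v τ) (w τ) + ξ τ)) (Ioo 0 T) ∧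
    ∃ Eplus Eminus : ℝ → ℝ,
      (∀ t ∈ Icc 0 T,
        Tendsto (fun τ => relEnergy (v τ) (w τ) + ξ τ) (plusFilter T t) (𝓝 (Eplus t)) ∧
        Tendsto (fun τ => relEnergy (v τ) (w τ) + ξ τ) (minusFilter t) (𝓝 (Eminus t))) ∧
      ∀ s ∈ Icc 0 T, ∀ t ∈ Icc 0 T, s ≤ t →
        Eplus t + ∫ τ in s..t, (relForm ν K (v τ) (w τ)
            + sysOp ν (f τ) (w τ) (w' τ) (v τ - w τ)
            - (K (w τ)).toReal * (relEnergy (v τ) (w τ) + ξ τ))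
          ≤ Eminus s
  initial_value : ∀ u : L2 Ω (Fin d),
    Tendsto (fun τ => ⟪v τ, u⟫) (plusFilter T 0) (𝓝 ⟪v₀, u⟫)

end FluidEV

end

noncomputable section

namespace FluidEV

/-! ### Weak derivatives on an interval -/

section WeakDeriv

variable {E : Type*} [NormedAddCommGroup E] [NormedSpace ℝ E] [CompleteSpace E]

/-! Write w for the comparison function and expand R(v|w) = ½‖v‖² − (v,w) + ½‖w‖². The strong energy
inequality controls the first term. The other two are primitives of integrable functions: (v,w)' is
the weak formulation tested with w plus (v, ∂ₜw), and (½‖w‖²)' = (∂ₜw, w). Since ξ = 0, the two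
terms with K cancel, and the antisymmetry ∫(a·∇)b·c = −∫(a·∇)c·b for solenoidal a turns the
integrand into exactly ν‖∇v‖² − ⟨f,v⟩ + (v,w)' − (½‖w‖²)' (`relForm_add_sysOp_eq`). This yields the
inequality for almost all s < t (`IsWeakSolution.relative_energy_inequality`). It says that the
relative energy plus a primitive of the integrand is essentially nonincreasing, so the one-sided
limits exist at all times and inherit the inequality (`exists_oneSided_limits`).

The work lies in inserting w into the weak formulation, which admits only sums of products of C¹
functions of time and solenoidal test fields.

In space, v ⊗ v is merely integrable, so L² convergence of gradients does not suffice. But v ⊗ v is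
symmetric and sees only symmetric gradients. It is enough to have solenoidal test fields converging
to w(τ) in L² with uniformly bounded symmetric gradients (`SymApprox`): by Korn's inequality their
gradients converge weakly in L², and the symmetric parts converge against integrable functions
(`SymApprox.tendsto_convInt`). For ν = 0 such fields come from admissibility: nonnegativity of the
relative form at (φ + ψ | φ), for rapidly oscillating solenoidal ψ, gives the pointwise bound |∂ⱼφᵢ
+ ∂ᵢφⱼ| ≤ d K(φ) (`IsAdmissible.abs_sym_grad_le`), and density of smooth fields together with L¹
continuity of K transfers it to approximants of w(t) for almost every t. For ν > 0, w(t) lies in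
H¹_{0,σ} ∩ W^{1,∞}; its extension by zero is mollified and then pushed back into the Lipschitz
domain by Piola transforms, which keep the divergence zero and the gradients bounded
(`IsBoundedLipschitzDomain.exists_symApprox`).

In time, v is differentiable only when tested with fixed fields. The product rule (`product_rule`)
therefore works with difference quotients: v(t) − v(t−h) is tested with the frozen field w(t), and
continuity of translations in L^p brings the averages of the rates at times (t−σ, t) to the
diagonal. This needs a null set of times that does not depend on the test field, which separability
and weak right-continuity provide (`IsWeakSolution.exists_full_set`). -/

theorem integral_smul_primitive_eq {a b : ℝ} {χ : ℝ → ℝ} (hχ : Continuous χ)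
    {I : ℝ → E} (hI : IntegrableOn I (Ioo a b)) :
    ∫ t in Ioo a b, χ t • ∫ r in a..t, I r = ∫ r in Ioo a b, (∫ t in r..b, χ t) • I r := by
  -- The integrand is cut off to the triangle r ≤ t, so that Fubini on the square exchanges the two
  -- integrals.
  set F : ℝ → ℝ → E := fun t r => (Iic t).indicator (fun r => χ t • I r) r with hF
  have hχi : IntegrableOn χ (Ioo a b) := (hχ.integrableOn_Icc).mono_set Ioo_subset_Icc_self
  have hint : Integrable (Function.uncurry F)
      ((volume.restrict (Ioo a b)).prod (volume.restrict (Ioo a b))) := by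
    have h1 : Integrable (fun p : ℝ × ℝ => χ p.1 • I p.2)
        ((volume.restrict (Ioo a b)).prod (volume.restrict (Ioo a b))) := hχi.smul_prod hI
    have hm : MeasurableSet {p : ℝ × ℝ | p.2 ≤ p.1} := measurableSet_le measurable_snd measurable_fst
    refine (h1.indicator hm).congr (ae_of_all _ fun p => ?_)
    simp only [Function.uncurry, hF, indicator, mem_ofPred_eq, mem_Iic]
  have hsw := integral_integral_swap hint
  have hL : ∫ t in Ioo a b, ∫ r in Ioo a b, F t r = ∫ t in Ioo a b, χ t • ∫ r in a..t, I r := by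
    refine setIntegral_congr_fun measurableSet_Ioo fun t ht => ?_
    simp only [hF]
    rw [integral_indicator measurableSet_Iic, Measure.restrict_restrict measurableSet_Iic,
      integral_smul, intervalIntegral.integral_of_le ht.1.le]
    congr 2
    congr 1
    ext x
    simp only [mem_inter_iff, mem_Iic, mem_Ioo, mem_Ioc]
    constructor
    · rintro ⟨h1, h2, h3⟩; exact ⟨h2, h1⟩
    · rintro ⟨h1, h2⟩; exact ⟨h2, h1, h2.trans_lt ht.2⟩
  have hR : ∫ r in Ioo a b, ∫ t in Ioo a b, F t r
      = ∫ r in Ioo a b, (∫ t in r..b, χ t) • I r := by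
    refine setIntegral_congr_fun measurableSet_Ioo fun r hr => ?_
    have : ∀ t, F t r = (Ici r).indicator (fun t => χ t • I r) t := by
      intro t; simp [hF, indicator]
    simp only [this]
    rw [integral_indicator measurableSet_Ici, Measure.restrict_restrict measurableSet_Ici,
      integral_smul_const, intervalIntegral.integral_of_le hr.2.le]
    congr 1
    rw [← integral_Ico_eq_integral_Ioc]
    congr 2
    ext x
    simp only [mem_inter_iff, mem_Ici, mem_Ioo, mem_Ico]
    constructor
    · rintro ⟨h1, h2, h3⟩; exact ⟨h1, h3⟩
    · rintro ⟨h1, h2⟩; exact ⟨h1, hr.1.trans_le h1, h2⟩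
  rw [← hL, ← hR, hsw]

/-- The primitive of a test function with vanishing integral is a test function. -/
theorem exists_primitive_test {a b : ℝ} {χ : ℝ → ℝ} (hχ : ContDiff ℝ ∞ χ)
    (hc : HasCompactSupport χ) (hs : tsupport χ ⊆ Ioo a b) (h0 : ∫ t in a..b, χ t = 0) :
    ∃ φ : ℝ → ℝ, ContDiff ℝ ∞ φ ∧ HasCompactSupport φ ∧ tsupport φ ⊆ Ioo a b ∧
      (∀ t, HasDerivAt φ (χ t) t) ∧ ∀ t, ∫ r in t..b, χ r = -φ t := by
  set φ : ℝ → ℝ := fun t => ∫ r in a..t, χ r with hφ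
  have hci : ∀ x y, IntervalIntegrable χ volume x y := fun x y => hχ.continuous.intervalIntegrable x y
  have hd : ∀ t, HasDerivAt φ (χ t) t := fun t =>
    intervalIntegral.integral_hasDerivAt_right (hci a t)
      hχ.continuous.stronglyMeasurable.stronglyMeasurableAtFilter hχ.continuous.continuousAt
  have hsm : ContDiff ℝ ∞ φ := by
    rw [contDiff_infty_iff_deriv]
    refine ⟨fun t => (hd t).differentiableAt, ?_⟩
    rwa [show deriv φ = χ from funext fun t => (hd t).deriv]
  have hright : ∀ t, ∫ r in t..b, χ r = -φ t := fun t => by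
    have := intervalIntegral.integral_add_adjacent_intervals (hci a t) (hci t b)
    rw [h0] at this
    simp only [hφ]; linarith
  -- The primitive vanishes to the left of α trivially and to the right of β because the total
  -- integral is zero. For empty support any α > a and β < b will do, even with β < α.
  obtain ⟨α, β, haα, hβb, hsub⟩ : ∃ α β, a < α ∧ β < b ∧ tsupport χ ⊆ Icc α β := by
    rcases (tsupport χ).eq_empty_or_nonempty with he | hne
    · exact ⟨a + 1, b - 1, by linarith, by linarith, by simp [he]⟩
    · obtain ⟨α, hα⟩ := hc.isCompact.exists_isLeast hne
      obtain ⟨β, hβ⟩ := hc.isCompact.exists_isGreatest hne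
      exact ⟨α, β, (hs hα.1).1, (hs hβ.1).2, fun x hx => ⟨hα.2 hx, hβ.2 hx⟩⟩
  have hz : ∀ t, t ∉ Icc α β → χ t = 0 := fun t ht =>
    image_eq_zero_of_notMem_tsupport fun h => ht (hsub h)
  have hsupp : ∀ t, t ∉ Icc α β → φ t = 0 := by
    intro t ht
    rcases lt_or_ge t α with h | h
    · simp only [hφ]
      rw [intervalIntegral.integral_congr (g := fun _ => 0), intervalIntegral.integral_zero]
      intro x hx
      refine hz x fun hx' => ?_
      have := hx.2
      rcases le_total a t with h1 | h1 <;> simp [h1] at this <;> linarith [hx'.1]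
    · have hβt : β < t := by
        by_contra hcon
        exact ht ⟨h, not_lt.1 hcon⟩
      have := hright t
      rw [intervalIntegral.integral_congr (g := fun _ => 0), intervalIntegral.integral_zero] at this
      · linarith
      intro x hx
      refine hz x fun hx' => ?_
      have := hx.1
      rcases le_total b t with h1 | h1 <;> simp [h1] at this <;> linarith [hx'.2]
  have hcl : tsupport φ ⊆ Icc α β :=
    closure_minimal (fun t ht => by by_contra h; exact ht (hsupp t h)) isClosed_Icc
  exact ⟨φ, hsm, HasCompactSupport.intro isCompact_Icc hsupp,
    hcl.trans fun x hx => ⟨haα.trans_le hx.1, hx.2.trans_lt hβb⟩, hd, hright⟩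

theorem exists_test_integral_one {a b : ℝ} (hab : a < b) :
    ∃ ψ : ℝ → ℝ, ContDiff ℝ ∞ ψ ∧ HasCompactSupport ψ ∧ tsupport ψ ⊆ Ioo a b ∧
      ∫ t in a..b, ψ t = 1 := by
  let c := (a + b) / 2
  let f : ContDiffBump c := ⟨(b - a) / 8, (b - a) / 4, by linarith, by linarith⟩
  refine ⟨f.normed volume, f.contDiff_normed, f.hasCompactSupport_normed, ?_, ?_⟩
  · rw [f.tsupport_normed_eq]
    intro x hx
    rw [Metric.mem_closedBall, Real.dist_eq, abs_le] at hx
    simp only [f, c] at hx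
    constructor <;> linarith [hx.1, hx.2]
  · rw [intervalIntegral.integral_of_le hab.le, setIntegral_eq_integral_of_forall_compl_eq_zero,
      f.integral_normed]
    intro x hx
    by_contra h
    have : x ∈ Function.support (f.normed volume) := h
    rw [f.support_normed_eq, Metric.mem_ball, Real.dist_eq, abs_lt] at this
    simp only [f, c] at this
    exact hx ⟨by linarith [this.1], by linarith [this.2]⟩

/-- A function with an integrable weak derivative is a primitive of it. -/
theorem ae_eq_const_add_primitive {a b : ℝ} (hab : a < b) {g I : ℝ → E}
    (hg : IntegrableOn g (Ioo a b)) (hI : IntegrableOn I (Ioo a b))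
    (h : ∀ φ : ℝ → ℝ, ContDiff ℝ ∞ φ → HasCompactSupport φ → tsupport φ ⊆ Ioo a b →
      ∫ t in Ioo a b, deriv φ t • g t = -∫ t in Ioo a b, φ t • I t) :
    ∃ c, ∀ᵐ t ∂volume.restrict (Ioo a b), g t = c + ∫ r in a..t, I r := by
  obtain ⟨ψ, hψ, hψc, hψs, hψ1⟩ := exists_test_integral_one hab
  set J : ℝ → E := fun t => ∫ r in a..t, I r with hJ
  have hIi : IntervalIntegrable I volume a b := by
    rw [intervalIntegrable_iff_integrableOn_Ioo_of_le hab.le]; exact hI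
  have hJc : ContinuousOn J (Icc a b) := by
    have := intervalIntegral.continuousOn_primitive_interval
      (by rw [uIcc_of_le hab.le, integrableOn_Icc_iff_integrableOn_Ioo]; exact hI :
        IntegrableOn I (uIcc a b) volume)
    rwa [uIcc_of_le hab.le] at this
  have hJi : IntegrableOn J (Ioo a b) := (hJc.integrableOn_Icc).mono_set Ioo_subset_Icc_self
  set k : ℝ → E := fun t => g t - J t with hk
  have hki : IntegrableOn k (Ioo a b) := hg.sub hJi
  have bd : ∀ χ : ℝ → ℝ, ContDiff ℝ ∞ χ → HasCompactSupport χ → ∀ m : ℝ → E,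
      IntegrableOn m (Ioo a b) → IntegrableOn (fun t => χ t • m t) (Ioo a b) := by
    intro χ hχ hc m hm
    obtain ⟨C, hC⟩ := hc.exists_bound_of_continuous hχ.continuous
    exact hm.bdd_smul C hχ.continuous.aestronglyMeasurable (ae_of_all _ hC)
  have hzero : ∀ χ : ℝ → ℝ, ContDiff ℝ ∞ χ → HasCompactSupport χ → tsupport χ ⊆ Ioo a b →
      ∫ t in a..b, χ t = 0 → ∫ t in Ioo a b, χ t • k t = 0 := by
    intro χ hχ hc hs h0
    obtain ⟨φ, hφ, hφc, hφs, hφd, hφr⟩ := exists_primitive_test hχ hc hs h0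
    have h1 := h φ hφ hφc hφs
    rw [show deriv φ = χ from funext fun t => (hφd t).deriv] at h1
    have h2 := integral_smul_primitive_eq hχ.continuous hI
    simp only [hφr, neg_smul, integral_neg] at h2
    simp only [hk, smul_sub]
    rw [integral_sub (bd χ hχ hc _ hg) (bd χ hχ hc _ hJi), h1, h2, sub_self]
  -- The du Bois-Reymond argument: k = g − J annihilates test functions of mean zero. Subtracting (∫
  -- χ) ψ from an arbitrary χ produces mean zero, so k − c annihilates every test function.
  set c := ∫ t in Ioo a b, ψ t • k t with hc
  refine ⟨c, ?_⟩
  have hfin : ∀ᵐ t, t ∈ Ioo a b → k t - c = 0 := by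
    refine isOpen_Ioo.ae_eq_zero_of_integral_contDiff_smul_eq_zero
      (hki.sub (integrableOn_const (by simp))).locallyIntegrableOn fun χ hχ hχc hχs => ?_
    have hoff : ∀ x, x ∉ Ioo a b → χ x • (k x - c) = 0 := fun x hx => by
      rw [image_eq_zero_of_notMem_tsupport fun hh => hx (hχs hh), zero_smul]
    rw [← setIntegral_eq_integral_of_forall_compl_eq_zero hoff]
    set m := ∫ t in a..b, χ t with hm
    have hd : ContDiff ℝ ∞ (fun t => χ t - m * ψ t) := hχ.sub (contDiff_const.mul hψ)
    have hdc : HasCompactSupport (fun t => χ t - m * ψ t) := hχc.sub (hψc.mul_left)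
    have hds : tsupport (fun t => χ t - m * ψ t) ⊆ Ioo a b := by
      refine (tsupport_sub χ (fun t => m * ψ t)).trans (union_subset hχs ?_)
      exact (tsupport_mul_subset_right).trans hψs
    have hci : ∀ {z : ℝ → ℝ}, ContDiff ℝ ∞ z → IntervalIntegrable z volume a b :=
      fun hz => hz.continuous.intervalIntegrable a b
    have h0 : ∫ t in a..b, (χ t - m * ψ t) = 0 := by
      rw [intervalIntegral.integral_sub (hci hχ) (hci (contDiff_const.mul hψ)),
        intervalIntegral.integral_const_mul, hψ1, ← hm]; ring
    have h3 := hzero _ hd hdc hds h0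
    have h4 : ∫ t in Ioo a b, (χ t - m * ψ t) • k t = (∫ t in Ioo a b, χ t • k t) - m • c := by
      simp only [sub_smul, mul_smul]
      rw [integral_sub (bd χ hχ hχc _ hki) (Integrable.fun_smul m (bd ψ hψ hψc _ hki)), integral_smul]
    have h5 : ∫ t in Ioo a b, χ t • (k t - c) = (∫ t in Ioo a b, χ t • k t) - m • c := by
      simp only [smul_sub]
      rw [integral_sub (bd χ hχ hχc _ hki) (bd χ hχ hχc _ (integrableOn_const (by simp))),
        integral_smul_const, hm, intervalIntegral.integral_of_le hab.le, integral_Ioc_eq_integral_Ioo]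
    rw [h5, ← h4, h3]
  rw [ae_restrict_iff' measurableSet_Ioo]
  filter_upwards [hfin] with t ht hti
  have := ht hti
  simp only [hk] at this
  rw [sub_sub, sub_eq_zero] at this
  rw [this, add_comm]

end WeakDeriv

/-! ### Continuity of correlations under small shifts -/

section Correlation

variable {A B : Type*} [NormedAddCommGroup A] [NormedSpace ℝ A] [NormedAddCommGroup B]
  [NormedSpace ℝ B]

theorem continuous_translate_Lp {A : Type*} [NormedAddCommGroup A] {p : ℝ≥0∞} [Fact (1 ≤ p)]
    (hp : p ≠ ⊤) (f : Lp A p (volume : Measure ℝ)) :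
    Continuous fun σ : ℝ => Lp.compMeasurePreserving (fun t : ℝ => t + σ)
      (measurePreserving_add_right volume σ) f := by
  let g : ℝ → C(ℝ, ℝ) := fun σ => ⟨fun t => t + σ, by fun_prop⟩
  have hg : Continuous g := by
    have : Continuous (fun p : ℝ × ℝ => p.2 + p.1) := by fun_prop
    exact (ContinuousMap.curry ⟨_, this⟩).continuous
  exact (continuous_const (y := f)).compMeasurePreservingLp hg
    (fun σ => measurePreserving_add_right volume σ) hp

theorem integral_correlation_eq_lpPairing {p q : ℝ≥0∞} [Fact (1 ≤ p)] [Fact (1 ≤ q)]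
    [ENNReal.HolderConjugate p q] (L : A →L[ℝ] B →L[ℝ] ℝ) {a : ℝ → A} {b : ℝ → B}
    (ha : MemLp a p) (hb : MemLp b q) (σ : ℝ) :
    ∫ t, L (a (t + σ)) (b t) = L.lpPairing volume p q (Lp.compMeasurePreserving (fun t : ℝ => t + σ)
      (measurePreserving_add_right volume σ) (ha.toLp a)) (hb.toLp b) := by
  rw [ContinuousLinearMap.lpPairing_eq_integral]
  refine integral_congr_ae ?_
  filter_upwards [Lp.coeFn_compMeasurePreserving (ha.toLp a) (measurePreserving_add_right volume σ),
    hb.coeFn_toLp, (measurePreserving_add_right volume σ).quasiMeasurePreserving.ae ha.coeFn_toLp]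
    with t h1 h2 h3
  rw [h1, h2, Function.comp_apply, h3]

/-- One exponent may be ∞, where translations are not continuous. The shift then goes to the other
factor by translation invariance, with σ replaced by −σ. -/
theorem continuous_correlation {p q : ℝ≥0∞} [Fact (1 ≤ p)] [Fact (1 ≤ q)]
    [ENNReal.HolderConjugate p q] (L : A →L[ℝ] B →L[ℝ] ℝ) {a : ℝ → A} {b : ℝ → B}
    (ha : MemLp a p) (hb : MemLp b q) (hpq : p ≠ ⊤ ∨ q ≠ ⊤) :
    Continuous fun σ => ∫ t, L (a (t + σ)) (b t) := by
  rcases hpq with hp | hq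
  · simp only [integral_correlation_eq_lpPairing L ha hb]
    exact ((L.lpPairing volume p q).flip (hb.toLp b)).continuous.comp (continuous_translate_Lp hp _)
  · have h1 : ∀ σ, ∫ t, L (a (t + σ)) (b t) = ∫ t, L.flip (b (t + (-σ))) (a t) := by
      intro σ
      rw [← integral_add_right_eq_self (fun t => L.flip (b (t + (-σ))) (a t)) σ]
      simp
    have : ENNReal.HolderConjugate q p := ENNReal.HolderConjugate.symm
    simp only [h1, integral_correlation_eq_lpPairing L.flip hb ha]
    exact ((L.flip.lpPairing volume q p).flip (ha.toLp a)).continuous.comp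
      ((continuous_translate_Lp hq _).comp continuous_neg)

theorem aestronglyMeasurable_correlation (L : A →L[ℝ] B →L[ℝ] ℝ) {a : ℝ → A} {b : ℝ → B}
    (ha : AEStronglyMeasurable a) (hb : AEStronglyMeasurable b) (h : ℝ) :
    AEStronglyMeasurable (fun z : ℝ × ℝ => L (a (z.1 + z.2)) (b z.1))
      ((volume : Measure ℝ).prod (volume.restrict (Ioc 0 h))) := by
  have h2 : (volume : Measure ℝ).prod (volume.restrict (Ioc 0 h)) ≪
      (volume : Measure ℝ).prod volume :=
    Measure.AbsolutelyContinuous.prod Measure.AbsolutelyContinuous.rfl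
      Measure.restrict_le_self.absolutelyContinuous
  refine AEStronglyMeasurable.mono_ac h2 ?_
  have hq : Measure.QuasiMeasurePreserving (fun z : ℝ × ℝ => z.1 + z.2)
      ((volume : Measure ℝ).prod volume) volume :=
    Measure.quasiMeasurePreserving_snd.comp
      (measurePreserving_prod_add volume volume).quasiMeasurePreserving
  exact L.aestronglyMeasurable_comp₂ (ha.comp_quasiMeasurePreserving hq) hb.comp_fst

/-- By Hölder and translation invariance the integral over t of the absolute value is bounded
independently of σ, and σ ranges over a set of finite measure. -/
theorem integrable_correlation {p q : ℝ≥0∞} [Fact (1 ≤ p)] [Fact (1 ≤ q)]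
    [ENNReal.HolderConjugate p q] (L : A →L[ℝ] B →L[ℝ] ℝ) {a : ℝ → A} {b : ℝ → B}
    (ha : MemLp a p) (hb : MemLp b q) (h : ℝ) :
    Integrable (fun z : ℝ × ℝ => L (a (z.1 + z.2)) (b z.1))
      ((volume : Measure ℝ).prod (volume.restrict (Ioc 0 h))) := by
  have hm := aestronglyMeasurable_correlation L ha.1 hb.1 h
  have hsh : ∀ σ, MemLp (fun t => a (t + σ)) p := fun σ =>
    ha.comp_measurePreserving (measurePreserving_add_right volume σ)
  rw [integrable_prod_iff' hm]
  constructor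
  · exact ae_of_all _ fun σ => memLp_one_iff_integrable.1 (L.memLp_of_bilin 1 (hsh σ) hb)
  · refine Integrable.mono' (g := fun _ => ‖L‖ * ‖ha.toLp a‖ * ‖hb.toLp b‖)
      (integrable_const _)
      hm.norm.prod_swap.integral_prod_right' (ae_of_all _ fun σ => ?_)
    rw [Real.norm_of_nonneg (integral_nonneg fun _ => norm_nonneg _)]
    have h1 := L.norm_holder_apply_apply_le (r := 1) (Lp.compMeasurePreserving (fun t : ℝ => t + σ)
      (measurePreserving_add_right volume σ) (ha.toLp a)) (hb.toLp b)
    rw [Lp.norm_compMeasurePreserving, L1.norm_eq_integral_norm] at h1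
    refine le_trans (le_of_eq (integral_congr_ae ?_)) h1
    filter_upwards [Lp.coeFn_compMeasurePreserving (ha.toLp a)
      (measurePreserving_add_right volume σ), hb.coeFn_toLp, L.coeFn_holder (r := 1)
        (Lp.compMeasurePreserving (fun t : ℝ => t + σ)
      (measurePreserving_add_right volume σ) (ha.toLp a)) (hb.toLp b),
      (measurePreserving_add_right volume σ).quasiMeasurePreserving.ae ha.coeFn_toLp]
      with t h1 h2 h3 h4
    rw [h3, h1, h2, Function.comp_apply, h4]

/-- After Fubini the average is the slope at 0 of the primitive of the correlation, which is
continuous. -/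
theorem tendsto_average_correlation {p q : ℝ≥0∞} [Fact (1 ≤ p)] [Fact (1 ≤ q)]
    [ENNReal.HolderConjugate p q] (L : A →L[ℝ] B →L[ℝ] ℝ) {a : ℝ → A} {b : ℝ → B}
    (ha : MemLp a p) (hb : MemLp b q) (hpq : p ≠ ⊤ ∨ q ≠ ⊤) :
    Tendsto (fun h : ℝ => h⁻¹ * ∫ t, ∫ σ in Ioc 0 h, L (a (t + σ)) (b t)) (𝓝[>] 0)
      (𝓝 (∫ t, L (a t) (b t))) := by
  set k : ℝ → ℝ := fun σ => ∫ t, L (a (t + σ)) (b t) with hk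
  have hkc : Continuous k := continuous_correlation L ha hb hpq
  have hd : HasDerivAt (fun h => ∫ σ in (0 : ℝ)..h, k σ) (k 0) 0 :=
    intervalIntegral.integral_hasDerivAt_right (hkc.intervalIntegrable 0 0)
      hkc.stronglyMeasurable.stronglyMeasurableAtFilter hkc.continuousAt
  have h0 : k 0 = ∫ t, L (a t) (b t) := by simp [hk]
  rw [← h0]
  have hs := hd.hasDerivWithinAt (s := Ioi 0)
  rw [hasDerivWithinAt_iff_tendsto_slope' (by simp)] at hs
  refine hs.congr' ?_
  filter_upwards [self_mem_nhdsWithin] with h hh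
  have hh0 : (0 : ℝ) < h := hh
  rw [integral_integral_swap (integrable_correlation L ha hb h)]
  simp [slope, intervalIntegral.integral_of_le hh0.le, hk]

end Correlation

/-! ### Essentially nonincreasing functions -/

section EssAntitone

theorem neBot_nhdsGT_inf_ae (t : ℝ) : (𝓝[>] t ⊓ ae (volume : Measure ℝ)).NeBot := by
  rw [inf_neBot_iff]
  intro U hU V hV
  obtain ⟨u, hu, hsub⟩ := (mem_nhdsGT_iff_exists_Ioo_subset).1 hU
  have hu' : t < u := hu
  by_contra hne
  rw [not_nonempty_iff_eq_empty] at hne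
  have : Ioo t u ⊆ Vᶜ := fun x hx hxV => by
    have : x ∈ U ∩ V := ⟨hsub hx, hxV⟩
    rw [hne] at this; exact this
  have h0 := measure_mono_null this (mem_ae_iff.1 hV)
  simp [Real.volume_Ioo] at h0
  linarith

theorem neBot_nhdsLT_inf_ae (t : ℝ) : (𝓝[<] t ⊓ ae (volume : Measure ℝ)).NeBot := by
  rw [inf_neBot_iff]
  intro U hU V hV
  obtain ⟨u, hu, hsub⟩ := (mem_nhdsLT_iff_exists_Ioo_subset).1 hU
  have hu' : u < t := hu
  by_contra hne
  rw [not_nonempty_iff_eq_empty] at hne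
  have : Ioo u t ⊆ Vᶜ := fun x hx hxV => by
    have : x ∈ U ∩ V := ⟨hsub hx, hxV⟩
    rw [hne] at this; exact this
  have h0 := measure_mono_null this (mem_ae_iff.1 hV)
  simp [Real.volume_Ioo] at h0
  linarith

theorem eventually_nhdsGT_inf_ae {T t u : ℝ} (ht : 0 ≤ t) (hu : t < u) (huT : u ≤ T) {P : ℝ → Prop}
    (h : ∀ᵐ τ ∂timeMeasure T, τ ∈ Ioo t u → P τ) : ∀ᶠ τ in 𝓝[>] t ⊓ ae volume, P τ := by
  rw [ae_restrict_iff' measurableSet_Ioo] at h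
  have h1 : ∀ᶠ τ in 𝓝[>] t ⊓ ae volume, τ ∈ Ioo t u :=
    mem_inf_of_left (Ioo_mem_nhdsGT hu)
  have h2 : ∀ᶠ τ in 𝓝[>] t ⊓ ae volume, τ ∈ Ioo 0 T → τ ∈ Ioo t u → P τ := mem_inf_of_right h
  filter_upwards [h1, h2] with τ h1 h2
  exact h2 ⟨ht.trans_lt h1.1, h1.2.trans_le huT⟩ h1

theorem eventually_nhdsLT_inf_ae {T t u : ℝ} (hu0 : 0 ≤ u) (hu : u < t) (htT : t ≤ T) {P : ℝ → Prop}
    (h : ∀ᵐ τ ∂timeMeasure T, τ ∈ Ioo u t → P τ) : ∀ᶠ τ in 𝓝[<] t ⊓ ae volume, P τ := by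
  rw [ae_restrict_iff' measurableSet_Ioo] at h
  have h1 : ∀ᶠ τ in 𝓝[<] t ⊓ ae volume, τ ∈ Ioo u t :=
    mem_inf_of_left (Ioo_mem_nhdsLT hu)
  have h2 : ∀ᶠ τ in 𝓝[<] t ⊓ ae volume, τ ∈ Ioo 0 T → τ ∈ Ioo u t → P τ := mem_inf_of_right h
  filter_upwards [h1, h2] with τ h1 h2
  exact h2 ⟨hu0.trans_lt h1.1, h1.2.trans_le htT⟩ h1

theorem frequently_timeMeasure_Ioo {T a b : ℝ} (ha : 0 ≤ a) (hab : a < b) (hb : b ≤ T)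
    {P : ℝ → Prop} (h : ∀ᵐ τ ∂timeMeasure T, P τ) : ∃ τ ∈ Ioo a b, P τ := by
  have h1 : ∀ᶠ τ in 𝓝[>] a ⊓ ae volume, P τ :=
    eventually_nhdsGT_inf_ae ha hab hb (h.mono fun τ hτ _ => hτ)
  have h2 : ∀ᶠ τ in 𝓝[>] a ⊓ ae volume, τ ∈ Ioo a b := mem_inf_of_left (Ioo_mem_nhdsGT hab)
  have := neBot_nhdsGT_inf_ae a
  obtain ⟨τ, h3, h4⟩ := (h1.and h2).exists
  exact ⟨τ, h4, h3⟩

variable {T : ℝ} {e : ℝ → ℝ}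

/-- The limit is the essential supremum of e on (t, T), written as the infimum of its essential
upper bounds there. -/
theorem exists_right_limit {C : ℝ} (hb : ∀ᵐ t ∂timeMeasure T, |e t| ≤ C)
    (h : ∀ᵐ s ∂timeMeasure T, ∀ᵐ t ∂timeMeasure T, s < t → e t ≤ e s)
    {t : ℝ} (ht : 0 ≤ t) (htT : t < T) : ∃ L, Tendsto e (𝓝[>] t ⊓ ae volume) (𝓝 L) := by
  set S : Set ℝ := {c | ∀ᵐ τ ∂timeMeasure T, t < τ → e τ ≤ c} with hS
  have hCS : C ∈ S := hb.mono fun τ hτ _ => (abs_le.1 hτ).2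
  have hbdd : BddBelow S := by
    refine ⟨-C, fun c hc => ?_⟩
    obtain ⟨τ, h1, h2, h3⟩ := frequently_timeMeasure_Ioo ht htT le_rfl (hb.and hc)
    exact (abs_le.1 h2).1.trans (h3 h1.1)
  refine ⟨sInf S, ?_⟩
  rw [Metric.tendsto_nhds]
  intro ε hε
  have hup : ∀ᶠ τ in 𝓝[>] t ⊓ ae volume, e τ < sInf S + ε := by
    obtain ⟨c, hc, hcl⟩ := exists_lt_of_csInf_lt ⟨C, hCS⟩ (show sInf S < sInf S + ε by linarith)
    refine eventually_nhdsGT_inf_ae ht htT le_rfl ?_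
    filter_upwards [hc] with τ h1 h2
    exact (h1 h2.1).trans_lt hcl
  have hlo : ∀ᶠ τ in 𝓝[>] t ⊓ ae volume, sInf S - ε < e τ := by
    have hnot : sInf S - ε ∉ S := fun hc => by linarith [csInf_le hbdd hc]
    -- The values above sInf S − ε fill a set of positive measure in (t, T), hence already in some
    -- (t + 1/(n+1), T). Monotonicity carries the lower bound to almost every earlier time.
    have hex : ∃ n : ℕ, ¬ ∀ᵐ τ ∂timeMeasure T, t + 1 / ((n : ℝ) + 1) < τ → e τ ≤ sInf S - ε := by
      by_contra hcon
      push Not at hcon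
      apply hnot
      rw [← ae_all_iff] at hcon
      filter_upwards [hcon] with τ h1 h2
      obtain ⟨n, hn⟩ := exists_nat_one_div_lt (sub_pos.2 h2)
      exact h1 n (by linarith)
    obtain ⟨n, hn⟩ := hex
    set δ : ℝ := 1 / ((n : ℝ) + 1)
    have hδ : 0 < δ := Nat.one_div_pos_of_nat
    refine eventually_nhdsGT_inf_ae ht (u := min (t + δ) T) (lt_min (by linarith) htT)
      (min_le_right _ _) ?_
    filter_upwards [h] with s hs hst
    have hf : ∃ᶠ τ in ae (timeMeasure T), t + δ < τ ∧ sInf S - ε < e τ := by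
      refine fun hcon => hn (hcon.mono fun τ h1 h2 => ?_)
      by_contra h3
      exact h1 ⟨h2, not_le.1 h3⟩
    obtain ⟨τ, ⟨h1, h2⟩, h3⟩ := (hf.and_eventually hs).exists
    exact h2.trans_le (h3 ((hst.2.trans_le (min_le_left _ _)).trans h1))
  filter_upwards [hup, hlo] with τ h1 h2
  rw [Real.dist_eq, abs_lt]
  constructor <;> linarith

/-- The limit is the essential infimum of e on (0, t). That it bounds e from below on (0, t) is
needed at the end point T, where the limit from the left replaces the one from the right. -/
theorem exists_left_limit {C : ℝ} (hb : ∀ᵐ t ∂timeMeasure T, |e t| ≤ C)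
    (h : ∀ᵐ s ∂timeMeasure T, ∀ᵐ t ∂timeMeasure T, s < t → e t ≤ e s)
    {t : ℝ} (ht : 0 < t) (htT : t ≤ T) :
    ∃ L, Tendsto e (𝓝[<] t ⊓ ae volume) (𝓝 L) ∧ ∀ᵐ τ ∂timeMeasure T, τ < t → L ≤ e τ := by
  set S : Set ℝ := {c | ∀ᵐ τ ∂timeMeasure T, τ < t → c ≤ e τ} with hS
  have hCS : -C ∈ S := hb.mono fun τ hτ _ => (abs_le.1 hτ).1
  have hbdd : BddAbove S := by
    refine ⟨C, fun c hc => ?_⟩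
    obtain ⟨τ, h1, h2, h3⟩ := frequently_timeMeasure_Ioo le_rfl ht htT (hb.and hc)
    exact (h3 h1.2).trans (abs_le.1 h2).2
  have hlo : ∀ ε > 0, ∀ᵐ τ ∂timeMeasure T, τ < t → sSup S - ε < e τ := by
    intro ε hε
    obtain ⟨c, hc, hcl⟩ := exists_lt_of_lt_csSup ⟨-C, hCS⟩ (show sSup S - ε < sSup S by linarith)
    filter_upwards [hc] with τ h1 h2
    exact hcl.trans_le (h1 h2)
  refine ⟨sSup S, ?_, ?_⟩
  · rw [Metric.tendsto_nhds]
    intro ε hε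
    have hnot : sSup S + ε ∉ S := fun hc => by linarith [le_csSup hbdd hc]
    have hf : ∃ᶠ τ in ae (timeMeasure T), τ < t ∧ e τ < sSup S + ε := by
      refine fun hcon => hnot (hcon.mono fun τ h1 h2 => ?_)
      by_contra h3
      exact h1 ⟨h2, not_le.1 h3⟩
    have hmem : ∀ᵐ τ ∂timeMeasure T, τ ∈ Ioo 0 T := ae_restrict_mem measurableSet_Ioo
    obtain ⟨s, ⟨h1, h2⟩, h3, h4⟩ := (hf.and_eventually (h.and hmem)).exists
    refine eventually_nhdsLT_inf_ae h4.1.le h1 htT ?_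
    filter_upwards [h3, hlo ε hε] with τ h5 h6 h7
    rw [Real.dist_eq, abs_lt]
    have := h5 h7.1
    have := h6 h7.2
    constructor <;> linarith
  · have h1 : ∀ᵐ τ ∂timeMeasure T, ∀ n : ℕ, τ < t → sSup S - 1 / ((n : ℝ) + 1) < e τ :=
      ae_all_iff.2 fun n => hlo _ Nat.one_div_pos_of_nat
    filter_upwards [h1] with τ h1 h2
    refine le_of_forall_pos_lt_add fun ε hε => ?_
    obtain ⟨n, hn⟩ := exists_nat_one_div_lt hε
    linarith [h1 n h2]

/-- One-sided limits of a function that satisfies an integrated differential inequality for almost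
all pairs of times. -/
theorem exists_oneSided_limits (hT : 0 < T) {E I : ℝ → ℝ} (hI : IntegrableOn I (Ioo 0 T)) {C : ℝ}
    (hb : ∀ᵐ t ∂timeMeasure T, |E t| ≤ C)
    (h : ∀ᵐ s ∂timeMeasure T, ∀ᵐ t ∂timeMeasure T, s < t → E t + ∫ r in s..t, I r ≤ E s) :
    ∃ Eplus Eminus : ℝ → ℝ,
      (∀ t ∈ Icc 0 T, Tendsto E (plusFilter T t) (𝓝 (Eplus t)) ∧
        Tendsto E (minusFilter t) (𝓝 (Eminus t))) ∧
      ∀ s ∈ Icc 0 T, ∀ t ∈ Icc 0 T, s ≤ t → Eplus t + ∫ τ in s..t, I τ ≤ Eminus s := by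
  set P : ℝ → ℝ := fun t => ∫ r in (0 : ℝ)..t, I r with hP
  have hIc : IntegrableOn I (Icc 0 T) := by rwa [integrableOn_Icc_iff_integrableOn_Ioo]
  have hPc : ContinuousOn P (Icc 0 T) := by
    have := intervalIntegral.continuousOn_primitive_interval (by rwa [uIcc_of_le hT.le] :
        IntegrableOn I (uIcc 0 T) volume)
    rwa [uIcc_of_le hT.le] at this
  have hii : ∀ {a b}, a ∈ Icc 0 T → b ∈ Icc 0 T → IntervalIntegrable I volume a b := by
    intro a b ha hb
    refine (hIc.mono_set ?_).intervalIntegrable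
    exact uIcc_subset_Icc ha hb
  have hsplit : ∀ {a b}, a ∈ Icc 0 T → b ∈ Icc 0 T → ∫ r in a..b, I r = P b - P a := by
    intro a b ha hb
    have h0 : (0 : ℝ) ∈ Icc 0 T := ⟨le_rfl, hT.le⟩
    simp only [hP]
    rw [← intervalIntegral.integral_add_adjacent_intervals (hii h0 ha) (hii ha hb)]
    ring
  -- Adding the continuous primitive P makes E essentially nonincreasing and does not affect the
  -- existence of limits.
  set e : ℝ → ℝ := fun t => E t + P t with he
  obtain ⟨CP, hCP⟩ := isCompact_Icc.exists_bound_of_continuousOn hPc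
  have hmem : ∀ᵐ τ ∂timeMeasure T, τ ∈ Ioo 0 T := ae_restrict_mem measurableSet_Ioo
  have heb : ∀ᵐ t ∂timeMeasure T, |e t| ≤ C + CP := by
    filter_upwards [hb, hmem] with t h1 h2
    exact (abs_add_le _ _).trans (add_le_add h1 (hCP t (Ioo_subset_Icc_self h2)))
  have hea : ∀ᵐ s ∂timeMeasure T, ∀ᵐ t ∂timeMeasure T, s < t → e t ≤ e s := by
    filter_upwards [h, hmem] with s hs hsm
    filter_upwards [hs, hmem] with t ht htm hst
    have := ht hst
    rw [hsplit (Ioo_subset_Icc_self hsm) (Ioo_subset_Icc_self htm)] at this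
    simp only [he]; linarith
  have hR : ∀ t, ∃ L, 0 ≤ t → t < T → Tendsto e (𝓝[>] t ⊓ ae volume) (𝓝 L) := fun t => by
    by_cases ht : 0 ≤ t ∧ t < T
    · obtain ⟨L, hL⟩ := exists_right_limit heb hea ht.1 ht.2
      exact ⟨L, fun _ _ => hL⟩
    · exact ⟨0, fun h1 h2 => (ht ⟨h1, h2⟩).elim⟩
  choose R hR using hR
  have hL : ∀ t, ∃ L, 0 < t → t ≤ T → Tendsto e (𝓝[<] t ⊓ ae volume) (𝓝 L) ∧
      ∀ᵐ τ ∂timeMeasure T, τ < t → L ≤ e τ := fun t => by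
    by_cases ht : 0 < t ∧ t ≤ T
    · obtain ⟨L, hL⟩ := exists_left_limit heb hea ht.1 ht.2
      exact ⟨L, fun _ _ => hL⟩
    · exact ⟨0, fun h1 h2 => (ht ⟨h1, h2⟩).elim⟩
  choose L hL using hL
  have hEe : E = fun t => e t - P t := by ext t; simp [he]
  have hPr : ∀ t, 0 ≤ t → t < T → Tendsto P (𝓝[>] t ⊓ ae volume) (𝓝 (P t)) := fun t h0 h1 => by
    refine Tendsto.mono_left ?_ inf_le_left
    refine (hPc t ⟨h0, h1.le⟩).mono_left ?_
    rw [nhdsWithin_le_iff]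
    exact mem_of_superset (Ioo_mem_nhdsGT h1) fun x hx => ⟨h0.trans hx.1.le, hx.2.le⟩
  have hPl : ∀ t, 0 < t → t ≤ T → Tendsto P (𝓝[<] t ⊓ ae volume) (𝓝 (P t)) := fun t h0 h1 => by
    refine Tendsto.mono_left ?_ inf_le_left
    refine (hPc t ⟨h0.le, h1⟩).mono_left ?_
    rw [nhdsWithin_le_iff]
    exact mem_of_superset (Ioo_mem_nhdsLT h0) fun x hx => ⟨hx.1.le, hx.2.le.trans h1⟩
  set Rp : ℝ → ℝ := fun t => if t < T then R t else L t with hRp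
  set Lm : ℝ → ℝ := fun t => if 0 < t then L t else R t with hLm
  refine ⟨fun t => Rp t - P t, fun t => Lm t - P t, fun t ht => ⟨?_, ?_⟩, fun s hs t ht hst => ?_⟩
  · rw [hEe]
    simp only [plusFilter, hRp]
    split_ifs with h1
    · exact (hR t ht.1 h1).sub (hPr t ht.1 h1)
    · have h2 : t = T := le_antisymm ht.2 (not_lt.1 h1)
      have h0 : 0 < t := h2 ▸ hT
      exact (hL t h0 ht.2).1.sub (hPl t h0 ht.2)
  · rw [hEe]
    simp only [minusFilter, hLm]
    split_ifs with h1
    · exact (hL t h1 ht.2).1.sub (hPl t h1 ht.2)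
    · have h2 : t = 0 := le_antisymm (not_lt.1 h1) ht.1
      have h0 : t < T := h2 ▸ hT
      exact (hR t ht.1 h0).sub (hPr t ht.1 h0)
  · rw [hsplit hs ht]
    suffices Rp t ≤ Lm s by linarith
    -- The right limit at t lies below e at almost every earlier time; letting these times tend to s
    -- gives the claim.
    have key : ∀ᵐ τ ∂timeMeasure T, τ < t → Rp t ≤ e τ := by
      simp only [hRp]
      split_ifs with h1
      · filter_upwards [hea] with τ h2 h3
        have := neBot_nhdsGT_inf_ae t
        exact le_of_tendsto (hR t ht.1 h1) (eventually_nhdsGT_inf_ae ht.1 h1 le_rfl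
          (h2.mono fun r hr hr' => hr (h3.trans hr'.1)))
      · have h2 : t = T := le_antisymm ht.2 (not_lt.1 h1)
        exact (hL t (h2 ▸ hT) ht.2).2
    by_cases hs0 : 0 < s
    · simp only [hLm, if_pos hs0]
      have := neBot_nhdsLT_inf_ae s
      exact ge_of_tendsto (hL s hs0 hs.2).1 (eventually_nhdsLT_inf_ae le_rfl hs0 hs.2
        (key.mono fun τ h1 h2 => h1 (h2.2.trans_le hst)))
    · have hs0' : s = 0 := le_antisymm (not_lt.1 hs0) hs.1
      subst hs0'
      simp only [hLm, if_neg hs0]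
      -- For s = t = 0 there are no earlier times, but both sides are then the same limit from
      -- inside.
      rcases ht.1.eq_or_lt with h0 | h0
      · subst h0
        simp [hRp, hT]
      · have := neBot_nhdsGT_inf_ae 0
        exact ge_of_tendsto (hR 0 le_rfl hT) (eventually_nhdsGT_inf_ae le_rfl h0 ht.2
          (key.mono fun τ h1 h2 => h1 h2.2))

end EssAntitone

/-! ### A product rule in time -/

/-- `C_c^∞(0,T)`. -/
def IsTimeTest (T : ℝ) (ψ : ℝ → ℝ) : Prop :=
  ContDiff ℝ ∞ ψ ∧ HasCompactSupport ψ ∧ tsupport ψ ⊆ Ioo 0 T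

/-- Averages of `n (t - σ, t)` over small `σ > 0` converge weakly to `n (t, t)`. -/
def DiagonalLimit (T : ℝ) (n : ℝ → ℝ → ℝ) : Prop :=
  ∀ ψ, IsTimeTest T ψ →
    (∀ h, Integrable (fun z : ℝ × ℝ => ψ z.1 * n (z.1 - z.2) z.1)
      ((volume : Measure ℝ).prod (volume.restrict (Ioc 0 h)))) ∧
    Tendsto (fun h : ℝ => h⁻¹ * ∫ t, ∫ σ in Ioc 0 h, ψ t * n (t - σ) t) (𝓝[>] 0)
      (𝓝 (∫ t, ψ t * n t t))

section

variable {T : ℝ}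

theorem IsTimeTest.exists_bound {ψ : ℝ → ℝ} (hψ : IsTimeTest T ψ) : ∃ C, ∀ t, ‖ψ t‖ ≤ C :=
  hψ.2.1.exists_bound_of_continuous hψ.1.continuous

theorem IsTimeTest.eq_zero {ψ : ℝ → ℝ} (hψ : IsTimeTest T ψ) {t : ℝ} (ht : t ∉ Ioo 0 T) :
    ψ t = 0 := image_eq_zero_of_notMem_tsupport fun h => ht (hψ.2.2 h)

theorem IsTimeTest.deriv_eq_zero {ψ : ℝ → ℝ} (hψ : IsTimeTest T ψ) {t : ℝ} (ht : t ∉ Ioo 0 T) :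
    deriv ψ t = 0 :=
  image_eq_zero_of_notMem_tsupport fun h => ht (hψ.2.2 (tsupport_deriv_subset h))

/-- Keeps t − h inside (0, T) on the support of ψ when h < δ, so that the backward differences in
`product_rule` do not see the cut-off at 0. -/
theorem IsTimeTest.exists_pos {ψ : ℝ → ℝ} (hψ : IsTimeTest T ψ) :
    ∃ δ > 0, ∀ t, ψ t ≠ 0 → δ < t := by
  rcases (tsupport ψ).eq_empty_or_nonempty with he | hne
  · exact ⟨1, one_pos, fun t ht => by
      have := subset_tsupport ψ (show t ∈ Function.support ψ from ht)
      rw [he] at this; exact this.elim⟩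
  · obtain ⟨α, hα⟩ := hψ.2.1.isCompact.exists_isLeast hne
    have h0 := (hψ.2.2 hα.1).1
    refine ⟨α / 2, by linarith, fun t ht => ?_⟩
    have := hα.2 (subset_tsupport ψ (show t ∈ Function.support ψ from ht))
    linarith

theorem DiagonalLimit.add {n m : ℝ → ℝ → ℝ} : DiagonalLimit T n → DiagonalLimit T m →
    (∀ ψ, IsTimeTest T ψ → Integrable (fun t => ψ t * n t t)) →
    (∀ ψ, IsTimeTest T ψ → Integrable (fun t => ψ t * m t t)) →
    DiagonalLimit T (fun r τ => n r τ + m r τ) := by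
  intro hn hm hni hmi ψ hψ
  refine ⟨fun h => ?_, ?_⟩
  · simp only [mul_add]
    exact ((hn ψ hψ).1 h).add ((hm ψ hψ).1 h)
  · have h1 := (hn ψ hψ).2.add (hm ψ hψ).2
    rw [← integral_add (hni ψ hψ) (hmi ψ hψ)] at h1
    simp only [mul_add]
    refine h1.congr fun h => ?_
    rw [← mul_add]
    congr 1
    rw [← integral_add ((hn ψ hψ).1 h).integral_prod_left ((hm ψ hψ).1 h).integral_prod_left]
    refine integral_congr_ae ?_
    filter_upwards [((hn ψ hψ).1 h).prod_right_ae, ((hm ψ hψ).1 h).prod_right_ae] with t h2 h3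
    rw [← integral_add h2 h3]

theorem DiagonalLimit.of_eq_zero {n : ℝ → ℝ → ℝ} (h : ∀ r, ∀ τ, n r τ = 0) :
    DiagonalLimit T n := by
  intro ψ hψ
  simp [h]

variable {A B : Type*} [NormedAddCommGroup A] [NormedSpace ℝ A] [NormedAddCommGroup B]
  [NormedSpace ℝ B]

/-- The reflection t ↦ −t turns the backward shift t − σ into the forward shift of the correlation
lemmas; ψ is absorbed into the factor b. -/
theorem DiagonalLimit.of_bilinear {p q : ℝ≥0∞} [Fact (1 ≤ p)] [Fact (1 ≤ q)]
    [ENNReal.HolderConjugate p q] (L : A →L[ℝ] B →L[ℝ] ℝ) {a : ℝ → A} {b : ℝ → B}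
    (ha : MemLp a p) (hb : MemLp b q) (hpq : p ≠ ⊤ ∨ q ≠ ⊤) :
    DiagonalLimit T (fun r τ => L (a r) (b τ)) := by
  intro ψ hψ
  obtain ⟨C, hC⟩ := hψ.exists_bound
  have hψb : MemLp (fun t => ψ t • b t) q := by
    have h1 : MemLp ψ ⊤ := memLp_top_of_bound hψ.1.continuous.aestronglyMeasurable C (ae_of_all _ hC)
    exact hb.smul h1
  have hmp := Measure.measurePreserving_neg (volume : Measure ℝ)
  have ha' : MemLp (fun t => a (-t)) p := ha.comp_measurePreserving hmp
  have hb' : MemLp (fun t => ψ (-t) • b (-t)) q := hψb.comp_measurePreserving hmp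
  constructor
  · intro h
    have h1 := integrable_correlation L ha' hb' h
    have h2 : MeasurePreserving (Prod.map (fun t : ℝ => -t) (id : ℝ → ℝ))
        ((volume : Measure ℝ).prod (volume.restrict (Ioc 0 h)))
        ((volume : Measure ℝ).prod (volume.restrict (Ioc 0 h))) :=
      hmp.prod (MeasurePreserving.id _)
    refine (h2.integrable_comp_of_integrable h1).congr (ae_of_all _ fun z => ?_)
    simp [Prod.map]
    left
    congr 3
    ring
  · have h1 := tendsto_average_correlation L ha' hb' hpq
    have e1 : ∫ t, L (a (-t)) (ψ (-t) • b (-t)) = ∫ t, ψ t * L (a t) (b t) := by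
      rw [← integral_neg_eq_self]; simp
    rw [e1] at h1
    refine h1.congr fun h => ?_
    congr 1
    rw [← integral_neg_eq_self]
    refine integral_congr_ae (ae_of_all _ fun t => ?_)
    simp only [neg_neg, map_smul, smul_eq_mul]
    refine integral_congr_ae (ae_of_all _ fun σ => ?_)
    simp only
    rw [show -(-t + σ) = t - σ by ring]

end

/-! ### The product rule by difference quotients in time -/

section

variable {T : ℝ} {H : Type*} [NormedAddCommGroup H] [InnerProductSpace ℝ H] [CompleteSpace H]

/-- The product with ψ extends by zero beyond (0, T) without losing the weak derivative. The
interval (−1, T + 1) leaves room for shifts by h < 1. -/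
theorem weakDeriv_smul_test {w w' : ℝ → H} (hw : IntegrableOn w (Ioo 0 T))
    (hw' : IntegrableOn w' (Ioo 0 T))
    (hder : ∀ φ, IsTimeTest T φ →
      ∫ t in Ioo 0 T, deriv φ t • w t = -∫ t in Ioo 0 T, φ t • w' t)
    (hT : 0 < T) {ψ : ℝ → ℝ} (hψ : IsTimeTest T ψ) :
    ∃ c, ∀ᵐ t ∂volume.restrict (Ioo (-1) (T + 1)), ψ t • w t = c + ∫ r in (-1)..t,
      (deriv ψ r • w r + ψ r • w' r) := by
  have hsub : Ioo 0 T ⊆ Ioo (-1) (T + 1) := fun x hx => ⟨by linarith [hx.1], by linarith [hx.2]⟩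
  have bd : ∀ {χ : ℝ → ℝ} {m : ℝ → H}, Continuous χ → HasCompactSupport χ →
      IntegrableOn m (Ioo 0 T) → IntegrableOn (fun t => χ t • m t) (Ioo 0 T) := by
    intro χ m hχ hc hm
    obtain ⟨C, hC⟩ := hc.exists_bound_of_continuous hχ
    exact hm.bdd_smul C hχ.aestronglyMeasurable (ae_of_all _ hC)
  have hcd : Continuous (deriv ψ) := hψ.1.continuous_deriv (by simp)
  have i1 := bd hcd hψ.2.1.deriv hw
  have i2 := bd hψ.1.continuous hψ.2.1 hw'
  have i0 := bd hψ.1.continuous hψ.2.1 hw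
  have ext : ∀ {m : ℝ → H}, IntegrableOn m (Ioo 0 T) → (∀ t, t ∉ Ioo 0 T → m t = 0) →
      IntegrableOn m (Ioo (-1) (T + 1)) := by
    intro m hm h0
    refine Integrable.integrableOn ?_
    rw [integrableOn_iff_integrable_of_support_subset] at hm
    · exact hm
    · intro t ht
      by_contra hcon
      exact ht (h0 t hcon)
  refine ae_eq_const_add_primitive (by linarith) (ext i0 fun t ht => by simp [hψ.eq_zero ht])
    (ext (i1.add i2) fun t ht => by simp [hψ.eq_zero ht, hψ.deriv_eq_zero ht]) ?_
  intro η hη hηc hηs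
  have hprod : IsTimeTest T (fun t => η t * ψ t) :=
    ⟨hη.mul hψ.1, hψ.2.1.mul_left, tsupport_mul_subset_right.trans hψ.2.2⟩
  have h1 := hder _ hprod
  have hdp : ∀ t, deriv (fun t => η t * ψ t) t = deriv η t * ψ t + η t * deriv ψ t := fun t =>
    deriv_fun_mul (hη.differentiable (by simp) t) (hψ.1.differentiable (by simp) t)
  have red : ∀ {m : ℝ → H}, (∀ t, t ∉ Ioo 0 T → m t = 0) →
      ∫ t in Ioo (-1) (T + 1), m t = ∫ t in Ioo 0 T, m t := by
    intro m h0
    refine setIntegral_eq_of_subset_of_forall_sdiff_eq_zero measurableSet_Ioo hsub fun t ht => ?_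
    exact h0 t ht.2
  rw [red fun t ht => by simp [hψ.eq_zero ht], red fun t ht => by simp [hψ.eq_zero ht, hψ.deriv_eq_zero ht]]
  simp only [hdp, add_smul, mul_smul, smul_add] at h1 ⊢
  have hdη : Continuous (deriv η) := hη.continuous_deriv (by simp)
  rw [integral_add (bd hdη hηc.deriv i0) (bd hη.continuous hηc i1)] at h1
  rw [integral_add (bd hη.continuous hηc i1) (bd hη.continuous hηc i2), neg_add, ← h1]
  abel

/-- Product rule: `v` has a weak derivative `n (t, ·)` when tested with the values of `w`, and `w`
has an integrable weak derivative `w'`. -/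
theorem product_rule (hT : 0 < T) {v w w' : ℝ → H} (hv : MemLp v ⊤ (timeMeasure T))
    (hw : MemLp w ⊤ (timeMeasure T)) (hw' : MemLp w' 1 (timeMeasure T))
    (hder : ∀ φ, IsTimeTest T φ →
      ∫ t in Ioo 0 T, deriv φ t • w t = -∫ t in Ioo 0 T, φ t • w' t)
    {n : ℝ → ℝ → ℝ} (hn : IntegrableOn (fun t => n t t) (Ioo 0 T)) (hdiag : DiagonalLimit T n)
    {G : Set ℝ} (hG : ∀ᵐ t ∂timeMeasure T, t ∈ G)
    (hinc : ∀ᵐ τ ∂timeMeasure T, ∀ s ∈ G, ∀ t ∈ G, s ∈ Ioo 0 T → t ∈ Ioo 0 T → s ≤ t →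
      ⟪v t - v s, w τ⟫ = ∫ r in s..t, n r τ) :
    ∃ c, ∀ᵐ t ∂timeMeasure T, ⟪v t, w t⟫ = c + ∫ r in (0 : ℝ)..t, (n r r + ⟪v r, w' r⟫) := by
  have hwi : IntegrableOn w (Ioo 0 T) := memLp_one_iff_integrable.1 (hw.mono_exponent le_top)
  have hw'i : IntegrableOn w' (Ioo 0 T) := memLp_one_iff_integrable.1 hw'
  have hvw : IntegrableOn (fun t => ⟪v t, w t⟫) (Ioo 0 T) :=
    memLp_one_iff_integrable.1 ((innerSL ℝ).memLp_of_bilin (q := 1) 1 hv (hw.mono_exponent le_top))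
  have hvw' : IntegrableOn (fun t => ⟪v t, w' t⟫) (Ioo 0 T) :=
    memLp_one_iff_integrable.1 ((innerSL ℝ).memLp_of_bilin (q := 1) 1 hv hw')
  refine ae_eq_const_add_primitive hT hvw (hn.add hvw') fun ψ hψ1 hψ2 hψ3 => ?_
  have hψ : IsTimeTest T ψ := ⟨hψ1, hψ2, hψ3⟩
  have hcd : Continuous (deriv ψ) := hψ.1.continuous_deriv (by simp)
  obtain ⟨C, hC⟩ := hψ.exists_bound
  obtain ⟨C', hC'⟩ := hψ.2.1.deriv.exists_bound_of_continuous hcd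
  have bdr : ∀ {χ : ℝ → ℝ} {K : ℝ} {m : ℝ → ℝ}, Continuous χ → (∀ t, ‖χ t‖ ≤ K) →
      IntegrableOn m (Ioo 0 T) → IntegrableOn (fun t => χ t * m t) (Ioo 0 T) := by
    intro χ K m hχ hc hm
    exact hm.bdd_smul K hχ.aestronglyMeasurable (ae_of_all _ hc)
  set W : ℝ → H := fun t => ψ t • w t with hW
  set W' : ℝ → H := fun t => deriv ψ t • w t + ψ t • w' t with hW'
  set V : ℝ → H := (Ioo 0 T).indicator v with hV
  have hW0 : ∀ t, t ∉ Ioo 0 T → W t = 0 := fun t ht => by simp [hW, hψ.eq_zero ht]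
  have hW'0 : ∀ t, t ∉ Ioo 0 T → W' t = 0 := fun t ht => by
    simp [hW', hψ.eq_zero ht, hψ.deriv_eq_zero ht]
  have ext : ∀ {m : ℝ → H} {p : ℝ≥0∞}, MemLp m p (timeMeasure T) → (∀ t, t ∉ Ioo 0 T → m t = 0) →
      MemLp m p volume := by
    intro m p hm h0
    have : (Ioo 0 T).indicator m = m := by
      ext1 t; by_cases ht : t ∈ Ioo 0 T
      · simp [ht]
      · simp [ht, h0 t ht]
    rw [← this, memLp_indicator_iff_restrict measurableSet_Ioo]
    exact hm
  have hVm : MemLp V ⊤ volume := (memLp_indicator_iff_restrict measurableSet_Ioo).2 hv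
  have hψm : ∀ μ : Measure ℝ, MemLp ψ ⊤ μ := fun μ =>
    memLp_top_of_bound hψ.1.continuous.aestronglyMeasurable C (ae_of_all _ hC)
  have hψ'm : ∀ μ : Measure ℝ, MemLp (deriv ψ) ⊤ μ := fun μ =>
    memLp_top_of_bound hcd.aestronglyMeasurable C' (ae_of_all _ hC')
  have hw1 : MemLp w 1 (timeMeasure T) := hw.mono_exponent le_top
  have hWm : MemLp W 1 volume := ext (hw1.smul (hψm _)) hW0
  have hW'm : MemLp W' 1 volume :=
    ext ((hw1.smul (hψ'm _)).add (hw'.smul (hψm _))) hW'0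
  -- the second half of the difference quotient
  have hlim2 := tendsto_average_correlation (innerSL ℝ (E := H)) hW'm hVm (Or.inl ENNReal.one_ne_top)
  have hlim1 := (hdiag ψ hψ).2
  have hlim := hlim1.add hlim2
  obtain ⟨δ, hδ, hδψ⟩ := hψ.exists_pos
  obtain ⟨c, hc⟩ := weakDeriv_smul_test hwi hw'i hder hT hψ
  have hW'ii : ∀ a b, IntervalIntegrable W' volume a b := fun a b =>
    (memLp_one_iff_integrable.1 hW'm).intervalIntegrable
  -- Discrete integration by parts: by translation invariance, ∫⟨V(t) − V(t−h), W(t)⟩ + ∫⟨V(t),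
  -- W(t+h) − W(t)⟩ = 0. The first difference is an integral of n over (t−h, t) tested at t, the
  -- second an integral of W' over (t, t+h). Dividing by h and letting h tend to 0 gives the weak
  -- derivative of ⟨v, w⟩.
  have hzero : ∀ h ∈ Ioo 0 (min δ 1), (h⁻¹ * ∫ t, ∫ σ in Ioc 0 h, ψ t * n (t - σ) t)
      + h⁻¹ * (∫ t, ∫ σ in Ioc 0 h, innerSL ℝ (W' (t + σ)) (V t)) = 0 := by
    intro h hh
    have hh0 : 0 < h := hh.1
    have hhδ : h < δ := hh.2.trans_le (min_le_left _ _)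
    have hh1 : h < 1 := hh.2.trans_le (min_le_right _ _)
    have sh : ∀ {P : ℝ → Prop}, (∀ᵐ t, P t) → ∀ᵐ t, P (t + h) := fun hP =>
      (measurePreserving_add_right volume h).quasiMeasurePreserving.ae hP
    have shs : ∀ {P : ℝ → Prop}, (∀ᵐ t, P t) → ∀ᵐ t, P (t - h) := fun hP =>
      (measurePreserving_sub_right volume h).quasiMeasurePreserving.ae hP
    rw [ae_restrict_iff' measurableSet_Ioo] at hG hinc hc
    have X1 : ∫ t, ⟪V t - V (t - h), W t⟫ = ∫ t, ∫ σ in Ioc 0 h, ψ t * n (t - σ) t := by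
      refine integral_congr_ae ?_
      filter_upwards [hG, shs hG, hinc] with t h1 h2 h3
      by_cases hψt : ψ t = 0
      · simp [hW, hψt]
      · have ht1 : δ < t := hδψ t hψt
        have ht : t ∈ Ioo 0 T := by by_contra hcon; exact hψt (hψ.eq_zero hcon)
        have hth : t - h ∈ Ioo 0 T := ⟨by linarith, by linarith [ht.2]⟩
        have h4 := h3 ht (t - h) (h2 hth) t (h1 ht) hth ht (by linarith)
        rw [integral_const_mul]
        simp only [hV, indicator_of_mem ht, indicator_of_mem hth, hW, inner_smul_right]
        rw [h4]
        congr 1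
        rw [← intervalIntegral.integral_of_le hh0.le,
          intervalIntegral.integral_comp_sub_left (fun r => n r t) t, sub_zero]
    have X2 : ∫ t, ⟪V t, W (t + h) - W t⟫ = ∫ t, ∫ σ in Ioc 0 h, innerSL ℝ (W' (t + σ)) (V t) := by
      refine integral_congr_ae ?_
      filter_upwards [hc, sh hc] with t h1 h2
      by_cases ht : t ∈ Ioo 0 T
      · have e1 := h1 ⟨by linarith [ht.1], by linarith [ht.2]⟩
        have e2 := h2 ⟨by linarith [ht.1], by linarith [ht.2]⟩
        have e3 : W (t + h) - W t = ∫ σ in Ioc 0 h, W' (t + σ) := by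
          rw [← intervalIntegral.integral_of_le hh0.le,
            intervalIntegral.integral_comp_add_left (fun r => W' r) t, add_zero]
          simp only [hW]
          rw [e1, e2, add_sub_add_left_eq_sub]
          exact intervalIntegral.integral_interval_sub_left (hW'ii _ _) (hW'ii _ _)
        rw [e3]
        have hint : IntegrableOn (fun σ => W' (t + σ)) (Ioc 0 h) :=
          ((memLp_one_iff_integrable.1 hW'm).comp_add_left t).integrableOn
        have := ContinuousLinearMap.integral_comp_comm (innerSL ℝ (V t)) hint
        simp only [innerSL_apply_apply] at this ⊢
        rw [← this]
        simp only [real_inner_comm]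
      · simp [hV, ht]
    have i1 : Integrable (fun t => ⟪V t, W t⟫) :=
      memLp_one_iff_integrable.1 ((innerSL ℝ).memLp_of_bilin (q := 1) 1 hVm hWm)
    have i2 : Integrable (fun t => ⟪V (t - h), W t⟫) :=
      memLp_one_iff_integrable.1 ((innerSL ℝ).memLp_of_bilin (q := 1) 1
        (hVm.comp_measurePreserving (measurePreserving_sub_right volume h)) hWm)
    have i3 : Integrable (fun t => ⟪V t, W (t + h)⟫) :=
      memLp_one_iff_integrable.1 ((innerSL ℝ).memLp_of_bilin (q := 1) 1 hVm
        (hWm.comp_measurePreserving (measurePreserving_add_right volume h)))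
    have e4 : ∫ t, ⟪V (t - h), W t⟫ = ∫ t, ⟪V t, W (t + h)⟫ := by
      rw [← integral_add_right_eq_self _ h]
      simp
    rw [← X1, ← X2]
    simp only [inner_sub_left, inner_sub_right]
    rw [integral_sub i1 i2, integral_sub i3 i1, e4]
    ring
  have hlim0 : (∫ t, ψ t * n t t) + ∫ t, innerSL ℝ (W' t) (V t) = 0 := by
    refine tendsto_nhds_unique hlim ?_
    refine tendsto_const_nhds.congr' ?_
    filter_upwards [Ioo_mem_nhdsGT (lt_min hδ one_pos)] with h hh
    exact (hzero h hh).symm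
  have r1 : ∫ t, ψ t * n t t = ∫ t in Ioo 0 T, ψ t * n t t :=
    (setIntegral_eq_integral_of_forall_compl_eq_zero fun t ht => by simp [hψ.eq_zero ht]).symm
  have r2 : ∫ t, innerSL ℝ (W' t) (V t) =
      ∫ t in Ioo 0 T, (deriv ψ t * ⟪v t, w t⟫ + ψ t * ⟪v t, w' t⟫) := by
    rw [← setIntegral_eq_integral_of_forall_compl_eq_zero (s := Ioo 0 T)
      fun t ht => by simp [hW'0 t ht]]
    refine setIntegral_congr_fun measurableSet_Ioo fun t ht => ?_
    simp only [hV, indicator_of_mem ht, hW', innerSL_apply_apply, inner_add_left, inner_smul_left,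
      RCLike.conj_to_real]
    rw [real_inner_comm, real_inner_comm (w' t)]
  rw [r1, r2, integral_add (bdr hcd hC' hvw) (bdr hψ.1.continuous hC hvw')] at hlim0
  simp only [smul_eq_mul, mul_add]
  rw [integral_add (bdr hψ.1.continuous hC hn) (bdr hψ.1.continuous hC hvw')]
  linarith

end

/-! ### Test functions -/

section Test

variable {d : ℕ} {Ω : Set (Vec d)} {F : Type} [NormedAddCommGroup F] [NormedSpace ℝ F]

theorem IsTest.continuous {w : Vec d → F} (hw : IsTest Ω w) : Continuous w := hw.1.continuous

theorem IsTest.differentiable {w : Vec d → F} (hw : IsTest Ω w) : Differentiable ℝ w :=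
  hw.1.differentiable (by simp)

theorem IsTest.memLp {w : Vec d → F} (hw : IsTest Ω w) (p : ℝ≥0∞) (μ : Measure (Vec d))
    [IsFiniteMeasureOnCompacts μ] : MemLp w p μ :=
  hw.continuous.memLp_of_hasCompactSupport hw.2.1

theorem IsTest.eq_zero {w : Vec d → F} (hw : IsTest Ω w) {x : Vec d} (hx : x ∉ Ω) : w x = 0 :=
  image_eq_zero_of_notMem_tsupport fun h => hx (hw.2.2 h)

theorem IsTest.add {w z : Vec d → F} (hw : IsTest Ω w) (hz : IsTest Ω z) :
    IsTest Ω (fun x => w x + z x) :=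
  ⟨hw.1.add hz.1, hw.2.1.add hz.2.1, (tsupport_add w z).trans (union_subset hw.2.2 hz.2.2)⟩

theorem IsTest.zero : IsTest Ω (fun _ => 0 : Vec d → F) :=
  ⟨contDiff_const, HasCompactSupport.zero, by
    rw [show (fun _ => 0 : Vec d → F) = 0 from rfl, tsupport_zero]; exact empty_subset _⟩

theorem IsTest.of_eq_zero {F' : Type} [NormedAddCommGroup F'] [NormedSpace ℝ F'] {w : Vec d → F}
    (hw : IsTest Ω w) {z : Vec d → F'} (hz : ContDiff ℝ ∞ z)
    (h : tsupport z ⊆ tsupport w) : IsTest Ω z :=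
  ⟨hz, hw.2.1.of_isClosed_subset (isClosed_tsupport z) h, h.trans hw.2.2⟩

theorem IsTest.smul {ψ : Vec d → ℝ} {w : Vec d → F} (hw : IsTest Ω w) (hψ : ContDiff ℝ ∞ ψ) :
    IsTest Ω (fun x => ψ x • w x) :=
  hw.of_eq_zero (hψ.smul hw.1) (tsupport_smul_subset_right ψ w)

theorem IsTest.const_smul (c : ℝ) {w : Vec d → F} (hw : IsTest Ω w) :
    IsTest Ω (fun x => c • w x) := hw.smul contDiff_const

theorem IsTest.partialDeriv {w : Vec d → F} (hw : IsTest Ω w) (j : Fin d) :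
    IsTest Ω (partialDeriv j w) := by
  refine hw.of_eq_zero ?_ ?_
  · exact (hw.1.fderiv_right (m := ∞) le_rfl).clm_apply contDiff_const
  · refine (closure_mono fun x hx => ?_).trans (tsupport_fderiv_subset ℝ (f := w))
    rw [Function.mem_support] at hx ⊢
    intro h
    simp [FluidEV.partialDeriv, h] at hx

theorem IsTest.clm_comp {F' : Type} [NormedAddCommGroup F'] [NormedSpace ℝ F'] {w : Vec d → F}
    (hw : IsTest Ω w) (L : F →L[ℝ] F') : IsTest Ω (fun x => L (w x)) := by
  refine hw.of_eq_zero (L.contDiff.comp hw.1) (closure_mono fun x hx => ?_)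
  rw [Function.mem_support] at hx ⊢
  intro h
  simp [h] at hx

theorem partialDeriv_clm_comp {F' : Type} [NormedAddCommGroup F'] [NormedSpace ℝ F'] {w : Vec d → F}
    {x : Vec d} (hw : DifferentiableAt ℝ w x) (L : F →L[ℝ] F') (j : Fin d) :
    partialDeriv j (fun x => L (w x)) x = L (partialDeriv j w x) := by
  have : HasFDerivAt (fun x => L (w x)) (L.comp (fderiv ℝ w x)) x :=
    L.hasFDerivAt.comp x hw.hasFDerivAt
  simp [partialDeriv, this.fderiv]

theorem partialDeriv_mul {f g : Vec d → ℝ} {x : Vec d} (hf : DifferentiableAt ℝ f x)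
    (hg : DifferentiableAt ℝ g x) (j : Fin d) :
    partialDeriv j (fun x => f x * g x) x = partialDeriv j f x * g x + f x * partialDeriv j g x := by
  simp [partialDeriv, fderiv_fun_mul hf hg]
  ring

theorem partialDeriv_apply {ι : Type} [Fintype ι] {w : Vec d → EuclideanSpace ℝ ι} {x : Vec d}
    (hw : DifferentiableAt ℝ w x) (j : Fin d) (i : ι) :
    partialDeriv j (fun x => w x i) x = partialDeriv j w x i :=
  partialDeriv_clm_comp hw (EuclideanSpace.proj i : EuclideanSpace ℝ ι →L[ℝ] ℝ) j

theorem IsTest.apply {ι : Type} [Fintype ι] {w : Vec d → EuclideanSpace ℝ ι} (hw : IsTest Ω w)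
    (i : ι) : IsTest Ω (fun x => w x i) :=
  hw.clm_comp (EuclideanSpace.proj i : EuclideanSpace ℝ ι →L[ℝ] ℝ)

theorem IsTest.gradField {w : Vec d → Vec d} (hw : IsTest Ω w) : IsTest Ω (gradField w) := by
  refine hw.of_eq_zero ?_ ?_
  · rw [contDiff_euclidean]
    intro p
    exact ((hw.partialDeriv p.2).apply p.1).1
  · refine (closure_mono fun x hx => ?_).trans (tsupport_fderiv_subset ℝ (f := w))
    rw [Function.mem_support] at hx ⊢
    intro h
    apply hx
    ext p
    simp [FluidEV.gradField, FluidEV.partialDeriv, h]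

@[simp]
theorem gradField_apply (w : Vec d → Vec d) (x : Vec d) (p : Fin d × Fin d) :
    gradField w x p = partialDeriv p.2 w x p.1 := rfl

theorem partialDeriv_add {w z : Vec d → F} {x : Vec d} (hw : DifferentiableAt ℝ w x)
    (hz : DifferentiableAt ℝ z x) (j : Fin d) :
    partialDeriv j (fun x => w x + z x) x = partialDeriv j w x + partialDeriv j z x := by
  simp [partialDeriv, fderiv_fun_add hw hz]

theorem partialDeriv_const_smul {w : Vec d → F} {x : Vec d} (hw : DifferentiableAt ℝ w x) (c : ℝ)
    (j : Fin d) : partialDeriv j (fun x => c • w x) x = c • partialDeriv j w x := by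
  simp [partialDeriv, fderiv_fun_const_smul hw]

theorem IsSolTest.add {w z : Vec d → Vec d} (hw : IsSolTest Ω w) (hz : IsSolTest Ω z) :
    IsSolTest Ω (fun x => w x + z x) := by
  refine ⟨hw.1.add hz.1, fun x => ?_⟩
  simp only [partialDeriv_add (hw.1.differentiable x) (hz.1.differentiable x), PiLp.add_apply,
    Finset.sum_add_distrib, hw.2 x, hz.2 x, add_zero]

theorem IsSolTest.const_smul (c : ℝ) {w : Vec d → Vec d} (hw : IsSolTest Ω w) :
    IsSolTest Ω (fun x => c • w x) := by
  refine ⟨hw.1.const_smul c, fun x => ?_⟩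
  simp only [partialDeriv_const_smul (hw.1.differentiable x), PiLp.smul_apply, smul_eq_mul,
    ← Finset.mul_sum, hw.2 x, mul_zero]

theorem IsSolTest.zero : IsSolTest Ω (fun _ => 0 : Vec d → Vec d) :=
  ⟨IsTest.zero, fun x => by simp [partialDeriv]⟩

/-- Integration by parts against a compactly supported function. -/
theorem integral_mul_partialDeriv {f g : Vec d → ℝ} (hf : ContDiff ℝ 1 f) (hg : ContDiff ℝ 1 g)
    (hgc : HasCompactSupport g) (j : Fin d) :
    ∫ x, f x * partialDeriv j g x = -∫ x, partialDeriv j f x * g x := by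
  have cf : Continuous f := hf.continuous
  have cg : Continuous g := hg.continuous
  have cf' : Continuous (partialDeriv j f) := (hf.continuous_fderiv one_ne_zero).clm_apply continuous_const
  have cg' : Continuous (partialDeriv j g) := (hg.continuous_fderiv one_ne_zero).clm_apply continuous_const
  have hg'c : HasCompactSupport (partialDeriv j g) := hgc.fderiv_apply ℝ _
  exact integral_mul_fderiv_eq_neg_fderiv_mul_of_integrable
    ((cf'.mul cg).integrable_of_hasCompactSupport hgc.mul_left)
    ((cf.mul cg').integrable_of_hasCompactSupport hg'c.mul_left)
    ((cf.mul cg).integrable_of_hasCompactSupport hgc.mul_left)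
    (fun x _ => (hf.differentiable one_ne_zero x)) (fun x _ => (hg.differentiable one_ne_zero x))

theorem setIntegral_eq_of_eq_zero {m : Vec d → ℝ} (h : ∀ x, x ∉ Ω → m x = 0) :
    ∫ x in Ω, m x = ∫ x, m x := setIntegral_eq_integral_of_forall_compl_eq_zero h

end Test

/-! ### Classes in `L²` and weak gradients -/

section L2

variable {d : ℕ} {Ω : Set (Vec d)} {ι : Type} [Fintype ι]

theorem toL2_coeFn {w : Vec d → EuclideanSpace ℝ ι} (hw : MemLp w 2 (volume.restrict Ω)) :
    toL2 Ω w =ᵐ[volume.restrict Ω] w := by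
  rw [toL2, dif_pos hw]; exact hw.coeFn_toLp

theorem toL2_eq_toLp {w : Vec d → EuclideanSpace ℝ ι} (hw : MemLp w 2 (volume.restrict Ω)) :
    toL2 Ω w = hw.toLp w := by
  rw [toL2, dif_pos hw]

theorem toL2_add {w z : Vec d → EuclideanSpace ℝ ι} (hw : MemLp w 2 (volume.restrict Ω))
    (hz : MemLp z 2 (volume.restrict Ω)) : toL2 Ω (fun x => w x + z x) = toL2 Ω w + toL2 Ω z := by
  rw [toL2_eq_toLp hw, toL2_eq_toLp hz, ← MemLp.toLp_add]
  exact toL2_eq_toLp (hw.add hz)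

theorem toL2_const_smul (c : ℝ) {w : Vec d → EuclideanSpace ℝ ι}
    (hw : MemLp w 2 (volume.restrict Ω)) : toL2 Ω (fun x => c • w x) = c • toL2 Ω w := by
  rw [toL2_eq_toLp hw, ← MemLp.toLp_const_smul]
  exact toL2_eq_toLp (hw.const_smul c)

theorem toL2_zero : toL2 Ω (fun _ => 0 : Vec d → EuclideanSpace ℝ ι) = 0 := by
  have h : MemLp (fun _ => 0 : Vec d → EuclideanSpace ℝ ι) 2 (volume.restrict Ω) := MemLp.zero
  rw [toL2_eq_toLp h]
  exact MemLp.toLp_zero _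

theorem inner_eq_integral (u v : L2 Ω ι) : ⟪u, v⟫ = ∫ x in Ω, ∑ i, u x i * v x i := by
  rw [L2.inner_def]
  refine integral_congr_ae (ae_of_all _ fun x => ?_)
  simp [PiLp.inner_apply, mul_comm]

theorem memLp_apply (u : L2 Ω ι) (i : ι) : MemLp (fun x => u x i) 2 (volume.restrict Ω) :=
  (Lp.memLp u).continuousLinearMap_comp (EuclideanSpace.proj i : EuclideanSpace ℝ ι →L[ℝ] ℝ)

theorem integrable_mul {f g : Vec d → ℝ} (hf : MemLp f 2 (volume.restrict Ω))
    (hg : MemLp g 2 (volume.restrict Ω)) : Integrable (fun x => f x * g x) (volume.restrict Ω) :=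
  hf.integrable_mul hg

theorem inner_toL2_single [DecidableEq ι] (u : L2 Ω ι) {φ : Vec d → ℝ}
    (hφ : MemLp φ 2 (volume.restrict Ω)) (i : ι) :
    ⟪u, toL2 Ω (fun x => φ x • EuclideanSpace.single i (1 : ℝ))⟫ = ∫ x in Ω, u x i * φ x := by
  have hm : MemLp (fun x => φ x • EuclideanSpace.single i (1 : ℝ)) 2 (volume.restrict Ω) :=
    hφ.continuousLinearMap_comp ((ContinuousLinearMap.id ℝ ℝ).smulRight
      (EuclideanSpace.single i (1 : ℝ)))
  rw [inner_eq_integral]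
  refine integral_congr_ae ?_
  filter_upwards [toL2_coeFn hm] with x hx
  rw [hx]
  simp

theorem hasWeakGrad_iff_inner [DecidableEq ι] {u : L2 Ω ι} {g : L2 Ω (ι × Fin d)} :
    HasWeakGrad Ω u g ↔ ∀ ψ : Vec d → ℝ, IsTest Ω ψ → ∀ (i : ι) (j : Fin d),
      ⟪u, toL2 Ω (fun x => partialDeriv j ψ x • EuclideanSpace.single i (1 : ℝ))⟫ =
        -⟪g, toL2 Ω (fun x => ψ x • EuclideanSpace.single (i, j) (1 : ℝ))⟫ := by
  refine forall₄_congr fun ψ hψ i j => ?_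
  rw [inner_toL2_single u ((hψ.partialDeriv j).memLp 2 _), inner_toL2_single g (hψ.memLp 2 _)]

/-- Elements of `L²` are determined by their integrals against test functions. -/
theorem eq_zero_of_forall_test (hΩ : IsOpen Ω) {u : L2 Ω ι}
    (h : ∀ ψ : Vec d → ℝ, IsTest Ω ψ → ∀ i, ∫ x in Ω, u x i * ψ x = 0) : u = 0 := by
  rw [Lp.eq_zero_iff_ae_eq_zero]
  have h1 : ∀ i, ∀ᵐ x ∂volume.restrict Ω, u x i = 0 := by
    intro i
    rw [ae_restrict_iff' hΩ.measurableSet]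
    have hloc : LocallyIntegrableOn (fun x => u x i) Ω volume := by
      rw [locallyIntegrableOn_iff hΩ.isLocallyClosed]
      intro k hk hkc
      have hk1 : MemLp (fun x => u x i) 2 (volume.restrict k) :=
        (memLp_apply u i).mono_measure (Measure.restrict_mono hk le_rfl)
      have : IsFiniteMeasure (volume.restrict k) := ⟨by simpa using hkc.measure_lt_top⟩
      exact hk1.integrable (by norm_num)
    refine hΩ.ae_eq_zero_of_integral_contDiff_smul_eq_zero hloc fun ψ h1 h2 h3 => ?_
    rw [← h ψ ⟨h1, h2, h3⟩ i, setIntegral_eq_of_eq_zero fun x hx => by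
      rw [IsTest.eq_zero ⟨h1, h2, h3⟩ hx, mul_zero]]
    simp only [smul_eq_mul, mul_comm]
  filter_upwards [ae_all_iff.2 h1] with x hx
  ext i
  simpa using hx i

theorem dense_span_test [DecidableEq ι] (hΩ : IsOpen Ω) :
    (Submodule.span ℝ {h : L2 Ω ι | ∃ (ψ : Vec d → ℝ) (i : ι), IsTest Ω ψ ∧
      h = toL2 Ω (fun x => ψ x • EuclideanSpace.single i (1 : ℝ))}).topologicalClosure = ⊤ := by
  rw [Submodule.topologicalClosure_eq_top_iff, Submodule.eq_bot_iff]
  intro u hu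
  refine eq_zero_of_forall_test hΩ fun ψ hψ i => ?_
  rw [← inner_toL2_single u (hψ.memLp 2 _) i, real_inner_comm]
  exact (Submodule.mem_orthogonal _ _).1 hu _ (Submodule.subset_span ⟨ψ, i, hψ, rfl⟩)

theorem HasWeakGrad.unique (hΩ : IsOpen Ω) {u : L2 Ω ι} {g g' : L2 Ω (ι × Fin d)}
    (h : HasWeakGrad Ω u g) (h' : HasWeakGrad Ω u g') : g = g' := by
  classical
  rw [← sub_eq_zero]
  refine eq_zero_of_forall_test hΩ fun ψ hψ p => ?_
  have h1 := hasWeakGrad_iff_inner.1 h ψ hψ p.1 p.2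
  have h2 := hasWeakGrad_iff_inner.1 h' ψ hψ p.1 p.2
  rw [← inner_toL2_single _ (hψ.memLp 2 _) p, inner_sub_left]
  linarith

theorem HasWeakGrad.wgrad_eq (hΩ : IsOpen Ω) {u : L2 Ω ι} {g : L2 Ω (ι × Fin d)}
    (h : HasWeakGrad Ω u g) : wgrad u = g := by
  have hex : ∃ g, HasWeakGrad Ω u g := ⟨g, h⟩
  rw [wgrad, dif_pos hex]
  exact HasWeakGrad.unique hΩ hex.choose_spec h

theorem HasWeakGrad.sub {u v : L2 Ω ι} {g k : L2 Ω (ι × Fin d)}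
    (h : HasWeakGrad Ω u g) (h' : HasWeakGrad Ω v k) : HasWeakGrad Ω (u - v) (g - k) := by
  classical
  rw [hasWeakGrad_iff_inner] at *
  intro ψ hψ i j
  rw [inner_sub_left, inner_sub_left, h ψ hψ i j, h' ψ hψ i j]
  ring

theorem hasWeakGrad_toL2 {w : Vec d → Vec d} (hw : IsTest Ω w) :
    HasWeakGrad Ω (toL2 Ω w) (toL2 Ω (gradField w)) := by
  intro ψ hψ i j
  have e1 : ∫ x in Ω, toL2 Ω w x i * partialDeriv j ψ x = ∫ x, w x i * partialDeriv j ψ x := by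
    rw [← setIntegral_eq_of_eq_zero fun x hx => by rw [hw.eq_zero hx]; simp]
    refine integral_congr_ae ?_
    filter_upwards [toL2_coeFn (hw.memLp 2 _)] with x hx
    rw [hx]
  have e2 : ∫ x in Ω, toL2 Ω (gradField w) x (i, j) * ψ x = ∫ x, partialDeriv j w x i * ψ x := by
    rw [← setIntegral_eq_of_eq_zero fun x hx => by rw [hψ.eq_zero hx]; simp]
    refine integral_congr_ae ?_
    filter_upwards [toL2_coeFn (hw.gradField.memLp 2 _)] with x hx
    rw [hx, gradField_apply]
  rw [e1, e2, integral_mul_partialDeriv ((hw.apply i).1.of_le (by simp)) (hψ.1.of_le (by simp)) hψ.2.1]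
  simp only [partialDeriv_apply (hw.differentiable _)]

theorem wgrad_toL2 (hΩ : IsOpen Ω) {w : Vec d → Vec d} (hw : IsTest Ω w) :
    wgrad (toL2 Ω w) = toL2 Ω (gradField w) := (hasWeakGrad_toL2 hw).wgrad_eq hΩ

theorem isClosed_hasWeakGrad :
    IsClosed {p : L2 Ω ι × L2 Ω (ι × Fin d) | HasWeakGrad Ω p.1 p.2} := by
  classical
  simp only [hasWeakGrad_iff_inner, ofPred_forall]
  refine isClosed_iInter fun ψ => isClosed_iInter fun hψ => isClosed_iInter fun i =>
    isClosed_iInter fun j => isClosed_eq (by fun_prop) (by fun_prop)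

theorem gradField_add {w z : Vec d → Vec d} (hw : Differentiable ℝ w) (hz : Differentiable ℝ z) :
    gradField (fun x => w x + z x) = fun x => gradField w x + gradField z x := by
  ext x p
  simp [partialDeriv_add (hw x) (hz x)]

theorem gradField_const_smul (c : ℝ) {w : Vec d → Vec d} (hw : Differentiable ℝ w) :
    gradField (fun x => c • w x) = fun x => c • gradField w x := by
  ext x p
  simp [partialDeriv_const_smul (hw x)]

/-- The solenoidal test fields as a subspace of `L²`. -/
def solTestSubmodule (Ω : Set (Vec d)) : Submodule ℝ (L2 Ω (Fin d)) where
  carrier := {u | ∃ w, IsSolTest Ω w ∧ u = toL2 Ω w}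
  zero_mem' := ⟨_, IsSolTest.zero, toL2_zero.symm⟩
  add_mem' := by
    rintro _ _ ⟨w, hw, rfl⟩ ⟨z, hz, rfl⟩
    exact ⟨_, hw.add hz, (toL2_add (hw.1.memLp 2 _) (hz.1.memLp 2 _)).symm⟩
  smul_mem' := by
    rintro c _ ⟨w, hw, rfl⟩
    exact ⟨_, hw.const_smul c, (toL2_const_smul c (hw.1.memLp 2 _)).symm⟩

theorem mem_L2sigma_iff {u : L2 Ω (Fin d)} :
    u ∈ L2sigma Ω ↔ u ∈ (solTestSubmodule Ω).topologicalClosure := Iff.rfl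

theorem testPair_mem_H10 {w : Vec d → Vec d} (hw : IsTest Ω w) :
    (toL2 Ω w, toL2 Ω (gradField w)) ∈ H10 Ω :=
  Submodule.le_topologicalClosure _ (Submodule.subset_span ⟨w, hw, rfl⟩)

/-- `wgrad` takes the default value 0 where no weak gradient exists; closedness of the weak gradient
relation excludes this default on H¹_{0,σ}. -/
theorem hasWeakGrad_of_mem_H10sigma {u : L2 Ω (Fin d)} (hu : u ∈ H10sigma Ω) :
    HasWeakGrad Ω u (wgrad u) := by
  refine closure_minimal ?_ (isClosed_hasWeakGrad (Ω := Ω) (ι := Fin d)) hu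
  rintro _ ⟨w, hw, rfl⟩
  exact hasWeakGrad_toL2 hw.1

theorem mem_H10_of_mem_H10sigma {u : L2 Ω (Fin d)} (hu : u ∈ H10sigma Ω) :
    (u, wgrad u) ∈ H10 Ω := by
  refine closure_minimal ?_ (Submodule.isClosed_topologicalClosure _) hu
  rintro _ ⟨w, hw, rfl⟩
  exact testPair_mem_H10 hw.1

end L2

/-! ### Weak convergence of bounded families -/

section Weak

variable {H : Type*} [NormedAddCommGroup H] [InnerProductSpace ℝ H]

/-- Replacing z by a nearby s in the span costs at most (|C| + ‖y‖)‖z − s‖, uniformly along the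
filter. -/
theorem tendsto_inner_of_mem_closure_span {α : Type*} {l : Filter α} {S : Set H} {x : α → H} {y : H}
    {C : ℝ} (hb : ∀ᶠ n in l, ‖x n‖ ≤ C)
    (h : ∀ s ∈ S, Tendsto (fun n => ⟪x n, s⟫) l (𝓝 ⟪y, s⟫)) {z : H}
    (hz : z ∈ (Submodule.span ℝ S).topologicalClosure) :
    Tendsto (fun n => ⟪x n, z⟫) l (𝓝 ⟪y, z⟫) := by
  have hspan : ∀ s ∈ Submodule.span ℝ S, Tendsto (fun n => ⟪x n, s⟫) l (𝓝 ⟪y, s⟫) := by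
    intro s hs
    induction hs using Submodule.span_induction with
    | mem s hs => exact h s hs
    | zero => simpa using tendsto_const_nhds
    | add a b _ _ ha hb => simpa only [inner_add_right] using ha.add hb
    | smul c a _ ha => simpa only [inner_smul_right] using ha.const_mul c
  rw [Metric.tendsto_nhds]
  intro ε hε
  set K : ℝ := |C| + ‖y‖ + 1 with hK
  have hKpos : 0 < K := by positivity
  have hz' : z ∈ closure ((Submodule.span ℝ S : Submodule ℝ H) : Set H) := hz
  obtain ⟨s, hs, hsz⟩ := Metric.mem_closure_iff.1 hz' (ε / (2 * K)) (by positivity)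
  have h1 := Metric.tendsto_nhds.1 (hspan s hs) (ε / 2) (by positivity)
  filter_upwards [h1, hb] with n h2 h3
  rw [Real.dist_eq] at h2 ⊢
  rw [dist_eq_norm] at hsz
  have e1 : ⟪x n, z⟫ - ⟪y, z⟫ = ⟪x n - y, z - s⟫ + (⟪x n, s⟫ - ⟪y, s⟫) := by
    simp only [inner_sub_left, inner_sub_right]; ring
  have e2 : |⟪x n - y, z - s⟫| ≤ K * (ε / (2 * K)) := by
    refine (abs_real_inner_le_norm _ _).trans ?_
    refine mul_le_mul ?_ hsz.le (norm_nonneg _) hKpos.le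
    have := norm_sub_le (x n) y
    have := le_abs_self C
    linarith
  have e3 : K * (ε / (2 * K)) = ε / 2 := by field_simp
  rw [e1]
  calc _ ≤ |⟪x n - y, z - s⟫| + |⟪x n, s⟫ - ⟪y, s⟫| := abs_add_le _ _
    _ < ε := by rw [e3] at e2; linarith

end Weak

/-! ### Fields approximated by solenoidal test fields with bounded symmetric gradients -/

section Sym

variable {d : ℕ} {Ω : Set (Vec d)}

/-- The solenoidal test fields `φ n` converge to `u` in `L²(Ω)` and their symmetric gradients are
uniformly bounded. -/
structure SymApprox (Ω : Set (Vec d)) (φ : ℕ → Vec d → Vec d) (C : ℝ) (u : L2 Ω (Fin d)) :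
    Prop where
  isSolTest : ∀ n, IsSolTest Ω (φ n)
  bound : ∀ n x i j, |partialDeriv j (φ n) x i + partialDeriv i (φ n) x j| ≤ C
  tendsto : Tendsto (fun n => toL2 Ω (φ n)) atTop (𝓝 u)

theorem partialDeriv_comm {f : Vec d → ℝ} (hf : ContDiff ℝ ∞ f) (i j : Fin d) (x : Vec d) :
    partialDeriv i (partialDeriv j f) x = partialDeriv j (partialDeriv i f) x := by
  have hd : DifferentiableAt ℝ (fderiv ℝ f) x :=
    (hf.fderiv_right (m := ∞) le_rfl).differentiable (by simp) x
  have e : ∀ a b : Fin d, partialDeriv a (partialDeriv b f) x =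
      fderiv ℝ (fderiv ℝ f) x (EuclideanSpace.single a 1) (EuclideanSpace.single b 1) := by
    intro a b
    unfold partialDeriv
    rw [fderiv_clm_apply hd (differentiableAt_const _)]
    simp
  rw [e, e]
  exact (hf.contDiffAt.isSymmSndFDerivAt (by simpa using WithTop.coe_le_coe.2 (le_top : (2 : ℕ∞) ≤ ⊤))) _ _

theorem norm_sq_eq_integral {ι : Type} [Fintype ι] (u : L2 Ω ι) :
    ‖u‖ ^ 2 = ∫ x in Ω, ∑ i, u x i ^ 2 := by
  rw [← real_inner_self_eq_norm_sq, inner_eq_integral]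
  simp only [sq]

/-- Integrating by parts in xᵢ moves the derivative off φⱼ; second derivatives commute, and the sum
over i is ∂ⱼ(div φ) φⱼ = 0. -/
theorem IsSolTest.integral_grad_mul_grad_swap {φ : Vec d → Vec d} (hφ : IsSolTest Ω φ) (j : Fin d) :
    ∑ i, ∫ x, partialDeriv j φ x i * partialDeriv i φ x j = 0 := by
  have h1 : ∀ i, ∫ x, partialDeriv j φ x i * partialDeriv i φ x j =
      -∫ x, partialDeriv j (fun x => partialDeriv i φ x i) x * φ x j := by
    intro i
    have hsm : ContDiff ℝ ∞ (fun x => φ x i) := (hφ.1.apply i).1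
    have hpd : ∀ (k : Fin d), (fun x => partialDeriv k φ x i) = partialDeriv k (fun x => φ x i) := by
      intro k; ext x; rw [partialDeriv_apply (hφ.1.differentiable x)]
    have := integral_mul_partialDeriv (f := fun x => partialDeriv j φ x i) (g := fun x => φ x j)
      (((hφ.1.partialDeriv j).apply i).1.of_le (by simp)) ((hφ.1.apply j).1.of_le (by simp))
      (hφ.1.apply j).2.1 i
    simp only [partialDeriv_apply (hφ.1.differentiable _)] at this
    rw [this, hpd, hpd]
    simp only [partialDeriv_comm hsm i j]
  simp only [h1]
  rw [Finset.sum_neg_distrib, ← integral_finsetSum]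
  · rw [neg_eq_zero]
    refine integral_eq_zero_of_ae (ae_of_all _ fun x => ?_)
    simp only [Pi.zero_apply]
    rw [← Finset.sum_mul]
    have hdiv : ∑ i, partialDeriv j (fun x => partialDeriv i φ x i) x =
        partialDeriv j (fun x => ∑ i, partialDeriv i φ x i) x := by
      unfold partialDeriv
      rw [fderiv_fun_sum]
      · simp
      · intro i _
        exact ((hφ.1.partialDeriv i).apply i).differentiable x
    rw [hdiv]
    have : (fun x => ∑ i, partialDeriv i φ x i) = fun _ => 0 := funext hφ.2
    rw [this]
    simp [partialDeriv]
  · intro i _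
    exact (((((hφ.1.partialDeriv i).apply i).partialDeriv j).continuous).mul
      (hφ.1.apply j).continuous).integrable_of_hasCompactSupport (hφ.1.apply j).2.1.mul_left

/-- Korn's inequality for solenoidal test fields. -/
theorem IsSolTest.norm_grad_sq_le (hΩ : Bornology.IsBounded Ω) {φ : Vec d → Vec d}
    (hφ : IsSolTest Ω φ) {C : ℝ} (hC : ∀ x i j, |partialDeriv j φ x i + partialDeriv i φ x j| ≤ C) :
    ‖toL2 Ω (gradField φ)‖ ^ 2 ≤ d * d * C ^ 2 * volume.real Ω := by
  have hvol : volume Ω < ⊤ := hΩ.measure_lt_top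
  have hint : ∀ i j k l, Integrable (fun x => partialDeriv j φ x i * partialDeriv k φ x l)
      (volume : Measure (Vec d)) := fun i j k l =>
    (((hφ.1.partialDeriv j).apply i).continuous.mul
      ((hφ.1.partialDeriv k).apply l).continuous).integrable_of_hasCompactSupport
      ((hφ.1.partialDeriv k).apply l).2.1.mul_left
  have e0 : ‖toL2 Ω (gradField φ)‖ ^ 2 = ∑ j, ∑ i, ∫ x, partialDeriv j φ x i * partialDeriv j φ x i := by
    rw [norm_sq_eq_integral]
    have : ∫ x in Ω, ∑ p, toL2 Ω (gradField φ) x p ^ 2 =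
        ∫ x, ∑ j, ∑ i, partialDeriv j φ x i * partialDeriv j φ x i := by
      rw [← setIntegral_eq_of_eq_zero (Ω := Ω)]
      · refine integral_congr_ae ?_
        filter_upwards [toL2_coeFn (hφ.1.gradField.memLp 2 _)] with x hx
        rw [hx, Fintype.sum_prod_type, Finset.sum_comm]
        simp [sq]
      · intro x hx
        simp [(hφ.1.partialDeriv _).eq_zero hx]
    rw [this, integral_finsetSum _ fun j _ => integrable_finsetSum _ fun i _ => hint i j j i]
    refine Finset.sum_congr rfl fun j _ => ?_
    rw [integral_finsetSum _ fun i _ => hint i j j i]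
  have e1 : ∑ j, ∑ i, ∫ x, partialDeriv j φ x i * partialDeriv i φ x j = 0 :=
    Finset.sum_eq_zero fun j _ => hφ.integral_grad_mul_grad_swap j
  -- The integrand is the square (∂ⱼφᵢ + ∂ᵢφⱼ)². Summed over i and j the mixed terms integrate to
  -- zero by e1, and 2‖∇φ‖² remains.
  have e2 : ∀ i j : Fin d, ∫ x, (partialDeriv j φ x i * partialDeriv j φ x i +
      2 * (partialDeriv j φ x i * partialDeriv i φ x j) + partialDeriv i φ x j * partialDeriv i φ x j)
      ≤ C ^ 2 * volume.real Ω := by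
    intro i j
    rw [← setIntegral_eq_of_eq_zero (Ω := Ω) (fun x hx => by
      simp [(hφ.1.partialDeriv _).eq_zero hx])]
    have : ∫ x in Ω, C ^ 2 = C ^ 2 * volume.real Ω := by
      rw [setIntegral_const, smul_eq_mul, mul_comm]
    rw [← this]
    refine integral_mono_of_nonneg ?_ (by
      have : IsFiniteMeasure (volume.restrict Ω) := ⟨by simpa using hvol⟩
      exact integrable_const _) ?_
    · refine ae_of_all _ fun x => ?_
      simp only [Pi.zero_apply]
      nlinarith [sq_nonneg (partialDeriv j φ x i + partialDeriv i φ x j)]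
    · refine ae_of_all _ fun x => ?_
      have := sq_le_sq' (abs_le.1 (hC x i j)).1 (abs_le.1 (hC x i j)).2
      simp only
      nlinarith
  have e3 : ∑ j, ∑ i, ∫ x, (partialDeriv j φ x i * partialDeriv j φ x i +
      2 * (partialDeriv j φ x i * partialDeriv i φ x j) + partialDeriv i φ x j * partialDeriv i φ x j)
      ≤ d * d * C ^ 2 * volume.real Ω := by
    refine (Finset.sum_le_sum fun j _ => Finset.sum_le_sum fun i _ => e2 i j).trans (le_of_eq ?_)
    simp; ring
  have e4 : ∑ j, ∑ i, ∫ x, (partialDeriv j φ x i * partialDeriv j φ x i +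
      2 * (partialDeriv j φ x i * partialDeriv i φ x j) + partialDeriv i φ x j * partialDeriv i φ x j)
      = 2 * ‖toL2 Ω (gradField φ)‖ ^ 2 := by
    have : ∀ i j : Fin d, ∫ x, (partialDeriv j φ x i * partialDeriv j φ x i +
      2 * (partialDeriv j φ x i * partialDeriv i φ x j) + partialDeriv i φ x j * partialDeriv i φ x j)
      = (∫ x, partialDeriv j φ x i * partialDeriv j φ x i) +
        2 * (∫ x, partialDeriv j φ x i * partialDeriv i φ x j) +
        ∫ x, partialDeriv i φ x j * partialDeriv i φ x j := by
      intro i j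
      have i2 := (hint i j i j).const_mul 2
      have i12 : Integrable (fun x => partialDeriv j φ x i * partialDeriv j φ x i +
        2 * (partialDeriv j φ x i * partialDeriv i φ x j)) := (hint i j j i).add i2
      rw [integral_add i12 (hint j i i j), integral_add (hint i j j i) i2, integral_const_mul]
    simp only [this, Finset.sum_add_distrib, ← Finset.mul_sum, e1, ← e0]
    rw [Finset.sum_comm, ← e0]
    ring
  have : 0 ≤ ‖toL2 Ω (gradField φ)‖ ^ 2 := sq_nonneg _
  linarith

theorem SymApprox.norm_grad_le (hΩ : Bornology.IsBounded Ω)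
    {φ : ℕ → Vec d → Vec d} {C : ℝ} {u : L2 Ω (Fin d)} (h : SymApprox Ω φ C u) :
    ∃ K, ∀ n, ‖toL2 Ω (gradField (φ n))‖ ≤ K :=
  ⟨_, fun n => Real.le_sqrt_of_sq_le ((h.isSolTest n).norm_grad_sq_le hΩ (h.bound n))⟩

/-- A sequence of test fields that converges in `L²` and whose gradients converge weakly. -/
structure WeakApprox (Ω : Set (Vec d)) (φ : ℕ → Vec d → Vec d) (u : L2 Ω (Fin d))
    (g : L2 Ω (Fin d × Fin d)) : Prop where
  isSolTest : ∀ n, IsSolTest Ω (φ n)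
  tendsto : Tendsto (fun n => toL2 Ω (φ n)) atTop (𝓝 u)
  tendsto_grad : ∀ h, Tendsto (fun n => ⟪toL2 Ω (gradField (φ n)), h⟫) atTop (𝓝 ⟪g, h⟫)

/-- Korn's inequality bounds the gradients in L². Against the dense test fields an integration by
parts reduces their convergence to that of φ n. -/
theorem SymApprox.weakApprox (hΩ : Bornology.IsBounded Ω) (hΩo : IsOpen Ω)
    {φ : ℕ → Vec d → Vec d} {C : ℝ} {u : L2 Ω (Fin d)} (h : SymApprox Ω φ C u)
    {g : L2 Ω (Fin d × Fin d)} (hg : HasWeakGrad Ω u g) : WeakApprox Ω φ u g := by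
  refine ⟨h.isSolTest, h.tendsto, fun k => ?_⟩
  obtain ⟨K, hK⟩ := h.norm_grad_le hΩ
  refine tendsto_inner_of_mem_closure_span (S := {h : L2 Ω (Fin d × Fin d) |
    ∃ (ψ : Vec d → ℝ) (i : Fin d × Fin d), IsTest Ω ψ ∧
      h = toL2 Ω (fun x => ψ x • EuclideanSpace.single i (1 : ℝ))}) (Eventually.of_forall hK) ?_
    (by rw [dense_span_test hΩo]; trivial)
  rintro _ ⟨ψ, p, hψ, rfl⟩
  have h1 := hasWeakGrad_iff_inner.1 hg ψ hψ p.1 p.2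
  have h2 : ∀ n, ⟪toL2 Ω (gradField (φ n)), toL2 Ω (fun x => ψ x • EuclideanSpace.single p (1 : ℝ))⟫
      = -⟪toL2 Ω (φ n), toL2 Ω (fun x => partialDeriv p.2 ψ x • EuclideanSpace.single p.1 (1 : ℝ))⟫ := by
    intro n
    have := hasWeakGrad_iff_inner.1 (hasWeakGrad_toL2 (h.isSolTest n).1) ψ hψ p.1 p.2
    linarith
  simp only [h2]
  rw [show ⟪g, toL2 Ω (fun x => ψ x • EuclideanSpace.single p (1 : ℝ))⟫ =
    -⟪u, toL2 Ω (fun x => partialDeriv p.2 ψ x • EuclideanSpace.single p.1 (1 : ℝ))⟫ by linarith]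
  exact (h.tendsto.inner tendsto_const_nhds).neg

theorem WeakApprox.tendsto_clm {φ : ℕ → Vec d → Vec d} {u : L2 Ω (Fin d)}
    {g : L2 Ω (Fin d × Fin d)} (h : WeakApprox Ω φ u g)
    (F : L2 Ω (Fin d) × L2 Ω (Fin d × Fin d) →L[ℝ] ℝ) :
    Tendsto (fun n => F (toL2 Ω (φ n), toL2 Ω (gradField (φ n)))) atTop (𝓝 (F (u, g))) := by
  set F₂ := F.comp (ContinuousLinearMap.inr ℝ (L2 Ω (Fin d)) (L2 Ω (Fin d × Fin d))) with hF₂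
  set y := (InnerProductSpace.toDual ℝ (L2 Ω (Fin d × Fin d))).symm F₂
  have e : ∀ a b, F (a, b) = F (a, 0) + ⟪b, y⟫ := by
    intro a b
    have h1 : ⟪b, y⟫ = F (0, b) := by
      rw [real_inner_comm, InnerProductSpace.toDual_symm_apply]; rfl
    rw [h1, ← map_add]; simp
  simp only [e _ (toL2 Ω (gradField _)), e u g]
  refine Tendsto.add ?_ (h.tendsto_grad y)
  have : Continuous fun a : L2 Ω (Fin d) => F (a, 0) := by fun_prop
  exact (this.tendsto u).comp h.tendsto

/-- A closed subspace is weakly closed: a functional separating (u, g) strictly from H¹₀ would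
contradict the weak convergence of the pairs. -/
theorem WeakApprox.mem_H10 {φ : ℕ → Vec d → Vec d} {u : L2 Ω (Fin d)}
    {g : L2 Ω (Fin d × Fin d)} (h : WeakApprox Ω φ u g) : (u, g) ∈ H10 Ω := by
  by_contra hcon
  have hcl : IsClosed ((H10 Ω : Submodule ℝ _) : Set (L2 Ω (Fin d) × L2 Ω (Fin d × Fin d))) :=
    Submodule.isClosed_topologicalClosure _
  obtain ⟨F, c, h1, h2⟩ := geometric_hahn_banach_closed_point (H10 Ω).convex hcl hcon
  have h3 := le_of_tendsto (h.tendsto_clm F) (Eventually.of_forall fun n =>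
    (h1 _ (testPair_mem_H10 (h.isSolTest n).1)).le)
  linarith

/-- A Hahn–Banach extension of F to all pairs reduces this to `WeakApprox.tendsto_clm`. -/
theorem WeakApprox.tendsto_Hm1 {φ : ℕ → Vec d → Vec d} {u : L2 Ω (Fin d)}
    {g : L2 Ω (Fin d × Fin d)} (h : WeakApprox Ω φ u g) (F : Hm1 Ω) :
    Tendsto (fun n => F ⟨(toL2 Ω (φ n), toL2 Ω (gradField (φ n))),
      testPair_mem_H10 (h.isSolTest n).1⟩) atTop (𝓝 (F ⟨(u, g), h.mem_H10⟩)) := by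
  obtain ⟨F', hF', -⟩ := exists_extension_norm_eq (H10 Ω) F
  have := h.tendsto_clm F'
  rw [← hF']
  refine this.congr fun n => ?_
  rw [← hF']

end Sym

/-! ### Convection integrals -/

section Convection

/-- A bounded sequence of functions that converges weakly in `L²` converges when tested with
integrable functions. -/
theorem tendsto_integral_mul_of_bounded {X : Type*} [MeasurableSpace X] {μ : Measure X}
    [IsFiniteMeasure μ] {s : ℕ → X → ℝ} {s₀ : X → ℝ} {C : ℝ}
    (hsm : ∀ n, AEStronglyMeasurable (s n) μ) (hsm₀ : AEStronglyMeasurable s₀ μ)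
    (hb : ∀ n, ∀ᵐ x ∂μ, ‖s n x‖ ≤ C) (hb₀ : ∀ᵐ x ∂μ, ‖s₀ x‖ ≤ C)
    (hweak : ∀ k, MemLp k 2 μ → Tendsto (fun n => ∫ x, s n x * k x ∂μ) atTop (𝓝 (∫ x, s₀ x * k x ∂μ)))
    {h : X → ℝ} (hh : Integrable h μ) :
    Tendsto (fun n => ∫ x, s n x * h x ∂μ) atTop (𝓝 (∫ x, s₀ x * h x ∂μ)) := by
  rw [Metric.tendsto_nhds]
  intro ε hε
  set K : ℝ := |C| + 1 with hK
  have hKpos : 0 < K := by positivity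
  have hCK : C ≤ K := (le_abs_self C).trans (by linarith)
  -- A simple function is square integrable because μ is finite, so the weak convergence applies to
  -- g; the uniform bound on the sequence controls the error by C‖h − g‖₁.
  obtain ⟨g, hg1, hg2⟩ := (memLp_one_iff_integrable.2 hh).exists_simpleFunc_eLpNorm_sub_lt
    ENNReal.one_ne_top (ε := ENNReal.ofReal (ε / (4 * K))) (by
      simp only [ne_eq, ENNReal.ofReal_eq_zero, not_le]; positivity)
  have hgi : Integrable g μ := memLp_one_iff_integrable.1 hg2
  have hdi : Integrable (fun x => h x - g x) μ := hh.sub hgi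
  have hsmall : ∫ x, ‖h x - g x‖ ∂μ < ε / (4 * K) := by
    rw [integral_norm_eq_lintegral_enorm hdi.1]
    rw [eLpNorm_one_eq_lintegral_enorm] at hg1
    exact (ENNReal.toReal_lt_of_lt_ofReal hg1)
  have hg22 : MemLp g 2 μ := g.memLp_of_isFiniteMeasure 2 μ
  have hbd : ∀ {r : X → ℝ}, AEStronglyMeasurable r μ → (∀ᵐ x ∂μ, ‖r x‖ ≤ C) →
      |(∫ x, r x * h x ∂μ) - ∫ x, r x * g x ∂μ| ≤ ε / 4 := by
    intro r hr hrb
    have i1 : Integrable (fun x => r x * h x) μ := hh.bdd_mul hr hrb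
    have i2 : Integrable (fun x => r x * g x) μ := hgi.bdd_mul hr hrb
    rw [← integral_sub i1 i2]
    calc |∫ x, (r x * h x - r x * g x) ∂μ| ≤ ∫ x, ‖r x * h x - r x * g x‖ ∂μ := by
          rw [← Real.norm_eq_abs]; exact norm_integral_le_integral_norm _
      _ ≤ ∫ x, K * ‖h x - g x‖ ∂μ := by
          refine integral_mono_ae (i1.sub i2).norm (hdi.norm.const_mul K) ?_
          filter_upwards [hrb] with x hx
          rw [← mul_sub, norm_mul]
          exact mul_le_mul_of_nonneg_right (hx.trans hCK) (norm_nonneg _)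
      _ = K * ∫ x, ‖h x - g x‖ ∂μ := integral_const_mul _ _
      _ ≤ K * (ε / (4 * K)) := mul_le_mul_of_nonneg_left hsmall.le hKpos.le
      _ = ε / 4 := by field_simp
  filter_upwards [Metric.tendsto_nhds.1 (hweak g hg22) (ε / 4) (by positivity)] with n hn
  have h1 := hbd (hsm n) (hb n)
  have h2 := hbd hsm₀ hb₀
  rw [Real.dist_eq] at hn ⊢
  rw [abs_le] at h1 h2
  rw [abs_lt] at hn ⊢
  constructor <;> linarith [h1.1, h1.2, h2.1, h2.2, hn.1, hn.2]

variable {d : ℕ} {Ω : Set (Vec d)}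

/-- v ⊗ v is symmetric, so only the symmetric part of G enters; as soon as that part is bounded, its
product with the integrable v ⊗ v is integrable. -/
theorem convInt_self_eq (v : L2 Ω (Fin d)) {G : L2 Ω (Fin d × Fin d)} {C : ℝ}
    (hG : ∀ i j, ∀ᵐ x ∂volume.restrict Ω, ‖G x (i, j) + G x (j, i)‖ ≤ C) :
    convInt v G v = 1 / 2 * ∑ i, ∑ j, ∫ x in Ω, (G x (i, j) + G x (j, i)) * (v x i * v x j) := by
  have hint : ∀ i j, Integrable (fun x => (G x (i, j) + G x (j, i)) * (v x i * v x j))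
      (volume.restrict Ω) := fun i j =>
    (integrable_mul (memLp_apply v i) (memLp_apply v j)).bdd_mul
      ((memLp_apply G (i, j)).add (memLp_apply G (j, i))).1 (hG i j)
  simp_rw [← integral_finsetSum _ fun j _ => hint _ j]
  rw [← integral_finsetSum _ fun i _ => integrable_finsetSum _ fun j _ => hint i j,
    ← integral_const_mul]
  refine integral_congr_ae (ae_of_all _ fun x => ?_)
  simp only
  have h1 : ∑ i, ∑ j, (G x (i, j) + G x (j, i)) * (v x i * v x j) =
      (∑ i, ∑ j, G x (i, j) * (v x i * v x j)) + ∑ i, ∑ j, G x (j, i) * (v x i * v x j) := by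
    simp only [add_mul, Finset.sum_add_distrib]
  have h2 : ∑ i, ∑ j, G x (j, i) * (v x i * v x j) = ∑ i, ∑ j, G x (i, j) * (v x i * v x j) := by
    rw [Finset.sum_comm]
    refine Finset.sum_congr rfl fun i _ => Finset.sum_congr rfl fun j _ => by ring
  have h3 : ∑ i, ∑ j, v x j * G x (i, j) * v x i = ∑ i, ∑ j, G x (i, j) * (v x i * v x j) :=
    Finset.sum_congr rfl fun i _ => Finset.sum_congr rfl fun j _ => by ring
  rw [h1, h2, h3]
  ring

/-- Along a `SymApprox` this bound is uniform; it supplies the majorant for dominated convergence in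
`inner_eq_of_symApprox`. -/
theorem abs_convInt_self_le (v : L2 Ω (Fin d)) {G : L2 Ω (Fin d × Fin d)} {C : ℝ}
    (hG : ∀ i j, ∀ᵐ x ∂volume.restrict Ω, ‖G x (i, j) + G x (j, i)‖ ≤ C) :
    |convInt v G v| ≤ 1 / 2 * (d * (d * (|C| * ‖v‖ ^ 2))) := by
  rw [convInt_self_eq v hG, abs_mul, abs_of_pos (by norm_num : (0 : ℝ) < 1 / 2)]
  refine mul_le_mul_of_nonneg_left ?_ (by norm_num)
  have hij : ∀ i j, |∫ x in Ω, (G x (i, j) + G x (j, i)) * (v x i * v x j)| ≤ |C| * ‖v‖ ^ 2 := by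
    intro i j
    rw [norm_sq_eq_integral, ← integral_const_mul, ← Real.norm_eq_abs]
    refine norm_integral_le_of_norm_le (Integrable.const_mul (integrable_finsetSum _ fun k _ => ?_) _) ?_
    · simp only [sq]; exact integrable_mul (memLp_apply v k) (memLp_apply v k)
    · filter_upwards [hG i j] with x hx
      rw [norm_mul]
      refine mul_le_mul (hx.trans (le_abs_self C)) ?_ (norm_nonneg _) (abs_nonneg _)
      rw [Real.norm_eq_abs, abs_mul]
      have hi : v x i ^ 2 ≤ ∑ k, v x k ^ 2 :=
        Finset.single_le_sum (f := fun k => v x k ^ 2) (fun k _ => sq_nonneg _) (Finset.mem_univ i)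
      have hj : v x j ^ 2 ≤ ∑ k, v x k ^ 2 :=
        Finset.single_le_sum (f := fun k => v x k ^ 2) (fun k _ => sq_nonneg _) (Finset.mem_univ j)
      rw [← sq_abs] at hi hj
      nlinarith [sq_nonneg (|v x i| - |v x j|)]
  calc _ ≤ ∑ i : Fin d, |∑ j, ∫ x in Ω, (G x (i, j) + G x (j, i)) * (v x i * v x j)| :=
        Finset.abs_sum_le_sum_abs _ _
    _ ≤ ∑ i : Fin d, ∑ j : Fin d, |C| * ‖v‖ ^ 2 := Finset.sum_le_sum fun i _ =>
        (Finset.abs_sum_le_sum_abs _ _).trans (Finset.sum_le_sum fun j _ => hij i j)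
    _ = _ := by simp

theorem SymApprox.bound_ae {φ : ℕ → Vec d → Vec d} {C : ℝ} {u : L2 Ω (Fin d)}
    (h : SymApprox Ω φ C u) (n : ℕ) (i j : Fin d) : ∀ᵐ x ∂volume.restrict Ω,
      ‖toL2 Ω (gradField (φ n)) x (i, j) + toL2 Ω (gradField (φ n)) x (j, i)‖ ≤ C := by
  filter_upwards [toL2_coeFn ((h.isSolTest n).1.gradField.memLp 2 _)] with x hx
  rw [hx]
  exact h.bound n x i j

theorem ae_norm_le_norm_Linf {X E : Type*} [MeasurableSpace X] {μ : Measure X}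
    [NormedAddCommGroup E] (Γ : Lp E ⊤ μ) : ∀ᵐ x ∂μ, ‖Γ x‖ ≤ ‖Γ‖ := by
  filter_upwards [ae_le_eLpNormEssSup (f := Γ) (μ := μ)] with x hx
  rw [← eLpNorm_exponent_top] at hx
  rw [Lp.norm_def, ← toReal_enorm]
  exact ENNReal.toReal_mono (Lp.eLpNorm_ne_top Γ) hx

theorem bound_sym_of_ae_eq {g : L2 Ω (Fin d × Fin d)} {Γ : Lp (Mat d) ⊤ (volume.restrict Ω)}
    (hg : Γ =ᵐ[volume.restrict Ω] g) (i j : Fin d) : ∀ᵐ x ∂volume.restrict Ω,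
      ‖g x (i, j) + g x (j, i)‖ ≤ 2 * ‖Γ‖ := by
  filter_upwards [hg, ae_norm_le_norm_Linf Γ] with x hx hn
  rw [hx] at hn
  have h1 := PiLp.norm_apply_le (g x) (i, j)
  have h2 := PiLp.norm_apply_le (g x) (j, i)
  refine (norm_add_le _ _).trans ?_
  linarith

/-- The symmetric gradients converge weakly in L² and are bounded in L^∞, which suffices against the
merely integrable products vᵢ vⱼ. -/
theorem SymApprox.tendsto_convInt (hΩ : Bornology.IsBounded Ω) (hΩo : IsOpen Ω)
    {φ : ℕ → Vec d → Vec d} {C : ℝ} {u : L2 Ω (Fin d)} (h : SymApprox Ω φ C u)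
    {g : L2 Ω (Fin d × Fin d)} (hg : HasWeakGrad Ω u g) {Γ : Lp (Mat d) ⊤ (volume.restrict Ω)}
    (hΓ : Γ =ᵐ[volume.restrict Ω] g) (v : L2 Ω (Fin d)) :
    Tendsto (fun n => convInt v (toL2 Ω (gradField (φ n))) v) atTop (𝓝 (convInt v g v)) := by
  have hfin : IsFiniteMeasure (volume.restrict Ω) := ⟨by simpa using hΩ.measure_lt_top⟩
  simp only [convInt_self_eq v (h.bound_ae _), convInt_self_eq v (bound_sym_of_ae_eq hΓ)]
  refine Tendsto.const_mul _ (tendsto_finsetSum _ fun i _ => tendsto_finsetSum _ fun j _ => ?_)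
  refine tendsto_integral_mul_of_bounded
    (s := fun n x => toL2 Ω (gradField (φ n)) x (i, j) + toL2 Ω (gradField (φ n)) x (j, i))
    (s₀ := fun x => g x (i, j) + g x (j, i)) (C := max C (2 * ‖Γ‖))
    (fun n => ((memLp_apply _ (i, j)).add (memLp_apply _ (j, i))).1)
    ((memLp_apply _ (i, j)).add (memLp_apply _ (j, i))).1
    (fun n => (h.bound_ae n i j).mono fun x hx => hx.trans (le_max_left _ _))
    ((bound_sym_of_ae_eq hΓ i j).mono fun x hx => hx.trans (le_max_right _ _)) ?_
    (integrable_mul (memLp_apply v i) (memLp_apply v j))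
  intro k hk
  have e : ∀ G : L2 Ω (Fin d × Fin d), ∫ x in Ω, (G x (i, j) + G x (j, i)) * k x =
      ⟪G, toL2 Ω (fun x => k x • EuclideanSpace.single (i, j) (1 : ℝ))⟫ +
      ⟪G, toL2 Ω (fun x => k x • EuclideanSpace.single (j, i) (1 : ℝ))⟫ := by
    intro G
    rw [inner_toL2_single G hk, inner_toL2_single G hk, ← integral_add
      (integrable_mul (memLp_apply G _) hk) (integrable_mul (memLp_apply G _) hk)]
    simp only [add_mul]
  simp only [e]
  have hw := h.weakApprox hΩ hΩo hg
  exact (hw.tendsto_grad _).add (hw.tendsto_grad _)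

/-! ### The convection integral as a continuous form -/

/-- The tensor product `(a, b) ↦ ((i, j) ↦ b i * a j)`. -/
def tensorCLM (d : ℕ) : Vec d →L[ℝ] Vec d →L[ℝ] Mat d :=
  (LinearMap.mk₂ ℝ (fun a b : Vec d => (WithLp.toLp 2 fun p : Fin d × Fin d => b p.1 * a p.2 : Mat d))
    (fun a a' b => by ext p; simp [mul_add]) (fun c a b => by ext p; simp; ring)
    (fun a b b' => by ext p; simp [add_mul]) (fun c a b => by ext p; simp; ring)).toContinuousBilinearMap

@[simp]
theorem tensorCLM_apply (a b : Vec d) (p : Fin d × Fin d) : tensorCLM d a b p = b p.1 * a p.2 := rfl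

/-- `b ⊗ a` as an integrable function. -/
def tensorL1 (Ω : Set (Vec d)) :
    L2 Ω (Fin d) →L[ℝ] L2 Ω (Fin d) →L[ℝ] Lp (Mat d) 1 (volume.restrict Ω) :=
  (tensorCLM d).holderL (volume.restrict Ω) 2 2 1

/-- Pairing of integrable with bounded matrix fields. -/
def pairL1Linf (Ω : Set (Vec d)) :
    Lp (Mat d) 1 (volume.restrict Ω) →L[ℝ] Lp (Mat d) ⊤ (volume.restrict Ω) →L[ℝ] ℝ :=
  (innerSL ℝ).lpPairing (volume.restrict Ω) 1 ⊤

/-- As a bounded trilinear expression, with the gradient in L^∞, the convection integral is visibly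
linear in a and c, and its measurability and integrability in time follow from those of the factors.
-/
theorem convInt_eq_pair (a c : L2 Ω (Fin d)) {g : L2 Ω (Fin d × Fin d)}
    {Γ : Lp (Mat d) ⊤ (volume.restrict Ω)} (hΓ : Γ =ᵐ[volume.restrict Ω] g) :
    convInt a g c = pairL1Linf Ω (tensorL1 Ω a c) Γ := by
  rw [pairL1Linf, ContinuousLinearMap.lpPairing_eq_integral, convInt]
  refine integral_congr_ae ?_
  have h1 := (tensorCLM d).coeFn_holder (r := 1) a c
  filter_upwards [hΓ, h1] with x h2 h3
  have h4 : tensorL1 Ω a c x = tensorCLM d (a x) (c x) := h3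
  rw [h4, h2]
  change _ = (innerSL ℝ) (tensorCLM d (a x) (c x)) (g x)
  simp only [innerSL_apply_apply, PiLp.inner_apply, RCLike.inner_apply, conj_trivial,
    Fintype.sum_prod_type, tensorCLM_apply]
  refine Finset.sum_congr rfl fun i _ => Finset.sum_congr rfl fun j _ => by ring

end Convection

/-! ### Antisymmetry of the convection integral -/

section Antisymmetry

variable {d : ℕ} {Ω : Set (Vec d)}

theorem symInt_eq_convInt (u : L2 Ω (Fin d)) (G : L2 Ω (Fin d × Fin d)) :
    symInt u G = convInt u G u := by
  refine integral_congr_ae (ae_of_all _ fun x => ?_)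
  simp only
  have h2 : ∑ i, ∑ j, u x i * G x (j, i) * u x j = ∑ i, ∑ j, u x i * G x (i, j) * u x j := by
    rw [Finset.sum_comm]
    exact Finset.sum_congr rfl fun i _ => Finset.sum_congr rfl fun j _ => by ring
  have h1 : ∑ i, ∑ j, u x i * (1 / 2 * (G x (i, j) + G x (j, i))) * u x j =
      1 / 2 * (∑ i, ∑ j, u x i * G x (i, j) * u x j) +
      1 / 2 * ∑ i, ∑ j, u x i * G x (j, i) * u x j := by
    simp only [Finset.mul_sum, ← Finset.sum_add_distrib]
    exact Finset.sum_congr rfl fun i _ => Finset.sum_congr rfl fun j _ => by ring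
  have h3 : ∑ i, ∑ j, u x j * G x (i, j) * u x i = ∑ i, ∑ j, u x i * G x (i, j) * u x j :=
    Finset.sum_congr rfl fun i _ => Finset.sum_congr rfl fun j _ => by ring
  rw [h1, h2, h3]
  ring

theorem memLp_mul_bounded {f g : Vec d → ℝ} (hf : MemLp f 2 (volume.restrict Ω))
    (hg : MemLp g ⊤ (volume.restrict Ω)) : MemLp (fun x => f x * g x) 2 (volume.restrict Ω) :=
  hg.mul hf

theorem memLp_top_apply_of_ae_eq {ι : Type} [Fintype ι] {c : L2 Ω ι}
    {V : Lp (EuclideanSpace ℝ ι) ⊤ (volume.restrict Ω)} (hV : V =ᵐ[volume.restrict Ω] c) (i : ι) :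
    MemLp (fun x => c x i) ⊤ (volume.restrict Ω) :=
  ((Lp.memLp V).ae_eq hV).eval_piLp i

/-- The convection integral is an inner product with respect to its first argument. -/
theorem convInt_eq_inner_left {G : L2 Ω (Fin d × Fin d)} {c : L2 Ω (Fin d)}
    (h : ∀ i j, MemLp (fun x => G x (i, j) * c x i) 2 (volume.restrict Ω)) :
    ∃ k : L2 Ω (Fin d), ∀ a, convInt a G c = ⟪a, k⟫ := by
  have hm : MemLp (fun x => (WithLp.toLp 2 fun j => ∑ i, G x (i, j) * c x i : Vec d)) 2
      (volume.restrict Ω) := MemLp.of_eval_piLp fun j => by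
    simpa using memLp_finsetSum Finset.univ fun i _ => h i j
  refine ⟨hm.toLp _, fun a => ?_⟩
  rw [inner_eq_integral]
  refine integral_congr_ae ?_
  filter_upwards [hm.coeFn_toLp] with x hx
  rw [hx, Finset.sum_comm]
  refine Finset.sum_congr rfl fun j _ => ?_
  simp only [Finset.mul_sum]
  exact Finset.sum_congr rfl fun i _ => by ring

/-- The convection integral is an inner product with respect to the gradient. -/
theorem convInt_eq_inner_grad {a c : L2 Ω (Fin d)}
    (h : ∀ i j, MemLp (fun x => a x j * c x i) 2 (volume.restrict Ω)) :
    ∃ k : L2 Ω (Fin d × Fin d), ∀ G, convInt a G c = ⟪G, k⟫ := by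
  have hm : MemLp (fun x => (WithLp.toLp 2 fun p : Fin d × Fin d => a x p.2 * c x p.1 : Mat d)) 2
      (volume.restrict Ω) := MemLp.of_eval_piLp fun p => h p.1 p.2
  refine ⟨hm.toLp _, fun G => ?_⟩
  rw [inner_eq_integral]
  refine integral_congr_ae ?_
  filter_upwards [hm.coeFn_toLp] with x hx
  rw [hx, Fintype.sum_prod_type]
  exact Finset.sum_congr rfl fun i _ => Finset.sum_congr rfl fun j _ => by ring

/-- The convection integral is an inner product with respect to its last argument. -/
theorem convInt_eq_inner_right {a : L2 Ω (Fin d)} {G : L2 Ω (Fin d × Fin d)}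
    (h : ∀ i j, MemLp (fun x => a x j * G x (i, j)) 2 (volume.restrict Ω)) :
    ∃ k : L2 Ω (Fin d), ∀ c, convInt a G c = ⟪c, k⟫ := by
  have hm : MemLp (fun x => (WithLp.toLp 2 fun i => ∑ j, a x j * G x (i, j) : Vec d)) 2
      (volume.restrict Ω) := MemLp.of_eval_piLp fun i => by
    simpa using memLp_finsetSum Finset.univ fun j _ => h i j
  refine ⟨hm.toLp _, fun c => ?_⟩
  rw [inner_eq_integral]
  refine integral_congr_ae ?_
  filter_upwards [hm.coeFn_toLp] with x hx
  rw [hx]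
  refine Finset.sum_congr rfl fun i _ => ?_
  simp only [Finset.mul_sum]
  exact Finset.sum_congr rfl fun j _ => by ring

/-- Since div α = 0, summing ∂ⱼ(αⱼ βᵢ) over j gives (α·∇)βᵢ; the identity is the definition of the
weak gradient of c tested with αⱼ βᵢ. -/
theorem convInt_antisymm_test {α β : Vec d → Vec d} (hα : IsSolTest Ω α) (hβ : IsTest Ω β)
    {c : L2 Ω (Fin d)} {g : L2 Ω (Fin d × Fin d)} (hg : HasWeakGrad Ω c g) :
    convInt (toL2 Ω α) (toL2 Ω (gradField β)) c = -convInt (toL2 Ω α) g (toL2 Ω β) := by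
  have hpr : ∀ i j, IsTest Ω (fun x => α x j * β x i) := fun i j =>
    (hβ.apply i).smul (hα.1.apply j).1
  have hw := fun i j => hg _ (hpr i j) i j
  have e1 : convInt (toL2 Ω α) (toL2 Ω (gradField β)) c =
      ∑ i, ∑ j, ∫ x in Ω, c x i * partialDeriv j (fun x => α x j * β x i) x := by
    have hI : ∀ i j, Integrable (fun x => c x i * partialDeriv j (fun x => α x j * β x i) x)
        (volume.restrict Ω) := fun i j =>
      integrable_mul (memLp_apply c i) (((hpr i j).partialDeriv j).memLp 2 _)
    simp_rw [← integral_finsetSum _ fun j _ => hI _ j]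
    rw [← integral_finsetSum _ fun i _ => integrable_finsetSum _ fun j _ => hI i j]
    refine integral_congr_ae ?_
    filter_upwards [toL2_coeFn (hα.1.memLp 2 _), toL2_coeFn (hβ.gradField.memLp 2 _)] with x h1 h2
    rw [h1, h2]
    refine Finset.sum_congr rfl fun i _ => ?_
    have hp : ∀ j, partialDeriv j (fun x => α x j * β x i) x =
        partialDeriv j α x j * β x i + α x j * partialDeriv j β x i := fun j => by
      rw [partialDeriv_mul ((hα.1.apply j).differentiable x) ((hβ.apply i).differentiable x),
        partialDeriv_apply (hα.1.differentiable x), partialDeriv_apply (hβ.differentiable x)]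
    simp only [hp, mul_add, Finset.sum_add_distrib]
    have h0 : ∑ j, c x i * (partialDeriv j α x j * β x i) = 0 := by
      rw [← Finset.mul_sum, ← Finset.sum_mul, hα.2 x]; simp
    rw [h0, zero_add]
    exact Finset.sum_congr rfl fun j _ => by simp only [gradField_apply]; ring
  have e2 : convInt (toL2 Ω α) g (toL2 Ω β) =
      ∑ i, ∑ j, ∫ x in Ω, g x (i, j) * (α x j * β x i) := by
    have hI : ∀ i j, Integrable (fun x => g x (i, j) * (α x j * β x i))
        (volume.restrict Ω) := fun i j =>
      integrable_mul (memLp_apply g (i, j)) ((hpr i j).memLp 2 _)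
    simp_rw [← integral_finsetSum _ fun j _ => hI _ j]
    rw [← integral_finsetSum _ fun i _ => integrable_finsetSum _ fun j _ => hI i j]
    refine integral_congr_ae ?_
    filter_upwards [toL2_coeFn (hα.1.memLp 2 _), toL2_coeFn (hβ.memLp 2 _)] with x h1 h2
    rw [h1, h2]
    exact Finset.sum_congr rfl fun i _ => Finset.sum_congr rfl fun j _ => by ring
  rw [e1, e2]
  simp only [hw, Finset.sum_neg_distrib]

/-- Two successive limits. Boundedness of c and of its gradient makes both sides L²-continuous in a,
so a may be a solenoidal test field. Then a is bounded, both sides are continuous under the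
convergence of φ n to b, and the case of test fields applies. -/
theorem convInt_antisymm {a b c : L2 Ω (Fin d)} {gb gc : L2 Ω (Fin d × Fin d)}
    (ha : a ∈ L2sigma Ω) {φ : ℕ → Vec d → Vec d} (hb : WeakApprox Ω φ b gb)
    (hc : HasWeakGrad Ω c gc) {V : Lp (Vec d) ⊤ (volume.restrict Ω)}
    (hV : V =ᵐ[volume.restrict Ω] c) {Γ : Lp (Mat d) ⊤ (volume.restrict Ω)}
    (hΓ : Γ =ᵐ[volume.restrict Ω] gc) : convInt a gb c = -convInt a gc b := by
  obtain ⟨k₁, hk₁⟩ := convInt_eq_inner_left (G := gb) (c := c) fun i j =>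
    memLp_mul_bounded (memLp_apply gb (i, j)) (memLp_top_apply_of_ae_eq hV i)
  obtain ⟨k₂, hk₂⟩ := convInt_eq_inner_left (G := gc) (c := b) fun i j => by
    simpa only [mul_comm] using
      memLp_mul_bounded (memLp_apply b i) (memLp_top_apply_of_ae_eq hΓ (i, j))
  have hcl : IsClosed {a : L2 Ω (Fin d) | convInt a gb c = -convInt a gc b} := by
    simp only [hk₁, hk₂]
    exact isClosed_eq (by fun_prop) (by fun_prop)
  refine closure_minimal ?_ hcl ha
  rintro _ ⟨α, hα, rfl⟩
  have hαt : ∀ j, MemLp (fun x => toL2 Ω α x j) ⊤ (volume.restrict Ω) := fun j =>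
    ((hα.1.apply j).memLp ⊤ _).ae_eq (by
      filter_upwards [toL2_coeFn (hα.1.memLp 2 _)] with x hx
      rw [hx])
  obtain ⟨k₃, hk₃⟩ := convInt_eq_inner_grad (a := toL2 Ω α) (c := c) fun i j => by
    simpa only [mul_comm] using memLp_mul_bounded (memLp_apply c i) (hαt j)
  obtain ⟨k₄, hk₄⟩ := convInt_eq_inner_right (a := toL2 Ω α) (G := gc) fun i j => by
    simpa only [mul_comm] using memLp_mul_bounded (memLp_apply gc (i, j)) (hαt j)
  have h1 : Tendsto (fun n => convInt (toL2 Ω α) (toL2 Ω (gradField (φ n))) c) atTop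
      (𝓝 (convInt (toL2 Ω α) gb c)) := by
    simp only [hk₃]; exact hb.tendsto_grad k₃
  have h2 : Tendsto (fun n => -convInt (toL2 Ω α) gc (toL2 Ω (φ n))) atTop
      (𝓝 (-convInt (toL2 Ω α) gc b)) := by
    simp only [hk₄]; exact (hb.tendsto.inner tendsto_const_nhds).neg
  refine tendsto_nhds_unique h1 (h2.congr fun n => ?_)
  rw [convInt_antisymm_test hα (hb.isSolTest n).1 hc]

/-- Elements of `H¹_{0,σ}` are approximated by solenoidal test fields. -/
theorem exists_weakApprox_of_mem_H10sigma {u : L2 Ω (Fin d)} (hu : u ∈ H10sigma Ω) :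
    ∃ φ, WeakApprox Ω φ u (wgrad u) := by
  obtain ⟨p, hp, hlim⟩ := mem_closure_iff_seq_limit.1 (show (u, wgrad u) ∈ closure _ from hu)
  choose φ hφ hpφ using hp
  refine ⟨φ, hφ, ?_, fun h => ?_⟩
  · have := (continuous_fst.tendsto _).comp hlim
    refine this.congr fun n => ?_
    simp [hpφ n]
  · have := Tendsto.inner (𝕜 := ℝ) ((continuous_snd.tendsto _).comp hlim)
      (tendsto_const_nhds (x := h))
    refine this.congr fun n => ?_
    simp [hpφ n]

end Antisymmetry

/-! ### Pointwise bounds from integral bounds on solenoidal test fields -/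

section Localization

variable {d : ℕ} {Ω : Set (Vec d)}

theorem sum_coord_smul_partialDeriv {F : Type} [NormedAddCommGroup F] [NormedSpace ℝ F]
    (φ : Vec d → F) (x z : Vec d) : ∑ j, z j • partialDeriv j φ x = fderiv ℝ φ x z := by
  have hz : z = ∑ j, z j • EuclideanSpace.single j (1 : ℝ) := by
    ext i
    simp [Finset.sum_apply, Pi.single_apply]
  conv_rhs => rw [hz, map_sum]
  simp [partialDeriv]

/-- The solenoidal field `(∂_k g) a - (∂_a g) k`. -/
def rotField (g : Vec d → ℝ) (a k : Vec d) (x : Vec d) : Vec d :=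
  fderiv ℝ g x k • a - fderiv ℝ g x a • k

/-- The divergence is D²g(a,k) − D²g(k,a), which vanishes by symmetry of second derivatives. -/
theorem isSolTest_rotField {g : Vec d → ℝ} (hg : IsTest Ω g) (a k : Vec d) :
    IsSolTest Ω (rotField g a k) := by
  have hf : ContDiff ℝ ∞ (fderiv ℝ g) := hg.1.fderiv_right (m := ∞) le_rfl
  have hsm : ContDiff ℝ ∞ (rotField g a k) :=
    ((hf.clm_apply contDiff_const).smul contDiff_const).sub
      ((hf.clm_apply contDiff_const).smul contDiff_const)
  refine ⟨hg.of_eq_zero hsm ((closure_mono fun x hx => ?_).trans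
    (tsupport_fderiv_subset ℝ (f := g))), fun x => ?_⟩
  · rw [Function.mem_support] at hx ⊢
    intro h
    simp [rotField, h] at hx
  · have hd : DifferentiableAt ℝ (fderiv ℝ g) x := hf.differentiable (by simp) x
    have hp : ∀ i, partialDeriv i (rotField g a k) x =
        fderiv ℝ (fderiv ℝ g) x (EuclideanSpace.single i 1) k • a -
        fderiv ℝ (fderiv ℝ g) x (EuclideanSpace.single i 1) a • k := by
      intro i
      have h1 : ∀ z : Vec d, HasFDerivAt (fun x => fderiv ℝ g x z)
          ((fderiv ℝ (fderiv ℝ g) x).flip z) x := fun z => by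
        simpa using hd.hasFDerivAt.clm_apply (hasFDerivAt_const z x)
      have h2 : HasFDerivAt (rotField g a k) _ x :=
        ((h1 k).smul_const a).sub ((h1 a).smul_const k)
      rw [partialDeriv, h2.fderiv]
      simp
    simp only [hp, PiLp.sub_apply, PiLp.smul_apply, smul_eq_mul, Finset.sum_sub_distrib]
    have h3 : ∀ y z : Vec d, ∑ i, fderiv ℝ (fderiv ℝ g) x (EuclideanSpace.single i 1) y * z i =
        fderiv ℝ (fderiv ℝ g) x z y := by
      intro y z
      have := sum_coord_smul_partialDeriv (fderiv ℝ g) x z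
      rw [← this]
      simp [partialDeriv, mul_comm]
    rw [h3, h3, (hg.1.contDiffAt.isSymmSndFDerivAt
      (by simpa using WithTop.coe_le_coe.2 (le_top : (2 : ℕ∞) ≤ ⊤))) a k, sub_self]

/-- The quadratic form `z ↦ z · (∇φ(x) + κ/2) z`. -/
def strainForm (φ : Vec d → Vec d) (κ : ℝ) (x z : Vec d) : ℝ :=
  ⟪fderiv ℝ φ x z, z⟫ + κ / 2 * ‖z‖ ^ 2

/-- The two arguments differ by a quarter period in θ. The cross terms cancel and sin² + cos² = 1
removes the oscillation, so no averaging over θ is needed. -/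
theorem strainForm_rotate (φ : Vec d → Vec d) (κ : ℝ) (x a r : Vec d) (α β θ : ℝ) :
    strainForm φ κ x ((α * Real.cos θ) • a + (β * Real.sin θ) • r) +
      strainForm φ κ x (-(α * Real.sin θ) • a + (β * Real.cos θ) • r) =
    α ^ 2 * strainForm φ κ x a + β ^ 2 * strainForm φ κ x r := by
  have h := Real.sin_sq_add_cos_sq θ
  have hc : Real.cos θ ^ 2 = 1 - Real.sin θ ^ 2 := by linarith
  simp only [strainForm, ← real_inner_self_eq_norm_sq, map_add, map_smul, inner_add_left,
    inner_add_right, inner_smul_left, inner_smul_right, RCLike.conj_to_real]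
  rw [real_inner_comm a r]
  ring_nf
  rw [hc]
  ring

theorem continuous_strainForm {φ : Vec d → Vec d} (hφ : ContDiff ℝ ∞ φ) (κ : ℝ) {z : Vec d → Vec d}
    (hz : Continuous z) : Continuous fun x => strainForm φ κ x (z x) := by
  have h1 : Continuous fun x => fderiv ℝ φ x (z x) :=
    (hφ.continuous_fderiv (by simp)).clm_apply hz
  unfold strainForm
  fun_prop

theorem fderiv_mul_trig {ρ : Vec d → ℝ} (hρ : Differentiable ℝ ρ) (k : Vec d) {N : ℝ} (hN : N ≠ 0)
    {τ τ' : ℝ → ℝ} (hτ : ∀ θ, HasDerivAt τ (τ' θ) θ) (x z : Vec d) :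
    fderiv ℝ (fun x => ρ x * (N⁻¹ * τ (N * ⟪k, x⟫))) x z =
      ρ x * τ' (N * ⟪k, x⟫) * ⟪k, z⟫ + N⁻¹ * τ (N * ⟪k, x⟫) * fderiv ℝ ρ x z := by
  have h1 : HasFDerivAt (fun x : Vec d => N * ⟪k, x⟫) (N • innerSL ℝ k) x :=
    ((innerSL ℝ k).hasFDerivAt (x := x)).const_mul N
  have h2 := ((hτ (N * ⟪k, x⟫)).comp_hasFDerivAt x h1).const_mul N⁻¹
  have h3 := ((hρ x).hasFDerivAt.mul h2).fderiv
  rw [show (fun x => ρ x * (N⁻¹ * τ (N * ⟪k, x⟫))) =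
    (ρ * fun x => N⁻¹ * (τ ∘ fun x : Vec d => N * ⟪k, x⟫) x) from rfl, h3]
  simp
  field_simp

/-- The test fields are the `rotField`s of ρ M⁻¹ sin(M k·x) and ρ M⁻¹ cos(M k·x). As k ⟂ a, their
leading parts are ρ‖k‖² cos(M k·x) a and −ρ‖k‖² sin(M k·x) a, and the rest is of order M⁻¹. By
`strainForm_rotate` the two nonnegative integrals add up to ‖k‖⁴ ∫ ρ² strainForm(a) + M⁻² J. Letting
M tend to infinity and then concentrating ρ near x₀ gives the pointwise sign. -/
theorem strainForm_nonneg_of_integral {φ : Vec d → Vec d} (hφ : ContDiff ℝ ∞ φ)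
    (hΩ : IsOpen Ω) {κ : ℝ}
    (h : ∀ ψ, IsSolTest Ω ψ → 0 ≤ ∫ x, strainForm φ κ x (ψ x)) {x₀ : Vec d} (hx₀ : x₀ ∈ Ω)
    {a k : Vec d} (hak : ⟪k, a⟫ = 0) (hk : k ≠ 0) : 0 ≤ strainForm φ κ x₀ a := by
  have hloc : ∀ ρ, IsTest Ω ρ → 0 ≤ ∫ x, ρ x ^ 2 * strainForm φ κ x a := by
    intro ρ hρ
    set r : Vec d → Vec d := rotField ρ a k with hr
    have hrt := isSolTest_rotField hρ a k
    set I := ∫ x, ρ x ^ 2 * strainForm φ κ x a with hI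
    set J := ∫ x, strainForm φ κ x (r x) with hJ
    have key : ∀ N : ℕ, 0 ≤ ‖k‖ ^ 4 * I + (((N : ℝ) + 1)⁻¹) ^ 2 * J := by
      intro N
      have hN : ((N : ℝ) + 1) ≠ 0 := by positivity
      set M : ℝ := (N : ℝ) + 1 with hM
      have sm : ContDiff ℝ ∞ (fun x : Vec d => M * ⟪k, x⟫) :=
        contDiff_const.mul (contDiff_const.inner ℝ contDiff_id)
      have t1 : IsTest Ω (fun x => ρ x * (M⁻¹ * Real.sin (M * ⟪k, x⟫))) := by
        simpa only [smul_eq_mul, mul_comm] using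
          hρ.smul (contDiff_const.mul (Real.contDiff_sin.comp sm) : ContDiff ℝ ∞
            (fun x : Vec d => M⁻¹ * Real.sin (M * ⟪k, x⟫)))
      have t2 : IsTest Ω (fun x => ρ x * (M⁻¹ * Real.cos (M * ⟪k, x⟫))) := by
        simpa only [smul_eq_mul, mul_comm] using
          hρ.smul (contDiff_const.mul (Real.contDiff_cos.comp sm) : ContDiff ℝ ∞
            (fun x : Vec d => M⁻¹ * Real.cos (M * ⟪k, x⟫)))
      have s1 := isSolTest_rotField t1 a k
      have s2 := isSolTest_rotField t2 a k
      have e1 : ∀ x, rotField (fun x => ρ x * (M⁻¹ * Real.sin (M * ⟪k, x⟫))) a k x =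
          (ρ x * ‖k‖ ^ 2 * Real.cos (M * ⟪k, x⟫)) • a + (M⁻¹ * Real.sin (M * ⟪k, x⟫)) • r x := by
        intro x
        simp only [rotField, fderiv_mul_trig hρ.differentiable k hN Real.hasDerivAt_sin, hak, hr,
          real_inner_self_eq_norm_sq]
        module
      have e2 : ∀ x, rotField (fun x => ρ x * (M⁻¹ * Real.cos (M * ⟪k, x⟫))) a k x =
          -(ρ x * ‖k‖ ^ 2 * Real.sin (M * ⟪k, x⟫)) • a + (M⁻¹ * Real.cos (M * ⟪k, x⟫)) • r x := by
        intro x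
        simp only [rotField, fderiv_mul_trig hρ.differentiable k hN Real.hasDerivAt_cos, hak, hr,
          real_inner_self_eq_norm_sq]
        module
      have i : ∀ {ψ : Vec d → Vec d}, IsSolTest Ω ψ → Integrable (fun x => strainForm φ κ x (ψ x)) := by
        intro ψ hψ
        refine (continuous_strainForm hφ κ hψ.1.continuous).integrable_of_hasCompactSupport ?_
        refine hψ.1.2.1.mono fun x hx => ?_
        rw [Function.mem_support] at hx ⊢
        intro h0
        simp [strainForm, h0] at hx
      have hsum := add_nonneg (h _ s1) (h _ s2)
      rw [← integral_add (i s1) (i s2)] at hsum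
      refine hsum.trans (le_of_eq ?_)
      have iρ : Integrable (fun x => ρ x ^ 2 * strainForm φ κ x a) := by
        refine (Continuous.mul (hρ.continuous.pow 2)
          (continuous_strainForm hφ κ continuous_const)).integrable_of_hasCompactSupport ?_
        refine hρ.2.1.mono fun x hx => ?_
        rw [Function.mem_support] at hx ⊢
        intro h0
        simp [h0] at hx
      rw [hI, hJ, ← integral_const_mul, ← integral_const_mul,
        ← integral_add (iρ.const_mul _) ((i hrt).const_mul _)]
      refine integral_congr_ae (ae_of_all _ fun x => ?_)
      simp only [e1, e2]
      rw [strainForm_rotate]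
      ring
    have hlim : Tendsto (fun N : ℕ => ‖k‖ ^ 4 * I + (((N : ℝ) + 1)⁻¹) ^ 2 * J) atTop
        (𝓝 (‖k‖ ^ 4 * I + 0 ^ 2 * J)) := by
      have := tendsto_one_div_add_atTop_nhds_zero_nat (𝕜 := ℝ)
      simp only [one_div] at this
      exact tendsto_const_nhds.add ((this.pow 2).mul_const J)
    have h0 := ge_of_tendsto' hlim key
    have hkpos : 0 < ‖k‖ ^ 4 := by positivity
    simp only [ne_eq, OfNat.ofNat_ne_zero, not_false_eq_true, zero_pow, zero_mul, add_zero] at h0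
    exact nonneg_of_mul_nonneg_right h0 hkpos
  by_contra hneg
  push Not at hneg
  have hc := continuous_strainForm hφ κ (continuous_const (y := a))
  have hopen : IsOpen ({x | strainForm φ κ x a < 0} ∩ Ω) :=
    (isOpen_lt hc continuous_const).inter hΩ
  obtain ⟨ε, hε, hball⟩ := Metric.isOpen_iff.1 hopen x₀ ⟨hneg, hx₀⟩
  let b : ContDiffBump x₀ := ⟨ε / 4, ε / 2, by positivity, by linarith⟩
  have hbs : tsupport b ⊆ Metric.ball x₀ ε := by
    rw [b.tsupport_eq]
    exact Metric.closedBall_subset_ball (by simp [b]; linarith)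
  have hbt : IsTest Ω b := ⟨b.contDiff, b.hasCompactSupport, hbs.trans fun x hx => (hball hx).2⟩
  have h1 := hloc b hbt
  have hcont : Continuous fun x => -(b x ^ 2 * strainForm φ κ x a) :=
    ((b.continuous.pow 2).mul hc).neg
  have hnn : 0 ≤ fun x => -(b x ^ 2 * strainForm φ κ x a) := by
    intro x
    simp only [Pi.zero_apply]
    by_cases hx : x ∈ Metric.ball x₀ ε
    · have := (hball hx).1
      have h2 : strainForm φ κ x a < 0 := this
      nlinarith [sq_nonneg (b x)]
    · rw [image_eq_zero_of_notMem_tsupport fun hh => hx (hbs hh)]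
      simp
  have hcs : HasCompactSupport fun x => -(b x ^ 2 * strainForm φ κ x a) := by
    refine b.hasCompactSupport.mono fun x hx => ?_
    rw [Function.mem_support] at hx ⊢
    intro h0
    simp [h0] at hx
  have hpos := hcont.integral_pos_of_hasCompactSupport_nonneg_nonzero (μ := volume) hcs hnn (x := x₀) (by
    have : b x₀ = 1 := b.one_of_mem_closedBall (Metric.mem_closedBall_self b.rIn_pos.le)
    simp only [this]
    intro h0
    linarith)
  rw [integral_neg] at hpos
  linarith

theorem strainForm_single_add {φ : Vec d → Vec d} (κ : ℝ) (x : Vec d) {i j : Fin d} (hij : i ≠ j)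
    {s : ℝ} (hs : s ^ 2 = 1) :
    strainForm φ κ x (EuclideanSpace.single i 1 + s • EuclideanSpace.single j 1) =
      partialDeriv i φ x i + partialDeriv j φ x j +
        s * (partialDeriv j φ x i + partialDeriv i φ x j) + κ := by
  have hn : ‖(EuclideanSpace.single i 1 + s • EuclideanSpace.single j 1 : Vec d)‖ ^ 2 = 2 := by
    rw [← real_inner_self_eq_norm_sq]
    simp only [inner_add_left, inner_add_right, inner_smul_left, inner_smul_right,
      EuclideanSpace.inner_single_left, RCLike.conj_to_real, PiLp.single_apply]
    simp [hij, hij.symm]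
    linear_combination hs
  rw [strainForm, hn]
  simp only [map_add, map_smul, inner_add_left, inner_add_right, inner_smul_left, inner_smul_right,
    EuclideanSpace.inner_single_right, RCLike.conj_to_real, partialDeriv]
  simp
  linear_combination fderiv ℝ φ x (EuclideanSpace.single j 1) j * hs

/-- As d ≥ 2, coordinate vectors have nonzero orthogonal partners, which gives ∂ᵢφᵢ ≥ −κ/2. The
vanishing divergence converts these lower bounds into ∂ᵢφᵢ ≤ (d−1)κ/2. The vectors eᵢ ± eⱼ then
bound the off-diagonal entries by ∂ᵢφᵢ + ∂ⱼφⱼ + κ ≤ dκ. -/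
theorem abs_sym_grad_le (hd : 2 ≤ d) {φ : Vec d → Vec d} (hφ : IsSolTest Ω φ) {κ : ℝ}
    (h : ∀ x ∈ Ω, ∀ a k : Vec d, ⟪k, a⟫ = 0 → k ≠ 0 → 0 ≤ strainForm φ κ x a) (hκ : 0 ≤ κ)
    (x : Vec d) (i j : Fin d) :
    |partialDeriv j φ x i + partialDeriv i φ x j| ≤ d * κ := by
  by_cases hx : x ∈ Ω
  swap
  · rw [(hφ.1.partialDeriv j).eq_zero hx, (hφ.1.partialDeriv i).eq_zero hx]
    simp; positivity
  have hdr : (2 : ℝ) ≤ d := by exact_mod_cast hd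
  have hdiag : ∀ i, -(κ / 2) ≤ partialDeriv i φ x i := by
    intro i
    have : Nontrivial (Fin d) := Fin.nontrivial_iff_two_le.2 hd
    obtain ⟨j, hj⟩ := exists_ne i
    have := h x hx (EuclideanSpace.single i 1) (EuclideanSpace.single j 1)
      (by simp [EuclideanSpace.inner_single_left, hj]) (by simp)
    simp [strainForm, EuclideanSpace.inner_single_right] at this
    simp only [partialDeriv]
    linarith
  have hup : ∀ i, partialDeriv i φ x i ≤ (d - 1) * (κ / 2) := by
    intro i
    have h0 := hφ.2 x
    rw [← Finset.add_sum_erase _ _ (Finset.mem_univ i)] at h0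
    have h1 : -((d - 1) * (κ / 2)) ≤ ∑ j ∈ Finset.univ.erase i, partialDeriv j φ x j := by
      have h2 := Finset.card_nsmul_le_sum (Finset.univ.erase i) (fun j => partialDeriv j φ x j)
        (-(κ / 2)) fun j _ => hdiag j
      rw [Finset.card_erase_of_mem (Finset.mem_univ i), Finset.card_univ, Fintype.card_fin,
        nsmul_eq_mul, Nat.cast_sub (by omega)] at h2
      push_cast at h2
      linarith
    linarith
  by_cases hij : i = j
  · subst hij
    rw [abs_le]
    constructor <;> nlinarith [hdiag i, hup i]
  · have hs : ∀ s : ℝ, s ^ 2 = 1 → 0 ≤ partialDeriv i φ x i + partialDeriv j φ x j +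
        s * (partialDeriv j φ x i + partialDeriv i φ x j) + κ := by
      intro s hs
      rw [← strainForm_single_add κ x hij hs]
      refine h x hx _ (EuclideanSpace.single i 1 - s • EuclideanSpace.single j 1) ?_ ?_
      · simp [inner_add_right, inner_sub_left, inner_smul_left, inner_smul_right,
          EuclideanSpace.inner_single_left, hij, Ne.symm hij]
        nlinarith
      · intro h0
        have := congrArg (fun z : Vec d => z i) h0
        simp [hij] at this
    have h1 := hs 1 (by norm_num)
    have h2 := hs (-1) (by norm_num)
    rw [abs_le]
    constructor <;> nlinarith [hup i, hup j]

end Localization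

/-! ### Admissible forms in the inviscid case -/

section Inviscid

variable {d : ℕ} {Ω : Set (Vec d)} {T : ℝ} {K : L2 Ω (Fin d) → ℝ≥0∞}

theorem isC1SolTest_const {φ : Vec d → Vec d} (hφ : IsSolTest Ω φ) :
    IsC1SolTest Ω T (fun _ => φ) := by
  refine ⟨fun _ _ => hφ, ⟨tsupport φ, hφ.1.2.1, hφ.1.2.2, fun _ _ => Subset.rfl⟩,
    fun _ _ => 0, fun _ _ => contDiff_const, fun k => ⟨?_, ?_, ?_⟩⟩
  · exact ((hφ.1.1.continuous_iteratedFDeriv (m := k)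
      (WithTop.coe_le_coe.2 le_top)).comp continuous_snd).continuousOn
  · have : iteratedFDeriv ℝ k (fun _ => 0 : Vec d → Vec d) = 0 := by
      ext1 x
      exact congrFun (iteratedFDeriv_fun_zero (𝕜 := ℝ) (n := k)) x
    simp only [this]
    exact continuousOn_const
  · intro t _ x
    have : iteratedFDeriv ℝ k (fun _ => 0 : Vec d → Vec d) x = 0 :=
      congrFun (iteratedFDeriv_fun_zero (𝕜 := ℝ) (n := k)) x
    rw [this]
    exact hasDerivWithinAt_const _ _ _

theorem memY_const (hΩ : IsOpen Ω) (hT : 0 < T) (hK : IsAdmissible Ω 0 T K) {φ : Vec d → Vec d}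
    (hφ : IsSolTest Ω φ) : MemY Ω 0 T (fun _ => toL2 Ω φ) := by
  have hX := (hK.memDom_of_smooth _ (isC1SolTest_const (T := T) hφ)).1
  refine ⟨hX, fun h => (lt_irrefl _ h).elim, ⟨?_, ?_, ?_⟩, fun _ => 0, ?_, ?_, ?_⟩
  · refine ae_of_all _ fun t => ?_
    have hex : ∃ g, HasWeakGrad Ω (toL2 Ω φ) g := ⟨_, hasWeakGrad_toL2 hφ.1⟩
    rw [wgrad, dif_pos hex]
    exact hex.choose_spec
  · exact ⟨fun _ => (hφ.1.memLp ⊤ _).toLp φ, memLp_const _, ae_of_all _ fun t =>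
      (MemLp.coeFn_toLp _).trans (toL2_coeFn (hφ.1.memLp 2 _)).symm⟩
  · refine ⟨fun _ => (hφ.1.gradField.memLp ⊤ _).toLp (gradField φ), memLp_const _,
      ae_of_all _ fun t => (MemLp.coeFn_toLp _).trans ?_⟩
    rw [wgrad_toL2 hΩ hφ.1]
    exact (toL2_coeFn (hφ.1.gradField.memLp 2 _)).symm
  · exact MemLp.zero
  · exact ae_of_all _ fun _ => subset_closure ⟨_, IsSolTest.zero, toL2_zero.symm⟩
  · intro ψ hψ hψc hψs
    have hψt : IsTimeTest T ψ := ⟨hψ, hψc, hψs⟩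
    have h0 : ∫ t in Ioo 0 T, deriv ψ t = 0 := by
      rw [← integral_Ioc_eq_integral_Ioo, ← intervalIntegral.integral_of_le hT.le,
        intervalIntegral.integral_deriv_eq_sub (fun x _ => hψ.differentiable (by simp) x)
          ((hψ.continuous_deriv (by simp)).intervalIntegrable _ _),
        hψt.eq_zero (by simp), hψt.eq_zero (by simp), sub_zero]
    rw [integral_smul_const, h0]
    simp

theorem eLpNorm_tendsto_exists_seq {X E : Type*} [MeasurableSpace X] [NormedAddCommGroup E]
    {μ : Measure X}
    {f : ℕ → X → E} (hf : ∀ n, AEStronglyMeasurable (f n) μ)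
    (h : Tendsto (fun n => eLpNorm (f n) 1 μ) atTop (𝓝 0)) :
    ∃ ns : ℕ → ℕ, StrictMono ns ∧ ∀ᵐ x ∂μ, Tendsto (fun n => f (ns n) x) atTop (𝓝 0) := by
  have h1 : TendstoInMeasure μ f atTop (fun _ => 0) := by
    refine tendstoInMeasure_of_tendsto_eLpNorm one_ne_zero hf aestronglyMeasurable_const ?_
    refine h.congr fun n => ?_
    congr 1
    ext x
    simp
  exact h1.exists_seq_tendsto_ae

/-- With κ = K(φ) the left-hand side is `relForm` for ν = 0 at the pair φ + ψ, φ. -/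
theorem symInt_toL2_add_eq {φ ψ : Vec d → Vec d} (hφ : IsSolTest Ω φ) (hψ : IsSolTest Ω ψ)
    (κ : ℝ) : symInt (toL2 Ω ψ) (toL2 Ω (gradField φ)) + κ * (1 / 2 * ‖toL2 Ω ψ‖ ^ 2) =
      ∫ x, strainForm φ κ x (ψ x) := by
  have hc : Continuous (fderiv ℝ φ) := hφ.1.1.continuous_fderiv (by simp)
  have hψc : Continuous ψ := hψ.1.1.continuous
  have h1 : Integrable (fun x => ⟪fderiv ℝ φ x (ψ x), ψ x⟫) (volume.restrict Ω) := by
    refine (Continuous.integrable_of_hasCompactSupport ((hc.clm_apply hψc).inner hψc)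
      (hψ.1.2.1.mono fun x hx => ?_)).restrict
    contrapose! hx
    simp_all
  have h2 : Integrable (fun x => κ / 2 * ‖ψ x‖ ^ 2) (volume.restrict Ω) := by
    refine (Continuous.integrable_of_hasCompactSupport (by fun_prop)
      (hψ.1.2.1.mono fun x hx => ?_)).restrict
    contrapose! hx
    simp_all
  have h3 : ∫ x, strainForm φ κ x (ψ x) = ∫ x in Ω, strainForm φ κ x (ψ x) :=
    (setIntegral_eq_of_eq_zero fun x hx => by simp [strainForm, hψ.1.eq_zero hx]).symm
  rw [h3, symInt_eq_convInt]
  simp only [strainForm]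
  rw [integral_add h1 h2, integral_const_mul, norm_sq_eq_integral, convInt]
  congr 1
  · refine integral_congr_ae ?_
    filter_upwards [toL2_coeFn (hψ.1.memLp 2 _), toL2_coeFn (hφ.1.gradField.memLp 2 _)]
      with x hx hy
    simp only [hx, hy, gradField_apply]
    rw [← sum_coord_smul_partialDeriv, PiLp.inner_apply]
    refine Finset.sum_congr rfl fun i _ => ?_
    simp [Finset.sum_apply, Finset.mul_sum, mul_comm]
  · have : ∫ x in Ω, ∑ i, toL2 Ω ψ x i ^ 2 = ∫ x in Ω, ‖ψ x‖ ^ 2 := by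
      refine integral_congr_ae ?_
      filter_upwards [toL2_coeFn (hψ.1.memLp 2 _)] with x hx
      rw [hx, EuclideanSpace.norm_sq_eq]
      simp
    rw [this]
    ring

/-- An admissible form controls the symmetric gradient of solenoidal test fields. -/
theorem IsAdmissible.abs_sym_grad_le (hd : 2 ≤ d) (hΩ : IsOpen Ω) (hT : 0 < T)
    (hK : IsAdmissible Ω 0 T K) {φ : Vec d → Vec d} (hφ : IsSolTest Ω φ) (x : Vec d)
    (i j : Fin d) :
    |partialDeriv j φ x i + partialDeriv i φ x j| ≤ d * (K (toL2 Ω φ)).toReal := by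
  refine FluidEV.abs_sym_grad_le hd hφ (fun y hy a k hak hk => ?_) ENNReal.toReal_nonneg x i j
  refine strainForm_nonneg_of_integral hφ.1.1 hΩ (fun ψ hψ => ?_) hy hak hk
  have hsum : IsSolTest Ω (fun x => φ x + ψ x) := hφ.add hψ
  -- Both fields are constant in time and their difference is the arbitrary test field ψ, so
  -- nonnegativity at a single time suffices.
  have h := hK.relForm_nonneg _ _ (hK.memDom_of_smooth _ (isC1SolTest_const hsum)).1
    (memY_const hΩ hT hK hφ) (hK.memDom_of_smooth _ (isC1SolTest_const hφ))
  have hne : NeBot (ae (timeMeasure T)) := by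
    rw [ae_neBot, Ne, Measure.restrict_eq_zero]
    simp [hT]
  obtain ⟨t, ht⟩ := h.exists
  rw [relForm, if_neg (lt_irrefl _), relEnergy, toL2_add (hφ.1.memLp 2 _) (hψ.1.memLp 2 _),
    add_sub_cancel_left, wgrad_toL2 hΩ hφ.1, symInt_toL2_add_eq hφ hψ] at ht
  exact ht

/-- In the inviscid case, the elements of the domain of an admissible form are approximated by
solenoidal test fields with bounded symmetric gradients. -/
theorem IsAdmissible.exists_symApprox (hd : 2 ≤ d) (hΩ : IsOpen Ω) (hT : 0 < T)
    (hK : IsAdmissible Ω 0 T K) {w : ℝ → L2 Ω (Fin d)} (hw : MemDom Ω 0 T K w) :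
    ∀ᵐ t ∂timeMeasure T, ∃ φ C, SymApprox Ω φ C (w t) := by
  obtain ⟨τ, hbase, hcont, hdense⟩ := hK.exists_topology
  set W : Dom Ω 0 T K := ⟨w, hw⟩ with hW
  have key : ∀ n : ℕ, ∃ u : ℝ → Vec d → Vec d, IsC1SolTest Ω T u ∧ ∃ z : Dom Ω 0 T K,
      (∀ᵐ t ∂timeMeasure T, z.1 t = toL2 Ω (u t)) ∧
      eLpNorm (fun t => z.1 t - w t) 1 (timeMeasure T) < ENNReal.ofReal (1 / (n + 1)) ∧
      eLpNorm (fun t => (K (z.1 t)).toReal - (K (w t)).toReal) 1 (timeMeasure T) <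
        ENNReal.ofReal (1 / (n + 1)) := by
    intro n
    have hpos : (0 : ℝ≥0∞) < ENNReal.ofReal (1 / (n + 1)) := ENNReal.ofReal_pos.2 (by positivity)
    have h := ((hbase W).eventually_lt_const hpos).and ((hcont W).eventually_lt_const hpos)
    obtain ⟨z, ⟨u, hu, hzu⟩, hz1, hz2⟩ :=
      ((mem_closure_iff_frequently.1 (hdense W)).and_eventually h).exists
    refine ⟨u, hu, z, hzu, ?_, hz2⟩
    rwa [baseDist, if_neg (lt_irrefl _)] at hz1
  choose u hu z hzu hz1 hz2 using key
  have hlim : Tendsto (fun n : ℕ => ENNReal.ofReal (1 / ((n : ℝ) + 1))) atTop (𝓝 0) := by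
    have h := (ENNReal.continuous_ofReal.tendsto 0).comp
      (tendsto_one_div_add_atTop_nhds_zero_nat (𝕜 := ℝ))
    rwa [ENNReal.ofReal_zero] at h
  have hmeas : ∀ y : Dom Ω 0 T K, AEStronglyMeasurable (fun t => (K (y.1 t)).toReal)
      (timeMeasure T) := fun y => y.2.2.1.ennreal_toReal.aestronglyMeasurable
  -- Along a subsequence the fields converge at almost every time, and along a further one so do the
  -- values of K. At such a time the values of K are bounded, and by `IsAdmissible.abs_sym_grad_le`
  -- so are the symmetric gradients.
  obtain ⟨ns, hns, hae⟩ := eLpNorm_tendsto_exists_seq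
    (fun n => ((z n).2.1.memLp_top.aestronglyMeasurable.sub hw.1.memLp_top.aestronglyMeasurable))
    (tendsto_of_tendsto_of_tendsto_of_le_of_le tendsto_const_nhds hlim (fun _ => zero_le)
      fun n => (hz1 n).le)
  obtain ⟨ms, hms, hae'⟩ := eLpNorm_tendsto_exists_seq
    (fun n => ((hmeas (z (ns n))).sub (hmeas W)))
    (tendsto_of_tendsto_of_tendsto_of_le_of_le tendsto_const_nhds
      (hlim.comp hns.tendsto_atTop) (fun _ => zero_le) fun n => (hz2 (ns n)).le)
  filter_upwards [hae, hae', ae_all_iff.2 hzu, ae_restrict_mem measurableSet_Ioo]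
    with t h1 h2 h3 ht
  have h1' := h1.comp hms.tendsto_atTop
  obtain ⟨B, hB⟩ := h2.bddAbove_range
  have htI : t ∈ Icc 0 T := Ioo_subset_Icc_self ht
  refine ⟨fun n => u (ns (ms n)) t, d * (B + (K (w t)).toReal),
    fun n => (hu _).1 t htI, fun n x i j => ?_, ?_⟩
  · refine (hK.abs_sym_grad_le hd hΩ hT ((hu _).1 t htI) x i j).trans ?_
    gcongr
    have := hB ⟨n, rfl⟩
    simp only [Pi.sub_apply, h3, hW] at this
    linarith
  · have h4 : Tendsto (fun n => (z (ns (ms n))).1 t - w t + w t) atTop (𝓝 (0 + w t)) :=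
      h1'.add_const (w t)
    simpa [h3] using h4

end Inviscid

/-! ### Pushing solenoidal fields into a Lipschitz domain -/

section Piola

variable {d : ℕ} {Ω : Set (Vec d)}

/-- The shift by `-s χ(y)` in the direction `e`. -/
def shiftMap (s : ℝ) (χ : Vec d → ℝ) (e y : Vec d) : Vec d := y - (s * χ y) • e

/-- The Piola transform of the field `w` under `shiftMap s χ e`. -/
def piolaField (s : ℝ) (χ : Vec d → ℝ) (e : Vec d) (w : Vec d → Vec d) (y : Vec d) : Vec d :=
  (1 - s * fderiv ℝ χ y e) • w (shiftMap s χ e y) +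
    (s * fderiv ℝ χ y (w (shiftMap s χ e y))) • e

variable {s : ℝ} {χ : Vec d → ℝ} {e : Vec d} {w : Vec d → Vec d}

theorem contDiff_shiftMap (hχ : ContDiff ℝ ∞ χ) : ContDiff ℝ ∞ (shiftMap s χ e) := by
  unfold shiftMap
  fun_prop

theorem contDiff_piolaField (hχ : ContDiff ℝ ∞ χ) (hw : ContDiff ℝ ∞ w) :
    ContDiff ℝ ∞ (piolaField s χ e w) := by
  have h1 : ContDiff ℝ ∞ (fderiv ℝ χ) := hχ.fderiv_right (m := ∞) le_rfl
  have h2 : ContDiff ℝ ∞ fun y => w (shiftMap s χ e y) := hw.comp (contDiff_shiftMap hχ)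
  exact ((contDiff_const.sub (contDiff_const.mul (h1.clm_apply contDiff_const))).smul h2).add
    ((contDiff_const.mul (h1.clm_apply h2)).smul contDiff_const)

theorem fderiv_piolaField (hχ : ContDiff ℝ ∞ χ) (hw : ContDiff ℝ ∞ w) (y z : Vec d) :
    fderiv ℝ (piolaField s χ e w) y z =
      (1 - s * fderiv ℝ χ y e) •
          fderiv ℝ w (shiftMap s χ e y) (z - (s * fderiv ℝ χ y z) • e) -
        (s * fderiv ℝ (fderiv ℝ χ) y z e) • w (shiftMap s χ e y) +
      (s * (fderiv ℝ (fderiv ℝ χ) y z (w (shiftMap s χ e y)) + fderiv ℝ χ y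
        (fderiv ℝ w (shiftMap s χ e y) (z - (s * fderiv ℝ χ y z) • e)))) • e := by
  have hD : HasFDerivAt χ (fderiv ℝ χ y) y := (hχ.differentiable (by simp) y).hasFDerivAt
  have hD2 : HasFDerivAt (fderiv ℝ χ) (fderiv ℝ (fderiv ℝ χ) y) y :=
    ((hχ.fderiv_right (m := ∞) le_rfl).differentiable (by simp) y).hasFDerivAt
  have hΨ : HasFDerivAt (shiftMap s χ e) _ y :=
    (hasFDerivAt_id y).sub ((hD.const_mul s).smul_const e)
  have hW : HasFDerivAt (fun y => w (shiftMap s χ e y)) _ y :=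
    ((hw.differentiable (by simp) _).hasFDerivAt).comp y hΨ
  have hT : HasFDerivAt (piolaField s χ e w) _ y :=
    ((((hD2.clm_apply (hasFDerivAt_const e y)).const_mul s).const_sub 1).smul hW).add
      (((hD2.clm_apply hW).const_mul s).smul_const e)
  rw [hT.fderiv]
  simp
  module

theorem sum_single_apply (A : Vec d →L[ℝ] ℝ) (z : Vec d) :
    ∑ i, A (EuclideanSpace.single i 1) * z i = A z := by
  have hz : z = ∑ j, z j • EuclideanSpace.single j (1 : ℝ) := by
    ext i
    simp [Finset.sum_apply, Pi.single_apply]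
  conv_rhs => rw [hz, map_sum]
  simp [mul_comm]

/-- For Ψ = `shiftMap s χ e`, DΨ = I − s e ⊗ ∇χ has determinant 1 − s ∂ₑχ, and the field is the
cofactor expression det(DΨ) (DΨ)⁻¹ w∘Ψ. Being polynomial in ∇χ it makes sense without invertibility.
In the divergence the second derivatives of χ cancel by symmetry and a multiple of (div w)∘Ψ
remains. -/
theorem piolaField_div (hχ : ContDiff ℝ ∞ χ) (hw : ContDiff ℝ ∞ w)
    (hdiv : ∀ x, ∑ i, partialDeriv i w x i = 0) (y : Vec d) :
    ∑ i, partialDeriv i (piolaField s χ e w) y i = 0 := by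
  have hsym := (hχ.contDiffAt (x := y)).isSymmSndFDerivAt
    (by simpa using WithTop.coe_le_coe.2 (le_top : (2 : ℕ∞) ≤ ⊤))
  set Y := shiftMap s χ e y with hY
  set A := fderiv ℝ w Y with hA
  set D := fderiv ℝ χ y with hD
  set H := fderiv ℝ (fderiv ℝ χ) y with hH
  have h0 : ∑ i, A (EuclideanSpace.single i 1) i = 0 := hdiv Y
  have h1 : ∑ i, D (EuclideanSpace.single i 1) * A e i = D (A e) := sum_single_apply D _
  have h2 : ∑ i, H (EuclideanSpace.single i 1) e * w Y i = H e (w Y) := by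
    rw [hsym e (w Y)]
    exact sum_single_apply (H.flip e) (w Y)
  have h3 : ∑ i, H (EuclideanSpace.single i 1) (w Y) * e i = H e (w Y) :=
    sum_single_apply (H.flip (w Y)) e
  have h4 : ∑ i, D (A (EuclideanSpace.single i 1)) * e i = D (A e) :=
    sum_single_apply (D.comp A) e
  have h5 : ∑ i, D (EuclideanSpace.single i 1) * e i = D e := sum_single_apply D e
  have key : ∀ i, partialDeriv i (piolaField s χ e w) y i =
      (1 - s * D e) * A (EuclideanSpace.single i 1) i
      - (1 - s * D e) * s * (D (EuclideanSpace.single i 1) * A e i)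
      - s * (H (EuclideanSpace.single i 1) e * w Y i)
      + s * (H (EuclideanSpace.single i 1) (w Y) * e i)
      + s * (D (A (EuclideanSpace.single i 1)) * e i)
      - s * s * D (A e) * (D (EuclideanSpace.single i 1) * e i) := by
    intro i
    rw [partialDeriv, fderiv_piolaField hχ hw]
    simp only [map_sub, map_smul, PiLp.add_apply, PiLp.sub_apply, PiLp.smul_apply, smul_eq_mul,
      ← hY, ← hA, ← hD, ← hH]
    ring
  simp only [key, Finset.sum_add_distrib, Finset.sum_sub_distrib, ← Finset.mul_sum, h0, h1, h2,
    h3, h4, h5]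
  ring

/-- `w` and its derivative are bounded by `M`. -/
def C1Bound (w : Vec d → Vec d) (M : ℝ) : Prop := ∀ y, ‖w y‖ ≤ M ∧ ‖fderiv ℝ w y‖ ≤ M

theorem C1Bound.nonneg {M : ℝ} (h : C1Bound w M) : 0 ≤ M := (norm_nonneg _).trans (h 0).1

theorem C1Bound.mono {M N : ℝ} (h : C1Bound w M) (hMN : M ≤ N) : C1Bound w N :=
  fun y => ⟨(h y).1.trans hMN, (h y).2.trans hMN⟩

/-- The constant depends only on bounds for the first two derivatives of χ, not on s or w, so it
survives the joint limit in s and the mollification. -/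
theorem exists_bound_piolaField (hχ : ContDiff ℝ ∞ χ) (hχc : HasCompactSupport χ)
    (h01 : ∀ y, χ y ∈ Icc 0 1) (he : ‖e‖ = 1) :
    ∃ C : ℝ, 0 ≤ C ∧ ∀ s ∈ Icc (0 : ℝ) 1, ∀ w M, ContDiff ℝ ∞ w → C1Bound w M →
      C1Bound (piolaField s χ e w) (C * M) ∧
      ∀ y, ‖piolaField s χ e w y - w y‖ ≤ s * (C * M) := by
  obtain ⟨A₁, hA₁⟩ := (hχ.continuous_fderiv (by simp)).bounded_above_of_compact_support
    (hχc.fderiv ℝ)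
  obtain ⟨A₂, hA₂⟩ := ((hχ.fderiv_right (m := ∞) le_rfl).continuous_fderiv
    (by simp)).bounded_above_of_compact_support ((hχc.fderiv ℝ).fderiv ℝ)
  set A := max A₁ A₂ with hA
  have hA0 : 0 ≤ A := (norm_nonneg _).trans ((hA₁ 0).trans (le_max_left _ _))
  have hD : ∀ y, ‖fderiv ℝ χ y‖ ≤ A := fun y => (hA₁ y).trans (le_max_left _ _)
  have hH : ∀ y, ‖fderiv ℝ (fderiv ℝ χ) y‖ ≤ A := fun y => (hA₂ y).trans (le_max_right _ _)
  -- One group of summands for each of the three terms in `fderiv_piolaField`; by `hexp` the total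
  -- also covers the field itself and its deviation from w.
  refine ⟨(1 + A) * (1 + A) + A + (A + A * (1 + A)), by positivity, ?_⟩
  rintro s ⟨hs0, hs1⟩ w M hw hM
  have hM0 := hM.nonneg
  have hDz : ∀ y z, |fderiv ℝ χ y z| ≤ A * ‖z‖ := fun y z =>
    ((fderiv ℝ χ y).le_opNorm z).trans (by gcongr; exact hD y)
  have hDe : ∀ y, |fderiv ℝ χ y e| ≤ A := fun y => by simpa [he] using hDz y e
  have hsm : ∀ {a b : ℝ}, |a| ≤ b → |s * a| ≤ b := fun {a b} h => by
    rw [abs_mul, abs_of_nonneg hs0]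
    exact (mul_le_of_le_one_left (abs_nonneg a) hs1).trans h
  have h1 : ∀ y, |1 - s * fderiv ℝ χ y e| ≤ 1 + A := fun y =>
    (abs_sub _ _).trans (by rw [abs_one]; gcongr; exact hsm (hDe y))
  have hwz : ∀ x z, ‖fderiv ℝ w x z‖ ≤ M * ‖z‖ := fun x z =>
    ((fderiv ℝ w x).le_opNorm z).trans (by gcongr; exact (hM x).2)
  have hexp : (1 + A) * M + A * M ≤ ((1 + A) * (1 + A) + A + (A + A * (1 + A))) * M := by
    rw [← add_mul]
    refine mul_le_mul_of_nonneg_right ?_ hM0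
    nlinarith [mul_nonneg hA0 hA0]
  refine ⟨fun y => ⟨?_, ?_⟩, fun y => ?_⟩
  · refine le_trans ((norm_add_le _ _).trans (add_le_add ?_ ?_)) hexp
    · rw [norm_smul, Real.norm_eq_abs]
      exact mul_le_mul (h1 y) (hM _).1 (norm_nonneg _) (by positivity)
    · rw [norm_smul, he, mul_one, Real.norm_eq_abs]
      exact hsm ((hDz y _).trans (by gcongr; exact (hM _).1))
  · refine ContinuousLinearMap.opNorm_le_bound _ (by positivity) fun z => ?_
    rw [fderiv_piolaField hχ hw]
    set Y := shiftMap s χ e y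
    have hz : ‖z - (s * fderiv ℝ χ y z) • e‖ ≤ (1 + A) * ‖z‖ := by
      refine (norm_sub_le _ _).trans ?_
      rw [norm_smul, he, mul_one, add_mul, one_mul, Real.norm_eq_abs]
      gcongr
      exact hsm (hDz y z)
    have hwz' : ‖fderiv ℝ w Y (z - (s * fderiv ℝ χ y z) • e)‖ ≤ M * ((1 + A) * ‖z‖) :=
      (hwz _ _).trans (by gcongr)
    have hHz : ∀ a : Vec d, |fderiv ℝ (fderiv ℝ χ) y z a| ≤ A * ‖z‖ * ‖a‖ := fun a =>
      ((fderiv ℝ (fderiv ℝ χ) y).le_opNorm₂ z a).trans (by gcongr; exact hH y)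
    have e1 : ‖(1 - s * fderiv ℝ χ y e) • fderiv ℝ w Y (z - (s * fderiv ℝ χ y z) • e)‖ ≤
        (1 + A) * (M * ((1 + A) * ‖z‖)) := by
      rw [norm_smul, Real.norm_eq_abs]
      exact mul_le_mul (h1 y) hwz' (norm_nonneg _) (by positivity)
    have e2 : ‖(s * fderiv ℝ (fderiv ℝ χ) y z e) • w Y‖ ≤ A * ‖z‖ * M := by
      rw [norm_smul, Real.norm_eq_abs]
      exact mul_le_mul (hsm (by simpa [he] using hHz e)) (hM _).1 (norm_nonneg _) (by positivity)
    have e3 : ‖(s * (fderiv ℝ (fderiv ℝ χ) y z (w Y) + fderiv ℝ χ y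
        (fderiv ℝ w Y (z - (s * fderiv ℝ χ y z) • e)))) • e‖ ≤
        A * ‖z‖ * M + A * (M * ((1 + A) * ‖z‖)) := by
      rw [norm_smul, he, mul_one, Real.norm_eq_abs]
      refine hsm ((abs_add_le _ _).trans (add_le_add ?_ ?_))
      · exact (hHz _).trans (by gcongr; exact (hM _).1)
      · exact (hDz y _).trans (by gcongr)
    refine (norm_add_le _ _).trans ((add_le_add ((norm_sub_le _ _).trans
      (add_le_add e1 e2)) e3).trans (le_of_eq ?_))
    ring
  · have hlip : ‖w (shiftMap s χ e y) - w y‖ ≤ s * M := by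
      have := Convex.norm_image_sub_le_of_norm_fderiv_le (𝕜 := ℝ) (f := w) (s := univ)
        (fun x _ => hw.differentiable (by simp) x) (fun x _ => (hM x).2) convex_univ
        (mem_univ y) (mem_univ (shiftMap s χ e y))
      refine this.trans ?_
      rw [shiftMap, sub_sub_cancel_left, norm_neg, norm_smul, he, mul_one, Real.norm_eq_abs,
        abs_mul, abs_of_nonneg hs0, abs_of_nonneg (h01 y).1, mul_comm]
      gcongr
      exact mul_le_of_le_one_right hs0 (h01 y).2
    have hdec : piolaField s χ e w y - w y = (w (shiftMap s χ e y) - w y)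
        - (s * fderiv ℝ χ y e) • w (shiftMap s χ e y)
        + (s * fderiv ℝ χ y (w (shiftMap s χ e y))) • e := by
      rw [piolaField]
      module
    have e1 : ‖(s * fderiv ℝ χ y e) • w (shiftMap s χ e y)‖ ≤ s * (A * M) := by
      rw [norm_smul, Real.norm_eq_abs, abs_mul, abs_of_nonneg hs0, mul_assoc]
      gcongr
      · exact hDe y
      · exact (hM _).1
    have e2 : ‖(s * fderiv ℝ χ y (w (shiftMap s χ e y))) • e‖ ≤ s * (A * M) := by
      rw [norm_smul, he, mul_one, Real.norm_eq_abs, abs_mul, abs_of_nonneg hs0]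
      gcongr
      exact (hDz y _).trans (by gcongr; exact (hM _).1)
    rw [hdec]
    refine (norm_add_le _ _).trans ((add_le_add ((norm_sub_le _ _).trans
      (add_le_add hlip e1)) e2).trans ?_)
    calc s * M + s * (A * M) + s * (A * M) = s * ((1 + A) * M + A * M) := by ring
      _ ≤ _ := by gcongr

/-- The composition of the shifts in a list of pairs `(χ, e)`. -/
def pushMap (s : ℝ) : List ((Vec d → ℝ) × Vec d) → Vec d → Vec d
  | [], y => y
  | c :: l, y => pushMap s l (shiftMap s c.1 c.2 y)

/-- The composition of the Piola transforms in a list of pairs `(χ, e)`. -/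
def pushField (s : ℝ) : List ((Vec d → ℝ) × Vec d) → (Vec d → Vec d) → Vec d → Vec d
  | [], w => w
  | c :: l, w => piolaField s c.1 c.2 (pushField s l w)

/-- Cut-off functions and unit directions. -/
structure IsCutoff (c : (Vec d → ℝ) × Vec d) : Prop where
  contDiff : ContDiff ℝ ∞ c.1
  hasCompactSupport : HasCompactSupport c.1
  mem_Icc : ∀ y, c.1 y ∈ Icc 0 1
  norm_eq : ‖c.2‖ = 1

variable {l : List ((Vec d → ℝ) × Vec d)}

theorem contDiff_pushField (hl : ∀ c ∈ l, IsCutoff c) (hw : ContDiff ℝ ∞ w) :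
    ContDiff ℝ ∞ (pushField s l w) := by
  induction l with
  | nil => exact hw
  | cons c l ih =>
    exact contDiff_piolaField (hl c (by simp)).contDiff
      (ih fun c hc => hl c (List.mem_cons_of_mem _ hc))

theorem pushField_div (hl : ∀ c ∈ l, IsCutoff c) (hw : ContDiff ℝ ∞ w)
    (hdiv : ∀ x, ∑ i, partialDeriv i w x i = 0) (y : Vec d) :
    ∑ i, partialDeriv i (pushField s l w) y i = 0 := by
  induction l generalizing y with
  | nil => exact hdiv y
  | cons c l ih =>
    have hl' : ∀ c ∈ l, IsCutoff c := fun c hc => hl c (List.mem_cons_of_mem _ hc)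
    exact piolaField_div (hl c (by simp)).contDiff (contDiff_pushField hl' hw) (ih hl') y

theorem exists_bound_pushField (hl : ∀ c ∈ l, IsCutoff c) :
    ∃ C : ℝ, 0 ≤ C ∧ ∀ s ∈ Icc (0 : ℝ) 1, ∀ w M, ContDiff ℝ ∞ w → C1Bound w M →
      C1Bound (pushField s l w) (C * M) ∧ ∀ y, ‖pushField s l w y - w y‖ ≤ s * (C * M) := by
  induction l with
  | nil =>
    refine ⟨1, zero_le_one, fun s hs w M _ hM => ⟨by simpa [pushField] using hM, fun y => ?_⟩⟩
    simpa [pushField] using mul_nonneg hs.1 hM.nonneg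
  | cons c l ih =>
    have hl' : ∀ c ∈ l, IsCutoff c := fun c hc => hl c (List.mem_cons_of_mem _ hc)
    obtain ⟨C, hC0, hC⟩ := ih hl'
    have hc := hl c (by simp)
    obtain ⟨C', hC'0, hC'⟩ := exists_bound_piolaField hc.contDiff hc.hasCompactSupport hc.mem_Icc
      hc.norm_eq
    -- C' C comes from the outer transform acting on a field bounded by C M; the extra C accounts
    -- for the deviation caused by the inner transforms.
    refine ⟨C' * C + C, by positivity, fun s hs w M hw hM => ?_⟩
    obtain ⟨h1, h2⟩ := hC s hs w M hw hM
    obtain ⟨h3, h4⟩ := hC' s hs _ _ (contDiff_pushField hl' hw) h1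
    have hM0 := hM.nonneg
    refine ⟨h3.mono (by nlinarith [mul_nonneg hC0 hM0]), fun y => ?_⟩
    calc ‖pushField s (c :: l) w y - w y‖
        ≤ ‖pushField s (c :: l) w y - pushField s l w y‖ + ‖pushField s l w y - w y‖ :=
          norm_sub_le_norm_sub_add_norm_sub _ _ _
      _ ≤ s * (C' * (C * M)) + s * (C * M) := add_le_add (h4 y) (h2 y)
      _ = s * ((C' * C + C) * M) := by ring

theorem pushField_eq_zero {y : Vec d} (h : w (pushMap s l y) = 0) : pushField s l w y = 0 := by
  induction l generalizing y with
  | nil => exact h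
  | cons c l ih =>
    have : pushField s l w (shiftMap s c.1 c.2 y) = 0 := ih h
    simp [pushField, piolaField, this]

theorem continuous_pushMap (hl : ∀ c ∈ l, IsCutoff c) : Continuous (pushMap s l) := by
  induction l with
  | nil => exact continuous_id
  | cons c l ih =>
    exact (ih fun c hc => hl c (List.mem_cons_of_mem _ hc)).comp
      (contDiff_shiftMap (hl c (by simp)).contDiff).continuous

theorem dist_pushMap_le (hl : ∀ c ∈ l, IsCutoff c) (hs : s ∈ Icc (0 : ℝ) 1) (y : Vec d) :
    dist y (pushMap s l y) ≤ l.length := by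
  induction l generalizing y with
  | nil => simp [pushMap]
  | cons c l ih =>
    have hc := hl c (by simp)
    have h1 : dist y (shiftMap s c.1 c.2 y) ≤ 1 := by
      rw [dist_eq_norm, shiftMap, sub_sub_cancel, norm_smul, hc.norm_eq, mul_one,
        Real.norm_eq_abs, abs_of_nonneg (mul_nonneg hs.1 (hc.mem_Icc y).1)]
      exact mul_le_one₀ hs.2 (hc.mem_Icc y).1 (hc.mem_Icc y).2
    have h2 := ih (fun c hc => hl c (List.mem_cons_of_mem _ hc)) (shiftMap s c.1 c.2 y)
    refine (dist_triangle _ _ _).trans ((add_le_add h1 h2).trans (le_of_eq ?_))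
    push_cast [List.length_cons]
    ring

/-- For small `s`, the shift moves the points of the complement of `Ω` at which the cut-off
function is positive to the exterior of `Ω`. -/
def MovesOut (Ω : Set (Vec d)) (s : ℝ) (c : (Vec d → ℝ) × Vec d) : Prop :=
  ∀ z ∉ Ω, 0 < c.1 z → shiftMap s c.1 c.2 z ∉ closure Ω

/-- A boundary point stays fixed until the first cut-off that is positive at it and is then moved to
the exterior. An exterior point stays exterior: each shift either fixes it or, by `MovesOut`, sends
it to an exterior point. -/
theorem pushMap_notMem_closure (hl : ∀ c ∈ l, IsCutoff c) (hm : ∀ c ∈ l, MovesOut Ω s c)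
    {z : Vec d} (hz : z ∉ Ω) (h : z ∉ closure Ω ∨ ∃ c ∈ l, 0 < c.1 z) :
    pushMap s l z ∉ closure Ω := by
  induction l generalizing z with
  | nil => simpa [pushMap] using h
  | cons c l ih =>
    have ih' := fun {z} => ih (fun c hc => hl c (List.mem_cons_of_mem _ hc))
      (fun c hc => hm c (List.mem_cons_of_mem _ hc)) (z := z)
    by_cases hc : 0 < c.1 z
    · have h1 := hm c (by simp) z hz hc
      exact ih' (fun h => h1 (subset_closure h)) (Or.inl h1)
    · have hc0 : c.1 z = 0 := le_antisymm (not_lt.1 hc) ((hl c (by simp)).mem_Icc z).1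
      have hs : shiftMap s c.1 c.2 z = z := by simp [shiftMap, hc0]
      rw [pushMap, hs]
      refine ih' hz (h.imp id ?_)
      rintro ⟨c', hc', hpos⟩
      rcases List.mem_cons.1 hc' with rfl | hmem
      · exact (hc hpos).elim
      · exact ⟨c', hmem, hpos⟩

/-- Near a boundary point of a Lipschitz domain there is a cut-off function whose shifts move
boundary points to the exterior. -/
theorem IsBoundedLipschitzDomain.exists_cutoff (hΩ : IsBoundedLipschitzDomain Ω) {x₀ : Vec d}
    (hx₀ : x₀ ∈ frontier Ω) : ∃ c : (Vec d → ℝ) × Vec d, IsCutoff c ∧ 0 < c.1 x₀ ∧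
      ∃ δ > 0, ∀ s, 0 < s → s < δ → MovesOut Ω s c := by
  obtain ⟨e, U, L, γ, he, hUo, hxU, hγ, hU⟩ := hΩ.lipschitz_boundary x₀ hx₀
  obtain ⟨r, hr, hrU⟩ := Metric.isOpen_iff.1 hUo x₀ hxU
  -- Support radius r/2 and shifts smaller than r/2 keep the shifted points in the ball of radius r,
  -- where Ω is described by γ.
  let b : ContDiffBump x₀ := ⟨r / 4, r / 2, by positivity, by linarith⟩
  refine ⟨(b, e), ⟨b.contDiff, b.hasCompactSupport, fun y => ⟨b.nonneg, b.le_one⟩, he⟩,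
    b.pos_of_mem_ball (Metric.mem_ball_self (by positivity)), r / 2, by positivity,
    fun s hs0 hs z hz hpos => ?_⟩
  have hzb : z ∈ Metric.ball x₀ (r / 2) := by
    have : z ∈ Function.support b := hpos.ne'
    rwa [b.support_eq] at this
  set y := shiftMap s b e z with hy
  have hpos' : 0 < s * b z := mul_pos hs0 hpos
  have hyU : y ∈ U := by
    refine hrU ?_
    rw [Metric.mem_ball] at hzb ⊢
    have h1 : dist y z ≤ s := by
      rw [dist_eq_norm, hy, shiftMap, sub_sub_cancel_left, norm_neg, norm_smul, he, mul_one,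
        Real.norm_eq_abs, abs_of_pos hpos']
      exact mul_le_of_le_one_right hs0.le b.le_one
    linarith [dist_triangle y z x₀]
  have hee : ⟪e, e⟫ = (1 : ℝ) := by rw [real_inner_self_eq_norm_sq, he, one_pow]
  have hey : ⟪e, y⟫ = ⟪e, z⟫ - s * b z := by
    rw [hy, shiftMap, inner_sub_right, inner_smul_right, hee, mul_one]
  have hpy : y - ⟪e, y⟫ • e = z - ⟪e, z⟫ • e := by
    rw [hey, hy, shiftMap]
    module
  have hzU : z ∈ U := hrU (Metric.ball_subset_ball (by linarith) hzb)
  -- A point outside Ω lies on or below the graph. The shift lowers ⟪e, ·⟫ and keeps the orthogonal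
  -- component, so the image lies strictly below the graph. This is an open condition, hence the
  -- image avoids the closure.
  have hzγ : ⟪e, z⟫ ≤ γ (z - ⟪e, z⟫ • e) := not_lt.1 fun h => hz ((hU z hzU).2 h)
  have hlt : ⟪e, y⟫ < γ (y - ⟪e, y⟫ • e) := by
    rw [hpy, hey]
    linarith
  have hopen : IsOpen {x | ⟪e, x⟫ < γ (x - ⟪e, x⟫ • e)} :=
    isOpen_lt (by fun_prop) (hγ.continuous.comp (by fun_prop))
  intro hcl
  obtain ⟨x, ⟨hxU, hxγ⟩, hxΩ⟩ := mem_closure_iff.1 hcl _ (hUo.inter hopen) ⟨hyU, hlt⟩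
  exact lt_asymm ((hU x hxU).1 hxΩ) hxγ

theorem IsBoundedLipschitzDomain.exists_cutoffs (hΩ : IsBoundedLipschitzDomain Ω) :
    ∃ l : List ((Vec d → ℝ) × Vec d), (∀ c ∈ l, IsCutoff c) ∧
      (∀ z ∈ frontier Ω, ∃ c ∈ l, 0 < c.1 z) ∧
      ∃ δ > 0, ∀ s, 0 < s → s < δ → ∀ c ∈ l, MovesOut Ω s c := by
  choose! c hc hpos δ hδ hm using fun x₀ (hx₀ : x₀ ∈ frontier Ω) => hΩ.exists_cutoff hx₀
  have hcomp : IsCompact (frontier Ω) :=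
    Metric.isCompact_of_isClosed_isBounded isClosed_frontier
      (hΩ.isBounded.closure.subset frontier_subset_closure)
  obtain ⟨t, ht, hcov⟩ := hcomp.elim_nhds_subcover (fun x => {z | 0 < (c x).1 z})
    fun x hx => (isOpen_lt continuous_const (hc x hx).contDiff.continuous).mem_nhds (hpos x hx)
  refine ⟨t.toList.map c, ?_, ?_, ?_⟩
  · intro c' hc'
    obtain ⟨x, hx, rfl⟩ := List.mem_map.1 hc'
    exact hc x (ht x (Finset.mem_toList.1 hx))
  · intro z hz
    obtain ⟨x, hx, hzx⟩ := mem_iUnion₂.1 (hcov hz)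
    exact ⟨c x, List.mem_map.2 ⟨x, Finset.mem_toList.2 hx, rfl⟩, hzx⟩
  · obtain ⟨δ', hδ', hle⟩ : ∃ δ' > 0, ∀ x ∈ t, δ' ≤ δ x := by
      rcases t.eq_empty_or_nonempty with rfl | hne
      · exact ⟨1, one_pos, by simp⟩
      · exact ⟨t.inf' hne δ, (Finset.lt_inf'_iff hne).2 fun x hx => hδ x (ht x hx),
          fun x hx => Finset.inf'_le _ hx⟩
    refine ⟨δ', hδ', fun s hs0 hs c' hc' => ?_⟩
    obtain ⟨x, hx, rfl⟩ := List.mem_map.1 hc'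
    have hx := Finset.mem_toList.1 hx
    exact hm x (ht x hx) s hs0 (hs.trans_le (hle x hx))

/-- The pushed fields are test fields if the original field vanishes outside a sufficiently small
neighbourhood of `Ω`. -/
theorem exists_isTest_pushField (hΩo : IsOpen Ω) (hΩb : Bornology.IsBounded Ω)
    (hl : ∀ c ∈ l, IsCutoff c) (hm : ∀ c ∈ l, MovesOut Ω s c)
    (hf : ∀ z ∈ frontier Ω, ∃ c ∈ l, 0 < c.1 z) (hs : s ∈ Icc (0 : ℝ) 1) :
    ∃ δ > 0, ∀ w : Vec d → Vec d, ContDiff ℝ ∞ w →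
      (∀ y, y ∉ Metric.cthickening δ Ω → w y = 0) → IsTest Ω (pushField s l w) := by
  have hcont : Continuous (pushMap s l) := continuous_pushMap hl
  obtain ⟨R, hR⟩ := (hΩb.cthickening (δ := 1)).subset_closedBall 0
  set B := Metric.closedBall (0 : Vec d) (R + l.length) with hB
  -- The image of this compact set avoids the closure of Ω, hence a whole neighbourhood of it.
  -- Points pushed into that neighbourhood therefore form a compact subset of Ω, which contains the
  -- support. The radius of B is large enough because each shift moves points by at most 1.
  have hBc : IsCompact (B \ Ω) := (isCompact_closedBall _ _).diff hΩo
  have hdisj : Disjoint (pushMap s l '' (B \ Ω)) (closure Ω) := by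
    rw [Set.disjoint_left]
    rintro _ ⟨z, ⟨-, hz⟩, rfl⟩
    refine pushMap_notMem_closure hl hm hz ?_
    by_cases hcl : z ∈ closure Ω
    · exact Or.inr (hf z ⟨hcl, by rwa [hΩo.interior_eq]⟩)
    · exact Or.inl hcl
  obtain ⟨δ, hδ, hdis⟩ := hdisj.exists_cthickenings (hBc.image hcont) isClosed_closure
  refine ⟨min δ 1, lt_min hδ one_pos, fun w hw hw0 => ?_⟩
  set S := pushMap s l ⁻¹' Metric.cthickening (min δ 1) Ω with hS
  have hSB : S ⊆ B := by
    intro y hy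
    have h1 := hR (Metric.cthickening_mono (min_le_right _ _) _ hy)
    rw [Metric.mem_closedBall] at h1 ⊢
    linarith [dist_triangle y (pushMap s l y) 0, dist_pushMap_le hl hs y]
  have hSc : IsCompact S := (isCompact_closedBall _ _).of_isClosed_subset
    (Metric.isClosed_cthickening.preimage hcont) hSB
  have hSΩ : S ⊆ Ω := by
    intro y hy
    by_contra hyΩ
    refine Set.disjoint_left.1 hdis
      (Metric.self_subset_cthickening _ ⟨y, ⟨hSB hy, hyΩ⟩, rfl⟩) ?_
    rw [Metric.cthickening_closure]
    exact Metric.cthickening_mono (min_le_left _ _) _ hy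
  have hsupp : tsupport (pushField s l w) ⊆ S := by
    refine closure_minimal (fun y hy => ?_) hSc.isClosed
    by_contra hyS
    exact hy (pushField_eq_zero (hw0 _ hyS))
  exact ⟨contDiff_pushField hl hw, HasCompactSupport.of_support_subset_isCompact hSc
    (subset_closure.trans hsupp), hsupp.trans hSΩ⟩

end Piola

/-! ### Approximation of Lipschitz solenoidal fields in Lipschitz domains -/

section Mollify

open ContinuousLinearMap
open scoped Convolution

variable {d : ℕ} {Ω : Set (Vec d)}

/-- The extension by zero of an element of `H¹_{0,σ}` is weakly differentiable in the whole
space. -/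
theorem integral_mul_partialDeriv_of_mem_H10sigma {u : L2 Ω (Fin d)} (hu : u ∈ H10sigma Ω)
    {ψ : Vec d → ℝ} (hψ : IsTest univ ψ) (i j : Fin d) :
    ∫ x in Ω, u x i * partialDeriv j ψ x = -∫ x in Ω, wgrad u x (i, j) * ψ x := by
  rw [← inner_toL2_single u ((hψ.partialDeriv j).memLp 2 _),
    ← inner_toL2_single (wgrad u) (hψ.memLp 2 _)]
  -- The identity is closed in the pair (u, ∇u). For test fields no boundary term appears because
  -- the field, rather than ψ, has compact support in Ω.
  refine closure_minimal (t := {p : L2 Ω (Fin d) × L2 Ω (Fin d × Fin d) |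
    ⟪p.1, toL2 Ω (fun x => partialDeriv j ψ x • EuclideanSpace.single i (1 : ℝ))⟫ =
      -⟪p.2, toL2 Ω (fun x => ψ x • EuclideanSpace.single (i, j) (1 : ℝ))⟫})
    ?_ (isClosed_eq (by fun_prop) (by fun_prop)) hu
  rintro _ ⟨w, hw, rfl⟩
  rw [Set.mem_ofPred_eq, inner_toL2_single _ ((hψ.partialDeriv j).memLp 2 _),
    inner_toL2_single _ (hψ.memLp 2 _)]
  have e1 : ∫ x in Ω, toL2 Ω w x i * partialDeriv j ψ x = ∫ x, w x i * partialDeriv j ψ x := by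
    rw [← setIntegral_eq_of_eq_zero fun x hx => by rw [hw.1.eq_zero hx]; simp]
    refine integral_congr_ae ?_
    filter_upwards [toL2_coeFn (hw.1.memLp 2 _)] with x hx
    rw [hx]
  have e2 : ∫ x in Ω, toL2 Ω (gradField w) x (i, j) * ψ x = ∫ x, partialDeriv j w x i * ψ x := by
    rw [← setIntegral_eq_of_eq_zero (Ω := Ω) fun x hx => by
      rw [(hw.1.partialDeriv j).eq_zero hx]; simp]
    refine integral_congr_ae ?_
    filter_upwards [toL2_coeFn (hw.1.gradField.memLp 2 _)] with x hx
    rw [hx, gradField_apply]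
  rw [e1, e2, integral_mul_partialDeriv ((hw.1.apply i).1.of_le (by simp))
    (hψ.1.of_le (by simp)) hψ.2.1]
  simp only [partialDeriv_apply (hw.1.differentiable _)]

/-- With a translated kernel as ψ this is the vanishing divergence of the mollified extension by
zero, also at points near or beyond the boundary. It passes to the limit from solenoidal test
fields. -/
theorem sum_integral_wgrad_diag_mul {u : L2 Ω (Fin d)} (hu : u ∈ H10sigma Ω)
    {ψ : Vec d → ℝ} (hψ : IsTest univ ψ) :
    ∑ i, ∫ x in Ω, wgrad u x (i, i) * ψ x = 0 := by
  obtain ⟨φ, hφ⟩ := exists_weakApprox_of_mem_H10sigma hu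
  have hlim : Tendsto (fun n => ∑ i, ∫ x in Ω, toL2 Ω (gradField (φ n)) x (i, i) * ψ x) atTop
      (𝓝 (∑ i, ∫ x in Ω, wgrad u x (i, i) * ψ x)) := by
    refine tendsto_finsetSum _ fun i _ => ?_
    simp only [← inner_toL2_single _ (hψ.memLp 2 _)]
    exact hφ.tendsto_grad _
  refine tendsto_nhds_unique hlim (tendsto_const_nhds.congr fun n => ?_)
  have hw := hφ.isSolTest n
  rw [← integral_finsetSum _ fun i _ => integrable_mul (memLp_apply _ _) (hψ.memLp 2 _),
    ← integral_zero (Vec d) ℝ (μ := volume.restrict Ω)]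
  refine integral_congr_ae ?_
  filter_upwards [toL2_coeFn (hw.1.gradField.memLp 2 _)] with x hx
  simp only [hx, gradField_apply, ← Finset.sum_mul, hw.2 x, zero_mul]

theorem norm_le_sum_abs (z : Vec d) : ‖z‖ ≤ ∑ i, |z i| := by
  have hz : z = ∑ j, z j • EuclideanSpace.single j (1 : ℝ) := by
    ext i
    simp [Finset.sum_apply, Pi.single_apply]
  conv_lhs => rw [hz]
  exact (norm_sum_le _ _).trans (by simp [norm_smul])

theorem norm_fderiv_le_of_partialDeriv_le {w : Vec d → Vec d} {x : Vec d} {B : ℝ} (hB : 0 ≤ B)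
    (h : ∀ i j, |partialDeriv j w x i| ≤ B) : ‖fderiv ℝ w x‖ ≤ d * (d * B) := by
  refine ContinuousLinearMap.opNorm_le_bound _ (by positivity) fun z => ?_
  rw [← sum_coord_smul_partialDeriv]
  refine (norm_sum_le _ _).trans ?_
  have h1 : ∀ j, ‖z j • partialDeriv j w x‖ ≤ d * B * ‖z‖ := fun j => by
    rw [norm_smul, mul_comm]
    gcongr
    · refine (norm_le_sum_abs _).trans ((Finset.sum_le_sum fun i _ => h i j).trans ?_)
      simp
    · exact PiLp.norm_apply_le z j
  refine (Finset.sum_le_sum fun j _ => h1 j).trans ?_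
  simp
  ring_nf
  rfl

variable {ρ : Vec d → ℝ} {u : L2 Ω (Fin d)}

theorem integrable_indicator_L2 (hΩm : MeasurableSet Ω) (hΩb : Bornology.IsBounded Ω)
    (u : L2 Ω (Fin d)) : Integrable (Ω.indicator u) := by
  have : IsFiniteMeasure (volume.restrict Ω) := ⟨by simpa using hΩb.measure_lt_top⟩
  rw [integrable_indicator_iff hΩm]
  exact (Lp.memLp u).integrable (by norm_num)

theorem convolution_indicator_eq (hΩm : MeasurableSet Ω) (x : Vec d) :
    (ρ ⋆[lsmul ℝ ℝ, volume] Ω.indicator u) x = ∫ y in Ω, ρ (x - y) • u y := by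
  rw [convolution_lsmul_swap, ← integral_indicator hΩm]
  refine integral_congr_ae (ae_of_all _ fun y => ?_)
  by_cases hy : y ∈ Ω <;> simp [hy]

theorem isTest_comp_sub (hρ : IsTest univ ρ) (x : Vec d) : IsTest univ (fun y => ρ (x - y)) :=
  ⟨hρ.1.comp (by fun_prop), hρ.2.1.comp_homeomorph (Homeomorph.subLeft x), subset_univ _⟩

theorem partialDeriv_comp_sub (hρ : IsTest univ ρ) (x y : Vec d) (j : Fin d) :
    partialDeriv j (fun y => ρ (x - y)) y = -partialDeriv j ρ (x - y) := by
  have h : HasFDerivAt (fun y => ρ (x - y)) _ y :=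
    (hρ.differentiable (x - y)).hasFDerivAt.comp y ((hasFDerivAt_id y).const_sub x)
  rw [partialDeriv, h.fderiv]
  simp [partialDeriv]

/-- The derivative falls on the kernel and is moved to u;
`integral_mul_partialDeriv_of_mem_H10sigma` ensures that the extension by zero creates no jump at
the boundary. -/
theorem partialDeriv_convolution (hΩm : MeasurableSet Ω) (hΩb : Bornology.IsBounded Ω)
    (hρ : IsTest univ ρ) (hu : u ∈ H10sigma Ω) (x : Vec d) (i j : Fin d) :
    partialDeriv j (ρ ⋆[lsmul ℝ ℝ, volume] Ω.indicator u) x i =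
      ∫ y in Ω, wgrad u y (i, j) * ρ (x - y) := by
  have hint := integrable_indicator_L2 hΩm hΩb u
  have h := hρ.2.1.hasFDerivAt_convolution_left (lsmul ℝ ℝ) (hρ.1.of_le (by simp))
    hint.locallyIntegrable x
  have hex : ConvolutionExistsAt (fderiv ℝ ρ) (Ω.indicator u) x
      ((lsmul ℝ ℝ : ℝ →L[ℝ] Vec d →L[ℝ] Vec d).precompL (Vec d)) volume :=
    (hρ.2.1.fderiv ℝ).convolutionExists_left _ (hρ.1.continuous_fderiv (by simp))
      hint.locallyIntegrable x
  rw [partialDeriv, h.fderiv, convolution_eq_swap, ContinuousLinearMap.integral_apply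
    hex.integrable_swap]
  have hev : ∀ y, ((lsmul ℝ ℝ : ℝ →L[ℝ] Vec d →L[ℝ] Vec d).precompL (Vec d)
      (fderiv ℝ ρ (x - y)) (Ω.indicator u y)) (EuclideanSpace.single j 1) =
      Ω.indicator (fun y => partialDeriv j ρ (x - y) • u y) y := by
    intro y
    by_cases hy : y ∈ Ω <;> simp [hy, partialDeriv, ContinuousLinearMap.precompL_apply]
  simp only [hev]
  rw [integral_indicator hΩm]
  have hψ := isTest_comp_sub hρ x
  have hm : MemLp (fun y => partialDeriv j ρ (x - y)) 2 (volume.restrict Ω) :=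
    (isTest_comp_sub (hρ.partialDeriv j) x).memLp 2 _
  have hi : Integrable (fun y => partialDeriv j ρ (x - y) • u y) (volume.restrict Ω) :=
    memLp_one_iff_integrable.1 ((Lp.memLp u).smul (r := 1) hm)
  have e := (EuclideanSpace.proj i : Vec d →L[ℝ] ℝ).integral_comp_comm hi
  have e' : (∫ y in Ω, partialDeriv j ρ (x - y) • u y) i =
      ∫ y in Ω, partialDeriv j ρ (x - y) * u y i := e.symm
  rw [e']
  have h2 := integral_mul_partialDeriv_of_mem_H10sigma hu hψ i j
  simp only [partialDeriv_comp_sub hρ, mul_neg] at h2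
  rw [integral_neg, neg_inj] at h2
  rw [← h2]
  simp only [mul_comm]

theorem norm_setIntegral_mul_le {F : Type*} [NormedAddCommGroup F] [NormedSpace ℝ F]
    (hρ : IsTest univ ρ) (hρ0 : ∀ x, 0 ≤ ρ x) (hρ1 : ∫ x, ρ x = 1) {B : ℝ} (hB : 0 ≤ B)
    {g : Vec d → F} (hg : ∀ᵐ y ∂volume.restrict Ω, ‖g y‖ ≤ B) (x : Vec d) :
    ‖∫ y in Ω, ρ (x - y) • g y‖ ≤ B := by
  have hi : Integrable (fun y => ρ (x - y) * B) := by
    refine Integrable.mul_const ?_ _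
    exact (hρ.1.continuous.integrable_of_hasCompactSupport hρ.2.1).comp_sub_left x
  calc ‖∫ y in Ω, ρ (x - y) • g y‖ ≤ ∫ y in Ω, ρ (x - y) * B := by
        refine norm_integral_le_of_norm_le hi.restrict ?_
        filter_upwards [hg] with y hy
        rw [norm_smul, Real.norm_eq_abs, abs_of_nonneg (hρ0 _)]
        exact mul_le_mul_of_nonneg_left hy (hρ0 _)
    _ ≤ ∫ y, ρ (x - y) * B :=
        setIntegral_le_integral hi (ae_of_all _ fun y => mul_nonneg (hρ0 _) hB)
    _ = B := by
        rw [integral_mul_const, integral_sub_left_eq_self (fun y => ρ y) volume x, hρ1, one_mul]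

theorem norm_toL2_sub_sq (w : Vec d → Vec d) (hw : MemLp w 2 (volume.restrict Ω)) :
    ‖toL2 Ω w - u‖ ^ 2 = ∫ x in Ω, ‖w x - u x‖ ^ 2 := by
  rw [norm_sq_eq_integral]
  refine integral_congr_ae ?_
  filter_upwards [Lp.coeFn_sub (toL2 Ω w) u, toL2_coeFn hw] with x h1 h2
  rw [h1, EuclideanSpace.norm_sq_eq]
  simp [h2]

/-- Mollification of the extension by zero. -/
theorem exists_mollification (hΩm : MeasurableSet Ω) (hΩb : Bornology.IsBounded Ω)
    (hu : u ∈ H10sigma Ω) {V : Lp (Vec d) ⊤ (volume.restrict Ω)}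
    (hV : V =ᵐ[volume.restrict Ω] u) {Γ : Lp (Mat d) ⊤ (volume.restrict Ω)}
    (hΓ : Γ =ᵐ[volume.restrict Ω] wgrad u) :
    ∃ M, ∀ δ > 0, ∀ ε > 0, ∃ w : Vec d → Vec d, ContDiff ℝ ∞ w ∧
      (∀ x, ∑ i, partialDeriv i w x i = 0) ∧ C1Bound w M ∧
      (∀ y, y ∉ Metric.cthickening δ Ω → w y = 0) ∧ MemLp w 2 (volume.restrict Ω) ∧
      ‖toL2 Ω w - u‖ < ε := by
  have : IsFiniteMeasure (volume.restrict Ω) := ⟨by simpa using hΩb.measure_lt_top⟩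
  have hint := integrable_indicator_L2 hΩm hΩb u
  have hub : ∀ᵐ y ∂volume.restrict Ω, ‖u y‖ ≤ ‖V‖ := by
    filter_upwards [hV, ae_norm_le_norm_Linf V] with y h1 h2
    rwa [h1] at h2
  have hgb : ∀ i j, ∀ᵐ y ∂volume.restrict Ω, ‖wgrad u y (i, j)‖ ≤ ‖Γ‖ := fun i j => by
    filter_upwards [hΓ, ae_norm_le_norm_Linf Γ] with y h1 h2
    rw [h1] at h2
    exact (PiLp.norm_apply_le _ _).trans h2
  -- Convolution with a probability kernel does not increase suprema, so the bound is independent of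
  -- δ and ε. The factors d pass from the entries of the gradient to its operator norm.
  refine ⟨max ‖V‖ (d * (d * ‖Γ‖)), fun δ hδ ε hε => ?_⟩
  let b : ℕ → ContDiffBump (0 : Vec d) := fun n =>
    ⟨δ / (n + 2) / 2, δ / (n + 2), by positivity, by
      have : 0 < δ / (n + 2) := by positivity
      linarith⟩
  set ρ : ℕ → Vec d → ℝ := fun n => (b n).normed volume with hρdef
  have hρ : ∀ n, IsTest univ (ρ n) := fun n =>
    ⟨(b n).contDiff_normed, (b n).hasCompactSupport_normed, subset_univ _⟩
  have hρ0 : ∀ n x, 0 ≤ ρ n x := fun n x => (b n).nonneg_normed x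
  have hρ1 : ∀ n, ∫ x, ρ n x = 1 := fun n => (b n).integral_normed
  set w : ℕ → Vec d → Vec d := fun n => ρ n ⋆[lsmul ℝ ℝ, volume] Ω.indicator u with hw
  have hwe : ∀ n x, w n x = ∫ y in Ω, ρ n (x - y) • u y := fun n x =>
    convolution_indicator_eq hΩm x
  have hsm : ∀ n, ContDiff ℝ ∞ (w n) := fun n =>
    (hρ n).2.1.contDiff_convolution_left _ (hρ n).1 hint.locallyIntegrable
  have hwb : ∀ n x, ‖w n x‖ ≤ ‖V‖ := fun n x => by
    rw [hwe]
    exact norm_setIntegral_mul_le (hρ n) (hρ0 n) (hρ1 n) (norm_nonneg _) hub x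
  have hmem : ∀ n, MemLp (w n) 2 (volume.restrict Ω) := fun n =>
    MemLp.of_bound (hsm n).continuous.aestronglyMeasurable ‖V‖ (ae_of_all _ (hwb n))
  have hlim0 : Tendsto (fun n : ℕ => δ / ((n : ℝ) + 2)) atTop (𝓝 0) :=
    tendsto_const_nhds.div_atTop (tendsto_atTop_add_const_right _ _ tendsto_natCast_atTop_atTop)
  have hae : ∀ᵐ x ∂volume.restrict Ω, Tendsto (fun n => w n x) atTop (𝓝 (u x)) := by
    have h := ContDiffBump.ae_convolution_tendsto_right_of_locallyIntegrable (μ := volume)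
      (φ := b) (l := atTop) (K := 2) (by exact hlim0)
      (Eventually.of_forall fun n => le_of_eq (by simp only [b]; ring)) hint.locallyIntegrable
    filter_upwards [ae_restrict_of_ae h, ae_restrict_mem hΩm] with x hx hxΩ
    simpa [hxΩ] using hx
  have hL2 : Tendsto (fun n => ‖toL2 Ω (w n) - u‖ ^ 2) atTop (𝓝 0) := by
    have h := tendsto_integral_of_dominated_convergence (μ := volume.restrict Ω)
      (F := fun n x => ‖w n x - u x‖ ^ 2) (f := fun _ => 0) (fun _ => (‖V‖ + ‖V‖) ^ 2)
      (fun n => (((hsm n).continuous.aestronglyMeasurable.sub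
        (Lp.aestronglyMeasurable u)).norm.pow 2)) (integrable_const _) ?_ ?_
    · simpa only [norm_toL2_sub_sq _ (hmem _), integral_zero] using h
    · intro n
      filter_upwards [hub] with x hx
      rw [norm_pow, norm_norm]
      gcongr
      exact (norm_sub_le _ _).trans (add_le_add (hwb n x) hx)
    · filter_upwards [hae] with x hx
      have := ((hx.sub_const (u x)).norm.pow 2)
      simpa using this
  obtain ⟨n, hn⟩ := (hL2.eventually_lt_const (pow_pos hε 2)).exists
  refine ⟨w n, hsm n, fun x => ?_, fun y => ⟨(hwb n y).trans (le_max_left _ _), ?_⟩,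
    fun y hy => ?_, hmem n, lt_of_pow_lt_pow_left₀ 2 hε.le hn⟩
  · simp only [hw, partialDeriv_convolution hΩm hΩb (hρ n) hu]
    exact sum_integral_wgrad_diag_mul hu (isTest_comp_sub (hρ n) x)
  · refine (norm_fderiv_le_of_partialDeriv_le (norm_nonneg _) fun i j => ?_).trans
      (le_max_right _ _)
    simp only [hw]
    rw [partialDeriv_convolution hΩm hΩb (hρ n) hu]
    have := norm_setIntegral_mul_le (hρ n) (hρ0 n) (hρ1 n) (norm_nonneg _) (hgb i j) y
    rw [← Real.norm_eq_abs]
    refine le_trans (le_of_eq ?_) this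
    congr 2
    exact funext fun z => mul_comm _ _
  · rw [hwe]
    refine setIntegral_eq_zero_of_forall_eq_zero fun z hz => ?_
    have : ρ n (y - z) = 0 := by
      by_contra hne
      have hmem : y - z ∈ Function.support (ρ n) := hne
      rw [hρdef] at hmem
      simp only [(b n).support_normed_eq, mem_ball_zero_iff] at hmem
      refine hy (Metric.mem_cthickening_of_dist_le y z δ Ω hz ?_)
      rw [dist_eq_norm]
      refine hmem.le.trans ?_
      exact div_le_self hδ.le (by linarith [(Nat.cast_nonneg n : (0 : ℝ) ≤ n)])
    rw [this, zero_smul]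

/-- In a bounded Lipschitz domain, solenoidal fields in `H¹_{0,σ} ∩ W^{1,∞}` are approximated by
solenoidal test fields with bounded gradients. -/
theorem IsBoundedLipschitzDomain.exists_symApprox (hΩ : IsBoundedLipschitzDomain Ω)
    (hu : u ∈ H10sigma Ω) {V : Lp (Vec d) ⊤ (volume.restrict Ω)}
    (hV : V =ᵐ[volume.restrict Ω] u) {Γ : Lp (Mat d) ⊤ (volume.restrict Ω)}
    (hΓ : Γ =ᵐ[volume.restrict Ω] wgrad u) : ∃ φ C, SymApprox Ω φ C u := by
  have : IsFiniteMeasure (volume.restrict Ω) := ⟨by simpa using hΩ.isBounded.measure_lt_top⟩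
  obtain ⟨M, hM⟩ := exists_mollification hΩ.isOpen.measurableSet hΩ.isBounded hu hV hΓ
  obtain ⟨l, hl, hf, δ, hδ, hm⟩ := hΩ.exists_cutoffs
  obtain ⟨C, hC0, hC⟩ := exists_bound_pushField hl
  have key : ∀ n : ℕ, ∃ φ, IsSolTest Ω φ ∧ C1Bound φ (C * M) ∧
      ‖toL2 Ω φ - u‖ ≤ (measureUnivNNReal (volume.restrict Ω) : ℝ) ^ (2 : ℝ≥0∞).toReal⁻¹ *
        (1 / ((n : ℝ) + 1) * (C * M)) + 1 / ((n : ℝ) + 1) := by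
    intro n
    have hn : (0 : ℝ) < 1 / ((n : ℝ) + 1) := by positivity
    set s := min (δ / 2) (1 / ((n : ℝ) + 1)) with hs
    have hs0 : 0 < s := lt_min (by positivity) hn
    have hs1 : s ≤ 1 := (min_le_right _ _).trans (by
      rw [div_le_one (by positivity)]
      linarith [(Nat.cast_nonneg n : (0 : ℝ) ≤ n)])
    have hsI : s ∈ Icc (0 : ℝ) 1 := ⟨hs0.le, hs1⟩
    have hsδ : s < δ := (min_le_left _ _).trans_lt (by linarith)
    -- The admissible thickness r of the neighbourhood depends on s, so the mollification is chosen
    -- after s.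
    obtain ⟨r, hr, htest⟩ := exists_isTest_pushField hΩ.isOpen hΩ.isBounded hl (hm s hs0 hsδ) hf hsI
    obtain ⟨w, hw, hdiv, hwM, hw0, hwL, hwu⟩ := hM r hr _ hn
    obtain ⟨hb1, hb2⟩ := hC s hsI w M hw hwM
    have hφ : IsSolTest Ω (pushField s l w) := ⟨htest w hw hw0, pushField_div hl hw hdiv⟩
    refine ⟨pushField s l w, hφ, hb1, ?_⟩
    have hCM : 0 ≤ C * M := hb1.nonneg
    -- The push changes w by at most s C M uniformly, whence the factor with the square root of the
    -- measure of Ω; mollification accounts for the last 1/(n+1).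
    refine (norm_sub_le_norm_sub_add_norm_sub _ (toL2 Ω w) _).trans (add_le_add ?_ hwu.le)
    refine Lp.norm_le_of_ae_bound (by positivity) ?_
    filter_upwards [Lp.coeFn_sub (toL2 Ω (pushField s l w)) (toL2 Ω w),
      toL2_coeFn (hφ.1.memLp 2 _), toL2_coeFn hwL] with x h1 h2 h3
    rw [h1, Pi.sub_apply, h2, h3]
    refine (hb2 x).trans ?_
    gcongr
    exact min_le_right _ _
  choose φ hφ hb hd using key
  refine ⟨φ, C * M + C * M, hφ, fun n x i j => ?_, ?_⟩
  · have h1 : ∀ i j, |partialDeriv j (φ n) x i| ≤ C * M := fun i j => by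
      have h := ((fderiv ℝ (φ n) x).le_opNorm (EuclideanSpace.single j 1))
      rw [PiLp.norm_single, norm_one, mul_one] at h
      exact (PiLp.norm_apply_le (partialDeriv j (φ n) x) i).trans (h.trans (hb n x).2)
    exact (abs_add_le _ _).trans (add_le_add (h1 i j) (h1 j i))
  · rw [tendsto_iff_norm_sub_tendsto_zero]
    refine squeeze_zero (fun _ => norm_nonneg _) hd ?_
    have h0 := tendsto_one_div_add_atTop_nhds_zero_nat (𝕜 := ℝ)
    simpa using ((h0.mul_const (C * M)).const_mul _).add h0

end Mollify

/-! ### Functions with values in a dual space -/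

section Dual

variable {X E A : Type*} [MeasurableSpace X] {μ : Measure X} [NormedAddCommGroup E]
  [NormedSpace ℝ E] [NormedAddCommGroup A] [NormedSpace ℝ A] {p : ℝ≥0∞} {g : X → E →L[ℝ] ℝ}

theorem memLp_zero_fun {F : Type*} [NormedAddCommGroup F] :
    MemLp (fun _ => 0 : X → F) p μ := MemLp.zero'

theorem memLp_dual_apply (hg : MemLp g p μ) (u : E) : MemLp (fun t => g t u) p μ :=
  hg.continuousLinearMap_comp (ContinuousLinearMap.apply ℝ ℝ u)

theorem memLp_dual_sub_smul (hg : MemLp g p μ) (c : ℝ) (L : A →L[ℝ] E →L[ℝ] ℝ) {a : X → A}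
    (ha : MemLp a p μ) : MemLp (fun t => g t - c • L (a t)) p μ :=
  hg.sub ((ha.continuousLinearMap_comp L).const_smul c)

theorem integrable_dual_apply (hg : MemLp g 2 μ) {u : X → E} (hu : MemLp u 2 μ) :
    Integrable (fun t => g t (u t)) μ :=
  memLp_one_iff_integrable.1
    ((ContinuousLinearMap.id ℝ (E →L[ℝ] ℝ)).memLp_of_bilin (q := 2) 1 hg hu)

theorem memLp_indicator_of_restrict {F : Type*} [NormedAddCommGroup F] {a : X → F}
    {S : Set X} (hS : MeasurableSet S)
    (ha : MemLp a p (μ.restrict S)) : MemLp (S.indicator a) p μ :=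
  (memLp_indicator_iff_restrict hS).2 ha

theorem DiagonalLimit.dual_apply {T : ℝ} {g : ℝ → E →L[ℝ] ℝ} {u : ℝ → E} (hg : MemLp g 2)
    (hu : MemLp u 2) : DiagonalLimit T (fun r τ => g r (u τ)) :=
  DiagonalLimit.of_bilinear (p := 2) (q := 2) (ContinuousLinearMap.id ℝ (E →L[ℝ] ℝ)) hg hu
    (Or.inl (by norm_num))

end Dual

/-! ### The duality pairing along a weak solution -/

section Pairing

variable {d : ℕ} {Ω : Set (Vec d)} {ν T : ℝ}

/-- The pair `(u, ∇u)` as an element of `H¹_0` if it belongs to this space, and `0` otherwise. -/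
def h10Lift (u : L2 Ω (Fin d)) : H10 Ω :=
  open Classical in if h : (u, wgrad u) ∈ H10 Ω then ⟨(u, wgrad u), h⟩ else 0

theorem h10Lift_of_mem {u : L2 Ω (Fin d)} (h : (u, wgrad u) ∈ H10 Ω) :
    h10Lift u = ⟨(u, wgrad u), h⟩ := dif_pos h

theorem pairing_eq (F : Hm1 Ω × L2 Ω (Fin d)) (u : L2 Ω (Fin d)) :
    pairing F u = F.1 (h10Lift u) + ⟪F.2, u⟫ := by
  unfold pairing h10Lift
  split_ifs <;> simp

theorem h10Lift_toL2 (hΩ : IsOpen Ω) {w : Vec d → Vec d} (hw : IsTest Ω w) :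
    h10Lift (toL2 Ω w) = ⟨(toL2 Ω w, toL2 Ω (gradField w)), testPair_mem_H10 hw⟩ := by
  have h := testPair_mem_H10 hw
  rw [← wgrad_toL2 hΩ hw] at h
  rw [h10Lift_of_mem h]
  exact Subtype.ext (Prod.ext rfl (wgrad_toL2 hΩ hw))

theorem h10Lift_const_smul (hΩ : IsOpen Ω) (c : ℝ) {w : Vec d → Vec d} (hw : IsTest Ω w) :
    h10Lift (c • toL2 Ω w) = c • h10Lift (toL2 Ω w) := by
  rw [← toL2_const_smul c (hw.memLp 2 _), h10Lift_toL2 hΩ (hw.const_smul c), h10Lift_toL2 hΩ hw]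
  refine Subtype.ext (Prod.ext (toL2_const_smul c (hw.memLp 2 _)) ?_)
  change toL2 Ω (gradField fun x => c • w x) = c • toL2 Ω (gradField w)
  rw [gradField_const_smul c hw.differentiable, toL2_const_smul c (hw.gradField.memLp 2 _)]

theorem h10Lift_sub {u v : L2 Ω (Fin d)} (hu : (u, wgrad u) ∈ H10 Ω) (hv : (v, wgrad v) ∈ H10 Ω)
    (huv : wgrad (u - v) = wgrad u - wgrad v) : h10Lift (u - v) = h10Lift u - h10Lift v := by
  have h : (u - v, wgrad (u - v)) ∈ H10 Ω := by
    rw [huv]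
    exact (H10 Ω).sub_mem hu hv
  rw [h10Lift_of_mem h, h10Lift_of_mem hu, h10Lift_of_mem hv]
  exact Subtype.ext (Prod.ext rfl huv)

theorem WeakApprox.tendsto_h10Lift (hΩ : IsOpen Ω) {φ : ℕ → Vec d → Vec d} {u : L2 Ω (Fin d)}
    (h : WeakApprox Ω φ u (wgrad u)) (F : Hm1 Ω) :
    Tendsto (fun n => F (h10Lift (toL2 Ω (φ n)))) atTop (𝓝 (F (h10Lift u))) := by
  simp only [h10Lift_toL2 hΩ (h.isSolTest _).1, h10Lift_of_mem h.mem_H10]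
  exact h.tendsto_Hm1 F

/-- The default value 0 of `h10Lift` occurs only on a null set of times; measurability descends from
the ambient product along the embedding of the subspace. -/
theorem MemX.memLp_h10Lift {v : ℝ → L2 Ω (Fin d)} (hv : MemX Ω ν T v) (hν : 0 < ν) :
    MemLp (fun t => h10Lift (v t)) 2 (timeMeasure T) := by
  have hm : MemLp (fun t => (v t, wgrad (v t))) 2 (timeMeasure T) :=
    memLp_prod_iff.2 ⟨hv.memLp_top.mono_exponent le_top, hv.memLp_grad hν⟩
  have hc : MemLp (fun t => (h10Lift (v t) : L2 Ω (Fin d) × L2 Ω (Fin d × Fin d))) 2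
      (timeMeasure T) := by
    refine hm.ae_eq ?_
    filter_upwards [hv.mem_H10sigma hν] with t ht
    rw [h10Lift_of_mem (mem_H10_of_mem_H10sigma ht)]
  refine hc.of_le ?_ (ae_of_all _ fun t => le_rfl)
  exact (IsEmbedding.subtypeVal.aestronglyMeasurable_comp_iff
    (f := fun t => h10Lift (v t))).1 hc.1

/-- The functional `φ ↦ (g, ∇φ)` on `H¹_0`. -/
def gradDual (Ω : Set (Vec d)) : L2 Ω (Fin d × Fin d) →L[ℝ] Hm1 Ω :=
  ((ContinuousLinearMap.compL ℝ (H10 Ω) (L2 Ω (Fin d × Fin d)) ℝ).flip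
    ((ContinuousLinearMap.snd ℝ (L2 Ω (Fin d)) (L2 Ω (Fin d × Fin d))).comp
      (H10 Ω).subtypeL)).comp (innerSL ℝ)

theorem gradDual_apply (g : L2 Ω (Fin d × Fin d)) (p : H10 Ω) : gradDual Ω g p = ⟪g, p.1.2⟫ :=
  rfl

/-- The part of `f + ν Δv` in `H^{-1}`. -/
def viscDual (ν : ℝ) (F : Hm1 Ω × L2 Ω (Fin d)) (v : L2 Ω (Fin d)) : Hm1 Ω :=
  open Classical in if 0 < ν then F.1 - ν • gradDual Ω (wgrad v) else 0

variable {f : ℝ → Hm1 Ω × L2 Ω (Fin d)} {v : ℝ → L2 Ω (Fin d)}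

theorem MemX.memLp_viscDual (hv : MemX Ω ν T v) (hf : MemZ Ω ν T f) :
    MemLp (fun t => viscDual ν (f t) (v t)) 2 (timeMeasure T) := by
  by_cases hν : 0 < ν
  · have he : (fun t => viscDual ν (f t) (v t)) =
        fun t => (f t).1 - ν • gradDual Ω (wgrad (v t)) := funext fun t => if_pos hν
    rw [he]
    exact memLp_dual_sub_smul (E := H10 Ω) (hf.memLp_fst hν) ν (gradDual Ω) (hv.memLp_grad hν)
  · have he : (fun t => viscDual ν (f t) (v t)) = fun _ => 0 := funext fun t => if_neg hν
    rw [he]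
    exact memLp_zero_fun (F := Hm1 Ω)

/-- For ν = 0 both sides vanish for every u, since the H⁻¹ part of f is zero; membership of u
matters only for ν > 0. The null set is independent of u. -/
theorem viscDual_apply (hν : 0 ≤ ν) (hf : MemZ Ω ν T f) :
    ∀ᵐ t ∂timeMeasure T, ∀ u : L2 Ω (Fin d), (0 < ν → (u, wgrad u) ∈ H10 Ω) →
      viscDual ν (f t) (v t) (h10Lift u) =
        (f t).1 (h10Lift u) - ν * ⟪wgrad (v t), wgrad u⟫ := by
  rcases hν.eq_or_lt with h0 | hpos
  · filter_upwards [hf.fst_eq_zero h0.symm] with t ht u _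
    simp [viscDual, ht, ← h0]
  · refine ae_of_all _ fun t u hu => ?_
    rw [viscDual, if_pos hpos, h10Lift_of_mem (hu hpos)]
    simp [gradDual_apply]

/-- The functional `u ↦ ∫ v ⊗ v : ∇u - ν (∇v, ∇u) + ⟨F, u⟩`. -/
def rate (ν : ℝ) (F : Hm1 Ω × L2 Ω (Fin d)) (v u : L2 Ω (Fin d)) : ℝ :=
  convInt v (wgrad u) v + viscDual ν F v (h10Lift u) + ⟪F.2, u⟫

/-- `v ⊗ v`. -/
theorem MemX.memLp_tensor (hv : MemX Ω ν T v) :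
    MemLp (fun t => tensorL1 Ω (v t) (v t)) ⊤ (timeMeasure T) :=
  (tensorL1 Ω).memLp_of_bilin (q := ⊤) ⊤ hv.memLp_top hv.memLp_top

theorem MemX.memLp_convInt (hv : MemX Ω ν T v) {g : L2 Ω (Fin d × Fin d)}
    {Γ : Lp (Mat d) ⊤ (volume.restrict Ω)} (hΓ : Γ =ᵐ[volume.restrict Ω] g) :
    MemLp (fun t => convInt (v t) g (v t)) 1 (timeMeasure T) := by
  simp only [convInt_eq_pair _ _ hΓ]
  have h : MemLp (fun t => (pairL1Linf Ω).flip Γ (tensorL1 Ω (v t) (v t))) ⊤ (timeMeasure T) :=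
    ((pairL1Linf Ω).flip Γ).comp_memLp' hv.memLp_tensor
  exact h.mono_exponent le_top

theorem integrableOn_rate (hv : MemX Ω ν T v) (hf : MemZ Ω ν T f)
    {u : L2 Ω (Fin d)} {Γ : Lp (Mat d) ⊤ (volume.restrict Ω)}
    (hΓ : Γ =ᵐ[volume.restrict Ω] wgrad u) :
    IntegrableOn (fun t => rate ν (f t) (v t) u) (Ioo 0 T) := by
  have h2 : MemLp (fun t => viscDual ν (f t) (v t) (h10Lift u)) 2 (timeMeasure T) :=
    memLp_dual_apply (E := H10 Ω) (hv.memLp_viscDual hf) (h10Lift u)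
  have h3 : MemLp (fun t => ⟪(f t).2, u⟫) 1 (timeMeasure T) := hf.memLp_snd.inner_const u
  exact memLp_one_iff_integrable.1
    (((hv.memLp_convInt hΓ).add (h2.mono_exponent (by norm_num))).add h3)

theorem ae_eq_wgrad_toL2 (hΩ : IsOpen Ω) {φ : Vec d → Vec d} (hφ : IsTest Ω φ) :
    (hφ.gradField.memLp ⊤ (volume.restrict Ω)).toLp (gradField φ) =ᵐ[volume.restrict Ω]
      wgrad (toL2 Ω φ) := by
  rw [wgrad_toL2 hΩ hφ]
  exact (MemLp.coeFn_toLp _).trans (toL2_coeFn (hφ.gradField.memLp 2 _)).symm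

theorem integrableOn_continuous_mul {T : ℝ} {g η : ℝ → ℝ} (hη : Continuous η)
    (hg : IntegrableOn g (Ioo 0 T)) : IntegrableOn (fun t => η t * g t) (Ioo 0 T) := by
  rw [← integrableOn_Icc_iff_integrableOn_Ioo] at hg ⊢
  exact hg.continuousOn_mul hη.continuousOn isCompact_Icc

/-- The weak formulation for a single product η(t)φ(x), with all spatial terms collected in `rate`.
Such products are the only test functions needed. -/
theorem weak_formulation_separated (hΩ : IsOpen Ω) (hν : 0 ≤ ν) (hT : 0 < T) (hf : MemZ Ω ν T f)
    {v₀ : L2 Ω (Fin d)} (hv : IsWeakSolution Ω ν T f v₀ v) {φ : Vec d → Vec d}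
    (hφ : IsSolTest Ω φ) {η : ℝ → ℝ} (hη : ContDiff ℝ 1 η) (hη0 : ∃ T' < T, ∀ t, T' ≤ t → η t = 0) :
    -∫ t in Ioo 0 T, deriv η t * ⟪v t, toL2 Ω φ⟫ =
      (∫ t in Ioo 0 T, η t * rate ν (f t) (v t) (toL2 Ω φ)) + η 0 * ⟪v₀, toL2 Ω φ⟫ := by
  have hw := hv.weak_formulation 1 (fun _ => η) (fun _ => φ) (fun _ => ⟨hη, hη0⟩) (fun _ => hφ)
  have inner_smul_eq : ∀ (u : L2 Ω (Fin d)) (c : ℝ),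
      ∫ x in Ω, ⟪u x, c • φ x⟫ = c * ⟪u, toL2 Ω φ⟫ := by
    intro u c
    rw [L2.inner_def, ← integral_const_mul]
    refine integral_congr_ae ?_
    filter_upwards [toL2_coeFn (hφ.1.memLp 2 _)] with x hx
    rw [hx, inner_smul_right]
  have hgrad : ∀ (a : L2 Ω (Fin d)) (g : L2 Ω (Fin d × Fin d)) (c : ℝ),
      ∫ x in Ω, (ν * ⟪g x, c • gradField φ x⟫
        - ∑ i, ∑ j, a x i * a x j * (c • gradField φ x) (i, j)) =
      c * (ν * ⟪g, toL2 Ω (gradField φ)⟫ - convInt a (toL2 Ω (gradField φ)) a) := by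
    intro a g c
    have hae := toL2_coeFn (hφ.1.gradField.memLp 2 (volume.restrict Ω))
    have i1 : Integrable (fun x => ⟪g x, toL2 Ω (gradField φ) x⟫) (volume.restrict Ω) :=
      L2.integrable_inner g (toL2 Ω (gradField φ))
    have i2 : Integrable (fun x => ∑ i, ∑ j, a x j * toL2 Ω (gradField φ) x (i, j) * a x i)
        (volume.restrict Ω) := by
      refine integrable_finsetSum _ fun i _ => integrable_finsetSum _ fun j _ => ?_
      have hb : MemLp (fun x => toL2 Ω (gradField φ) x (i, j)) ⊤ (volume.restrict Ω) :=
        ((hφ.1.gradField.apply (i, j)).memLp ⊤ _).ae_eq (by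
          filter_upwards [hae] with x hx
          rw [hx])
      have := integrable_mul (memLp_apply a j) (memLp_apply a i)
      refine (memLp_one_iff_integrable.1 ((memLp_one_iff_integrable.2 this).mul (r := 1) hb)).congr
        (ae_of_all _ fun x => ?_)
      simp only [Pi.mul_apply]
      ring
    rw [L2.inner_def, convInt, ← integral_const_mul, ← integral_sub (i1.const_mul ν) i2,
      ← integral_const_mul]
    refine integral_congr_ae ?_
    filter_upwards [hae] with x hx
    rw [hx, inner_smul_right, mul_sub, Finset.mul_sum]
    congr 1
    · ring
    · refine Finset.sum_congr rfl fun i _ => ?_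
      rw [Finset.mul_sum]
      refine Finset.sum_congr rfl fun j _ => ?_
      simp only [PiLp.smul_apply, smul_eq_mul]
      ring
  simp only [Finset.univ_unique, Finset.sum_singleton, inner_smul_eq, hgrad] at hw
  simp only [intervalIntegral.integral_of_le hT.le, integral_Ioc_eq_integral_Ioo] at hw
  have hrate : IntegrableOn (fun t => η t * rate ν (f t) (v t) (toL2 Ω φ)) (Ioo 0 T) :=
    integrableOn_continuous_mul hη.continuous
      (integrableOn_rate hv.memX hf (ae_eq_wgrad_toL2 hΩ hφ.1))
  have hvisc : MemLp (fun t => ν * ⟪wgrad (v t), toL2 Ω (gradField φ)⟫) 1 (timeMeasure T) := by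
    rcases hν.eq_or_lt with h0 | hpos
    · simp [← h0]
    · exact (((hv.memX.memLp_grad hpos).inner_const _).const_mul ν).mono_exponent (by norm_num)
  have hA : IntegrableOn (fun t => η t * (ν * ⟪wgrad (v t), toL2 Ω (gradField φ)⟫ -
      convInt (v t) (toL2 Ω (gradField φ)) (v t))) (Ioo 0 T) := by
    refine integrableOn_continuous_mul hη.continuous (memLp_one_iff_integrable.1 (hvisc.sub ?_))
    rw [← wgrad_toL2 hΩ hφ.1]
    exact hv.memX.memLp_convInt (ae_eq_wgrad_toL2 hΩ hφ.1)
  have hB : ∫ t in Ioo 0 T, pairing (f t) (η t • toL2 Ω φ) =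
      (∫ t in Ioo 0 T, η t * rate ν (f t) (v t) (toL2 Ω φ)) +
      ∫ t in Ioo 0 T, η t * (ν * ⟪wgrad (v t), toL2 Ω (gradField φ)⟫ -
      convInt (v t) (toL2 Ω (gradField φ)) (v t)) := by
    rw [← integral_add hrate hA]
    refine integral_congr_ae ?_
    filter_upwards [viscDual_apply (v := v) hν hf] with t ht
    have hmem : (toL2 Ω φ, wgrad (toL2 Ω φ)) ∈ H10 Ω := by
      rw [wgrad_toL2 hΩ hφ.1]
      exact testPair_mem_H10 hφ.1
    rw [rate, ht _ fun _ => hmem, pairing_eq, h10Lift_const_smul hΩ _ hφ.1, inner_smul_right,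
      map_smul, smul_eq_mul, wgrad_toL2 hΩ hφ.1]
    ring
  rw [hB] at hw
  linarith

end Pairing

/-! ### Weak continuity in time of weak solutions -/

section Continuity

variable {d : ℕ} {Ω : Set (Vec d)} {ν T : ℝ} {f : ℝ → Hm1 Ω × L2 Ω (Fin d)}
  {v : ℝ → L2 Ω (Fin d)} {v₀ : L2 Ω (Fin d)}

theorem intervalIntegrable_of_integrableOn_Ioo {I : ℝ → ℝ} (hI : IntegrableOn I (Ioo 0 T))
    {a b : ℝ} (ha : a ∈ Icc 0 T) (hb : b ∈ Icc 0 T) : IntervalIntegrable I volume a b := by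
  rw [← integrableOn_Icc_iff_integrableOn_Ioo] at hI
  exact (hI.mono_set (uIcc_subset_Icc ha hb)).intervalIntegrable

theorem continuousOn_primitive_Icc {I : ℝ → ℝ} (hT : 0 ≤ T) (hI : IntegrableOn I (Ioo 0 T)) :
    ContinuousOn (fun t => ∫ r in (0 : ℝ)..t, I r) (Icc 0 T) := by
  rw [← integrableOn_Icc_iff_integrableOn_Ioo, ← uIcc_of_le hT] at hI
  rw [← uIcc_of_le hT]
  exact intervalIntegral.continuousOn_primitive_interval hI

/-- Weak solutions tested with a solenoidal test field. -/
theorem IsWeakSolution.inner_toL2_eq (hΩ : IsOpen Ω) (hν : 0 ≤ ν) (hT : 0 < T)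
    (hf : MemZ Ω ν T f) (hv : IsWeakSolution Ω ν T f v₀ v) {φ : Vec d → Vec d}
    (hφ : IsSolTest Ω φ) : ∀ᵐ t ∂timeMeasure T, ⟪v t, toL2 Ω φ⟫ =
      ⟪v₀, toL2 Ω φ⟫ + ∫ r in (0 : ℝ)..t, rate ν (f r) (v r) (toL2 Ω φ) := by
  set I : ℝ → ℝ := fun r => rate ν (f r) (v r) (toL2 Ω φ) with hIdef
  have hI : IntegrableOn I (Ioo 0 T) := integrableOn_rate hv.memX hf (ae_eq_wgrad_toL2 hΩ hφ.1)
  have hg : IntegrableOn (fun t => ⟪v t, toL2 Ω φ⟫) (Ioo 0 T) :=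
    memLp_one_iff_integrable.1 ((hv.memX.memLp_top.inner_const _).mono_exponent le_top)
  have hP : IntegrableOn (fun t => ∫ r in (0 : ℝ)..t, I r) (Ioo 0 T) :=
    (continuousOn_primitive_Icc hT.le hI).integrableOn_Icc.mono_set Ioo_subset_Icc_self
  have hD : IntegrableOn (fun t => ⟪v t, toL2 Ω φ⟫ - (⟪v₀, toL2 Ω φ⟫ + ∫ r in (0 : ℝ)..t, I r))
      (Ioo 0 T) := hg.sub ((integrable_const _).add hP)
  rw [ae_restrict_iff' measurableSet_Ioo]
  have h := isOpen_Ioo.ae_eq_zero_of_integral_contDiff_smul_eq_zero hD.locallyIntegrableOn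
    fun ψ hψ hψc hψs => ?_
  · filter_upwards [h] with t ht htT
    exact sub_eq_zero.1 (ht htT)
  have hψt : IsTimeTest T ψ := ⟨hψ, hψc, hψs⟩
  rw [← setIntegral_eq_integral_of_forall_compl_eq_zero (s := Ioo 0 T)
    fun t ht => by rw [hψt.eq_zero ht, zero_smul]]
  -- The primitive of ψ that vanishes near T. It need not vanish at 0, where its value −∫ ψ brings
  -- in v₀ and thereby identifies the constant of integration.
  set η : ℝ → ℝ := fun t => (∫ r in (0 : ℝ)..t, ψ r) - ∫ r in (0 : ℝ)..T, ψ r with hη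
  have hηd : ∀ t, HasDerivAt η (ψ t) t := fun t =>
    (intervalIntegral.integral_hasDerivAt_right (hψ.continuous.intervalIntegrable _ _)
      hψ.continuous.stronglyMeasurable.stronglyMeasurableAtFilter
      hψ.continuous.continuousAt).sub_const _
  have hη' : deriv η = ψ := funext fun t => (hηd t).deriv
  have hηs : ∀ t, η t = -∫ r in t..T, ψ r := fun t => by
    rw [hη, ← intervalIntegral.integral_add_adjacent_intervals
      (hψ.continuous.intervalIntegrable 0 t) (hψ.continuous.intervalIntegrable t T)]
    simp
  have hη0 : ∃ T' < T, ∀ t, T' ≤ t → η t = 0 := by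
    obtain ⟨T', hT', hz⟩ : ∃ T' < T, ∀ t, T' ≤ t → ψ t = 0 := by
      rcases (tsupport ψ).eq_empty_or_nonempty with he | hne
      · exact ⟨T - 1, by linarith, fun t _ => image_eq_zero_of_notMem_tsupport (by simp [he])⟩
      · obtain ⟨α, hα⟩ := hψc.isCompact.exists_isGreatest hne
        have hαT := (hψs hα.1).2
        refine ⟨(α + T) / 2, by linarith, fun t ht => image_eq_zero_of_notMem_tsupport fun h => ?_⟩
        have := hα.2 h
        linarith
    refine ⟨T', hT', fun t ht => ?_⟩
    rw [hηs, intervalIntegral.integral_congr (g := fun _ => 0) fun r hr => ?_]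
    · simp
    · exact hz r ((le_min ht hT'.le).trans hr.1)
  have hw := weak_formulation_separated hΩ hν hT hf hv hφ
    (contDiff_one_iff_deriv.2 ⟨fun t => (hηd t).differentiableAt, hη' ▸ hψ.continuous⟩) hη0
  rw [hη'] at hw
  have hsw := integral_smul_primitive_eq (a := 0) (b := T) hψ.continuous hI
  have hψi : IntegrableOn ψ (Ioo 0 T) := (hψ.continuous.integrable_of_hasCompactSupport hψc).integrableOn
  have e1 : ∫ t in Ioo 0 T, η t * rate ν (f t) (v t) (toL2 Ω φ) =
      -∫ r in Ioo 0 T, (∫ t in r..T, ψ t) • I r := by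
    rw [← integral_neg]
    refine integral_congr_ae (ae_of_all _ fun r => ?_)
    simp only [hηs, smul_eq_mul, hIdef]
    ring
  have e2 : η 0 = -∫ t in Ioo 0 T, ψ t := by
    rw [hηs, intervalIntegral.integral_of_le hT.le, integral_Ioc_eq_integral_Ioo]
  rw [e1, e2, ← hsw] at hw
  have i1 := integrableOn_continuous_mul hψ.continuous hg
  have i2 := integrableOn_continuous_mul hψ.continuous hP
  simp only [smul_eq_mul, mul_sub, mul_add] at hw ⊢
  have i3 : IntegrableOn (fun t => ψ t * ⟪v₀, toL2 Ω φ⟫) (Ioo 0 T) := hψi.mul_const _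
  have i4 : IntegrableOn (fun t => ψ t * ⟪v₀, toL2 Ω φ⟫ + ψ t * ∫ r in (0 : ℝ)..t, I r)
      (Ioo 0 T) := i3.add i2
  rw [integral_sub i1 i4, integral_add i3 i2, integral_mul_const]
  linarith

theorem MemX.exists_bound (hv : MemX Ω ν T v) : ∃ C, ∀ᵐ t ∂timeMeasure T, ‖v t‖ ≤ C := by
  refine ⟨(eLpNormEssSup v (timeMeasure T)).toReal, ?_⟩
  filter_upwards [ae_le_eLpNormEssSup (f := v) (μ := timeMeasure T)] with t ht
  rw [← toReal_enorm]
  refine ENNReal.toReal_mono ?_ ht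
  rw [← eLpNorm_exponent_top]
  exact hv.memLp_top.2.ne

theorem tendsto_primitive_nhdsGT {I : ℝ → ℝ} (hI : IntegrableOn I (Ioo 0 T))
    {t : ℝ} (ht : 0 ≤ t) (htT : t < T) :
    Tendsto (fun s => ∫ r in (0 : ℝ)..s, I r) (𝓝[>] t ⊓ ae volume)
      (𝓝 (∫ r in (0 : ℝ)..t, I r)) := by
  have h := (continuousOn_primitive_Icc (ht.trans htT.le) hI) t ⟨ht, htT.le⟩
  refine h.mono_left (inf_le_left.trans ?_)
  rw [← nhdsWithin_Ioo_eq_nhdsGT htT]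
  exact nhdsWithin_mono _ fun s hs => ⟨ht.trans hs.1.le, hs.2.le⟩

/-- Outside a null set of times, a weak solution satisfies the integrated equation for all
solenoidal test fields. -/
theorem IsWeakSolution.exists_full_set (hΩ : IsOpen Ω) (hν : 0 ≤ ν) (hT : 0 < T)
    (hf : MemZ Ω ν T f) (hv : IsWeakSolution Ω ν T f v₀ v) :
    ∃ G : Set ℝ, (∀ᵐ t ∂timeMeasure T, t ∈ G) ∧ ∀ φ, IsSolTest Ω φ → ∀ t ∈ G, t ∈ Ioo 0 T →
      ⟪v t, toL2 Ω φ⟫ = ⟪v₀, toL2 Ω φ⟫ + ∫ r in (0 : ℝ)..t, rate ν (f r) (v r) (toL2 Ω φ) := by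
  obtain ⟨C, hC⟩ := hv.memX.exists_bound
  have : Fact ((2 : ℝ≥0∞) ≠ ⊤) := ⟨by norm_num⟩
  -- `rate` is not continuous in φ with respect to L², so density of D does not transfer the
  -- equation directly. Instead, the equation on D makes v weakly right-continuous at t when tested
  -- with solenoidal test fields. The equation for φ holds at almost every s > t, and letting s
  -- decrease to t gives it at t.
  obtain ⟨D, hDS, hDc, hDd⟩ := (TopologicalSpace.IsSeparable.of_separableSpace
    {u : L2 Ω (Fin d) | ∃ w, IsSolTest Ω w ∧ u = toL2 Ω w}).exists_countable_dense_subset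
  set Q : ℝ → L2 Ω (Fin d) → Prop := fun t x =>
    ⟪v t, x⟫ = ⟪v₀, x⟫ + ∫ r in (0 : ℝ)..t, rate ν (f r) (v r) x with hQ
  have hDae : ∀ᵐ t ∂timeMeasure T, ∀ x ∈ D, Q t x := by
    rw [ae_ball_iff hDc]
    intro x hx
    obtain ⟨w, hw, rfl⟩ := hDS hx
    exact hv.inner_toL2_eq hΩ hν hT hf hw
  refine ⟨{t | ∀ x ∈ D, Q t x}, hDae, fun φ hφ t htG htT => ?_⟩
  have hI : ∀ {φ}, IsSolTest Ω φ → IntegrableOn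
      (fun r => rate ν (f r) (v r) (toL2 Ω φ)) (Ioo 0 T) := fun hφ =>
    integrableOn_rate hv.memX hf (ae_eq_wgrad_toL2 hΩ hφ.1)
  have hev : ∀ {P : ℝ → Prop}, (∀ᵐ s ∂timeMeasure T, P s) → ∀ᶠ s in 𝓝[>] t ⊓ ae volume, P s :=
    fun h => eventually_nhdsGT_inf_ae htT.1.le htT.2 le_rfl (h.mono fun s hs _ => hs)
  have hweak : Tendsto (fun s => ⟪v s, toL2 Ω φ⟫) (𝓝[>] t ⊓ ae volume) (𝓝 ⟪v t, toL2 Ω φ⟫) := by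
    refine tendsto_inner_of_mem_closure_span (S := D) (hev hC) (fun x hx => ?_)
      (closure_mono Submodule.subset_span (hDd ⟨φ, hφ, rfl⟩))
    have htx : Q t x := htG x hx
    rw [htx]
    obtain ⟨w, hw, rfl⟩ := hDS hx
    refine ((tendsto_primitive_nhdsGT (hI hw) htT.1.le htT.2).const_add _).congr' ?_
    filter_upwards [hev hDae] with s hs
    exact (hs _ hx).symm
  have := neBot_nhdsGT_inf_ae t
  refine tendsto_nhds_unique hweak
    (((tendsto_primitive_nhdsGT (hI hφ) htT.1.le htT.2).const_add _).congr' ?_)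
  filter_upwards [hev (hv.inner_toL2_eq hΩ hν hT hf hφ)] with s hs
  exact hs.symm

/-- The initial value is attained weakly. -/
theorem IsWeakSolution.tendsto_initial (hΩ : IsOpen Ω) (hν : 0 ≤ ν) (hT : 0 < T)
    (hf : MemZ Ω ν T f) (hv : IsWeakSolution Ω ν T f v₀ v) (hv₀ : v₀ ∈ L2sigma Ω)
    (u : L2 Ω (Fin d)) :
    Tendsto (fun τ => ⟪v τ, u⟫) (plusFilter T 0) (𝓝 ⟪v₀, u⟫) := by
  rw [plusFilter, if_pos hT]
  have hev : ∀ {P : ℝ → Prop}, (∀ᵐ s ∂timeMeasure T, P s) →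
      ∀ᶠ s in 𝓝[>] (0 : ℝ) ⊓ ae volume, P s :=
    fun h => eventually_nhdsGT_inf_ae le_rfl hT le_rfl (h.mono fun s hs _ => hs)
  obtain ⟨C, hC⟩ := hv.memX.exists_bound
  -- Almost all v(τ), and v₀, lie in L²_σ, so u may be replaced by its orthogonal projection, which
  -- solenoidal test fields approximate.
  set S := (solTestSubmodule Ω).topologicalClosure with hS
  have : CompleteSpace S :=
    (solTestSubmodule Ω).isClosed_topologicalClosure.completeSpace_coe
  have hdec : ∀ x ∈ L2sigma Ω, ⟪x, u⟫ = ⟪x, S.starProjection u⟫ := by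
    intro x hx
    rw [← sub_eq_zero, ← inner_sub_right]
    exact (Submodule.mem_orthogonal _ _).1 (S.sub_starProjection_mem_orthogonal u) x hx
  have hlim : Tendsto (fun τ => ⟪v τ, S.starProjection u⟫)
      (𝓝[>] (0 : ℝ) ⊓ ae volume) (𝓝 ⟪v₀, S.starProjection u⟫) := by
    refine tendsto_inner_of_mem_closure_span (S := (solTestSubmodule Ω : Set (L2 Ω (Fin d))))
      (hev hC) ?_ (by rw [Submodule.span_eq]; exact S.starProjection_apply_mem u)
    rintro _ ⟨φ, hφ, rfl⟩
    have h := (tendsto_primitive_nhdsGT (integrableOn_rate hv.memX hf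
      (ae_eq_wgrad_toL2 hΩ hφ.1)) le_rfl hT).const_add ⟪v₀, toL2 Ω φ⟫
    rw [intervalIntegral.integral_same, add_zero] at h
    refine h.congr' ?_
    filter_upwards [hev (hv.inner_toL2_eq hΩ hν hT hf hφ)] with s hs
    exact hs.symm
  rw [hdec v₀ hv₀]
  refine hlim.congr' ?_
  filter_upwards [hev hv.memX.mem_L2sigma] with τ hτ
  exact (hdec _ hτ).symm

/-- The integrated equation extends to fields with an approximation by test fields. -/
theorem inner_eq_of_symApprox (hΩ : IsOpen Ω) (hΩb : Bornology.IsBounded Ω)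
    (hf : MemZ Ω ν T f) (hv : MemX Ω ν T v) {t : ℝ} (ht : t ∈ Ioo 0 T)
    (h : ∀ φ, IsSolTest Ω φ → ⟪v t, toL2 Ω φ⟫ =
      ⟪v₀, toL2 Ω φ⟫ + ∫ r in (0 : ℝ)..t, rate ν (f r) (v r) (toL2 Ω φ))
    {φ : ℕ → Vec d → Vec d} {C : ℝ} {u : L2 Ω (Fin d)} (hu : SymApprox Ω φ C u)
    (hg : HasWeakGrad Ω u (wgrad u)) {Γ : Lp (Mat d) ⊤ (volume.restrict Ω)}
    (hΓ : Γ =ᵐ[volume.restrict Ω] wgrad u) :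
    ⟪v t, u⟫ = ⟪v₀, u⟫ + ∫ r in (0 : ℝ)..t, rate ν (f r) (v r) u := by
  have hWA := hu.weakApprox hΩb hΩ hg
  obtain ⟨K₁, hK₁⟩ := hu.norm_grad_le hΩb
  obtain ⟨K₂, hK₂⟩ := (Metric.isBounded_range_of_tendsto _ hu.tendsto).exists_norm_le
  have hK₂' : ∀ n, ‖toL2 Ω (φ n)‖ ≤ K₂ := fun n => hK₂ _ ⟨n, rfl⟩
  have hlift : ∀ n, ‖h10Lift (toL2 Ω (φ n))‖ ≤ max K₂ K₁ := fun n => by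
    rw [h10Lift_toL2 hΩ (hu.isSolTest n).1]
    exact max_le_max (hK₂' n) (hK₁ n)
  have hsub : Ioc 0 t ⊆ Ioo 0 T := fun s hs => ⟨hs.1, hs.2.trans_lt ht.2⟩
  have hlim : Tendsto (fun n => ∫ r in (0 : ℝ)..t, rate ν (f r) (v r) (toL2 Ω (φ n))) atTop
      (𝓝 (∫ r in (0 : ℝ)..t, rate ν (f r) (v r) u)) := by
    simp only [intervalIntegral.integral_of_le ht.1.le]
    refine tendsto_integral_of_dominated_convergence
      (fun r => 1 / 2 * (d * (d * (|C| * ‖v r‖ ^ 2))) +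
        ‖viscDual ν (f r) (v r)‖ * max K₂ K₁ + ‖(f r).2‖ * K₂) (fun n => ?_) ?_ (fun n => ?_) ?_
    · exact ((integrableOn_rate hv hf (ae_eq_wgrad_toL2 hΩ (hu.isSolTest n).1)).mono_set hsub).1
    · have h1 : IntegrableOn (fun r => ‖v r‖ ^ 2) (Ioo 0 T) :=
        (hv.memLp_top.mono_exponent le_top : MemLp v 2 _).integrable_norm_pow (by norm_num)
      have h2 : IntegrableOn (fun r => ‖viscDual ν (f r) (v r)‖) (Ioo 0 T) :=
        (MemLp.norm (E := Hm1 Ω) (hv.memLp_viscDual hf)).integrable (by norm_num)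
      have h3 : IntegrableOn (fun r => ‖(f r).2‖) (Ioo 0 T) := hf.memLp_snd.norm.integrable le_rfl
      have h4 : IntegrableOn (fun r => 1 / 2 * (d * (d * (|C| * ‖v r‖ ^ 2))) +
          ‖viscDual ν (f r) (v r)‖ * max K₂ K₁ + ‖(f r).2‖ * K₂) (Ioo 0 T) :=
        (((((h1.const_mul |C|).const_mul (d : ℝ)).const_mul (d : ℝ)).const_mul (1 / 2)).add
          (h2.mul_const _)).add (h3.mul_const _)
      exact h4.mono_set hsub
    · refine ae_of_all _ fun r => ?_
      rw [rate, wgrad_toL2 hΩ (hu.isSolTest n).1]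
      refine (norm_add_le _ _).trans (add_le_add ((norm_add_le _ _).trans (add_le_add ?_ ?_)) ?_)
      · exact abs_convInt_self_le _ (hu.bound_ae n)
      · exact ((viscDual ν (f r) (v r)).le_opNorm _).trans
          (mul_le_mul_of_nonneg_left (hlift n) (norm_nonneg _))
      · exact (norm_inner_le_norm _ _).trans
          (mul_le_mul_of_nonneg_left (hK₂' n) (norm_nonneg _))
    · refine ae_of_all _ fun r => ?_
      unfold rate
      simp only [wgrad_toL2 hΩ (hu.isSolTest _).1]
      exact ((hu.tendsto_convInt hΩb hΩ hg hΓ (v r)).add (hWA.tendsto_h10Lift hΩ _)).add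
        (tendsto_const_nhds.inner hu.tendsto)
  refine tendsto_nhds_unique (tendsto_const_nhds.inner hu.tendsto)
    (((tendsto_const_nhds.inner hu.tendsto).add hlim).congr fun n => ?_)
  rw [h _ (hu.isSolTest n)]

end Continuity

/-! ### Product rules in time -/

section ProductRule

variable {d : ℕ} {Ω : Set (Vec d)} {ν T : ℝ} {f : ℝ → Hm1 Ω × L2 Ω (Fin d)}
  {v w w' : ℝ → L2 Ω (Fin d)} {v₀ : L2 Ω (Fin d)}

theorem DiagonalLimit.add_of_integrable {n m : ℝ → ℝ → ℝ} (hn : DiagonalLimit T n)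
    (hm : DiagonalLimit T m) (hni : Integrable (fun t => n t t))
    (hmi : Integrable (fun t => m t t)) : DiagonalLimit T (fun r τ => n r τ + m r τ) := by
  have key : ∀ {g : ℝ → ℝ}, Integrable g → ∀ ψ, IsTimeTest T ψ →
      Integrable (fun t => ψ t * g t) := fun hg ψ hψ => by
    obtain ⟨C, hC⟩ := hψ.exists_bound
    exact hg.bdd_mul hψ.1.continuous.aestronglyMeasurable (ae_of_all _ hC)
  exact hn.add hm (key hni) (key hmi)

theorem HasWeakTimeDeriv.memLp_one (h : HasWeakTimeDeriv T w w') : MemLp w' 1 (timeMeasure T) :=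
  h.memLp.mono_exponent (by norm_num)

/-- The product rule for `½ ‖w‖²`. -/
theorem HasWeakTimeDeriv.norm_sq_eq (hT : 0 < T) (hw : MemLp w ⊤ (timeMeasure T))
    (h : HasWeakTimeDeriv T w w') : ∃ c, ∀ᵐ t ∂timeMeasure T,
      1 / 2 * ‖w t‖ ^ 2 = c + ∫ r in (0 : ℝ)..t, ⟪w' r, w r⟫ := by
  set a := (Ioo 0 T).indicator w' with ha
  set b := (Ioo 0 T).indicator w with hb
  have ham : MemLp a 1 := memLp_indicator_of_restrict measurableSet_Ioo h.memLp_one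
  have hbm : MemLp b ⊤ := memLp_indicator_of_restrict measurableSet_Ioo hw
  have hw'i : IntegrableOn w' (Ioo 0 T) := memLp_one_iff_integrable.1 h.memLp_one
  have hwi : IntegrableOn w (Ioo 0 T) := memLp_one_iff_integrable.1 (hw.mono_exponent le_top)
  obtain ⟨c₀, hc₀⟩ := ae_eq_const_add_primitive hT hwi hw'i h.integral_eq
  have hdiag : DiagonalLimit T (fun r τ => ⟪a r, b τ⟫) :=
    DiagonalLimit.of_bilinear (p := 1) (q := ⊤) (innerSL ℝ) ham hbm (Or.inl (by norm_num))
  have hint : Integrable (fun t => ⟪a t, b t⟫) :=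
    memLp_one_iff_integrable.1 ((innerSL ℝ).memLp_of_bilin (q := ⊤) 1 ham hbm)
  have heq : ∀ r ∈ Ioo 0 T, ∀ τ ∈ Ioo 0 T, ⟪a r, b τ⟫ = ⟪w' r, w τ⟫ := fun r hr τ hτ => by
    rw [ha, hb, indicator_of_mem hr, indicator_of_mem hτ]
  have hI : ∀ {s t : ℝ}, s ∈ Icc 0 T → t ∈ Icc 0 T → IntervalIntegrable w' volume s t :=
    fun hs ht => by
      have h' := hw'i
      rw [← integrableOn_Icc_iff_integrableOn_Ioo] at h'
      exact (h'.mono_set (uIcc_subset_Icc hs ht)).intervalIntegrable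
  -- The product rule with v = w and n(r, τ) = ⟪w' r, w τ⟫; its two halves contribute equally,
  -- whence the factor ½.
  obtain ⟨c, hc⟩ := product_rule hT hw hw h.memLp_one (fun φ hφ => h.integral_eq φ hφ.1 hφ.2.1 hφ.2.2)
    hint.integrableOn hdiag (G := {t | w t = c₀ + ∫ r in (0 : ℝ)..t, w' r}) hc₀ (by
      filter_upwards [ae_restrict_mem measurableSet_Ioo] with τ hτ s hs t ht hsT htT hst
      have hs' : w s = c₀ + ∫ r in (0 : ℝ)..s, w' r := hs
      have ht' : w t = c₀ + ∫ r in (0 : ℝ)..t, w' r := ht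
      have h0 : (0 : ℝ) ∈ Icc 0 T := ⟨le_rfl, hT.le⟩
      have hsI := Ioo_subset_Icc_self hsT
      have htI := Ioo_subset_Icc_self htT
      rw [hs', ht', add_sub_add_left_eq_sub,
        intervalIntegral.integral_interval_sub_left (hI h0 htI) (hI h0 hsI)]
      have e : ∫ r in s..t, ⟪a r, b τ⟫ = ∫ r in s..t, ⟪w τ, w' r⟫ :=
        intervalIntegral.integral_congr fun r hr => by
          rw [uIcc_of_le hst] at hr
          rw [heq r ⟨hsT.1.trans_le hr.1, hr.2.trans_lt htT.2⟩ τ hτ, real_inner_comm]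
      rw [e, real_inner_comm]
      exact ((innerSL ℝ (w τ)).intervalIntegral_comp_comm (hI hsI htI)).symm)
  refine ⟨c / 2, ?_⟩
  filter_upwards [hc, ae_restrict_mem measurableSet_Ioo] with t ht htT
  rw [real_inner_self_eq_norm_sq] at ht
  have e : ∫ r in (0 : ℝ)..t, (⟪a r, b r⟫ + ⟪w r, w' r⟫) = 2 * ∫ r in (0 : ℝ)..t, ⟪w' r, w r⟫ := by
    rw [← intervalIntegral.integral_const_mul, intervalIntegral.integral_of_le htT.1.le,
      intervalIntegral.integral_of_le htT.1.le]
    refine setIntegral_congr_fun measurableSet_Ioc fun r hr => ?_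
    have hrT : r ∈ Ioo 0 T := ⟨hr.1, hr.2.trans_lt htT.2⟩
    rw [heq r hrT r hrT, real_inner_comm (w r) (w' r)]
    ring
  rw [ht, e]
  ring

theorem exists_diagonal_viscDual (hf : MemZ Ω ν T f) (hv : MemX Ω ν T v) (hw : MemX Ω ν T w) :
    ∃ n : ℝ → ℝ → ℝ, DiagonalLimit T n ∧ Integrable (fun t => n t t) ∧
      ∀ r ∈ Ioo 0 T, ∀ τ ∈ Ioo 0 T, n r τ = viscDual ν (f r) (v r) (h10Lift (w τ)) := by
  by_cases hpos : 0 < ν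
  · have mℓ : MemLp ((Ioo 0 T).indicator fun r => viscDual ν (f r) (v r)) 2 :=
      memLp_indicator_of_restrict (F := Hm1 Ω) measurableSet_Ioo (hv.memLp_viscDual hf)
    have mp : MemLp ((Ioo 0 T).indicator fun r => h10Lift (w r)) 2 :=
      memLp_indicator_of_restrict (F := H10 Ω) measurableSet_Ioo (hw.memLp_h10Lift hpos)
    refine ⟨_, DiagonalLimit.dual_apply (E := H10 Ω) mℓ mp,
      integrable_dual_apply (E := H10 Ω) mℓ mp, fun r hr τ hτ => ?_⟩
    rw [indicator_of_mem hr, indicator_of_mem hτ]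
  · refine ⟨fun _ _ => 0, DiagonalLimit.of_eq_zero fun _ _ => rfl, integrable_zero _ _ _,
      fun r _ τ _ => ?_⟩
    rw [viscDual, if_neg hpos]
    rfl

/-- `rate` is a sum of three bilinear couplings with conjugate exponents in time: v ⊗ v in L^∞ with
∇w in L¹, the H⁻¹ part in L² with `h10Lift` of w in L², and the L² part of f in L¹ with w in L^∞.
The function n extends the factors by zero outside (0, T). -/
theorem exists_diagonal_rate (hf : MemZ Ω ν T f) (hv : MemX Ω ν T v) (hw : MemX Ω ν T w)
    {Γ : ℝ → Lp (Mat d) ⊤ (volume.restrict Ω)} (hΓ : MemLp Γ 1 (timeMeasure T)) :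
    ∃ n : ℝ → ℝ → ℝ, DiagonalLimit T n ∧ Integrable (fun t => n t t) ∧
      ∀ r ∈ Ioo 0 T, ∀ τ ∈ Ioo 0 T, Γ τ =ᵐ[volume.restrict Ω] wgrad (w τ) →
        n r τ = rate ν (f r) (v r) (w τ) := by
  obtain ⟨n₂, d2, i2, e2⟩ := exists_diagonal_viscDual hf hv hw
  have mV : MemLp ((Ioo 0 T).indicator fun r => tensorL1 Ω (v r) (v r)) ⊤ :=
    memLp_indicator_of_restrict measurableSet_Ioo hv.memLp_tensor
  have mΓ : MemLp ((Ioo 0 T).indicator Γ) 1 := memLp_indicator_of_restrict measurableSet_Ioo hΓ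
  have mf : MemLp ((Ioo 0 T).indicator fun r => (f r).2) 1 :=
    memLp_indicator_of_restrict measurableSet_Ioo hf.memLp_snd
  have mw : MemLp ((Ioo 0 T).indicator w) ⊤ :=
    memLp_indicator_of_restrict measurableSet_Ioo hw.memLp_top
  have d1 := DiagonalLimit.of_bilinear (T := T) (p := ⊤) (q := 1) (pairL1Linf Ω) mV mΓ
    (Or.inr (by norm_num))
  have i1 := memLp_one_iff_integrable.1 ((pairL1Linf Ω).memLp_of_bilin (q := 1) 1 mV mΓ)
  have d3 := DiagonalLimit.of_bilinear (T := T) (p := 1) (q := ⊤) (innerSL ℝ) mf mw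
    (Or.inl (by norm_num))
  have i3 := memLp_one_iff_integrable.1 ((innerSL ℝ).memLp_of_bilin (q := ⊤) 1 mf mw)
  refine ⟨_, (d1.add_of_integrable d2 i1 i2).add_of_integrable d3 (i1.add i2) i3,
    (i1.add i2).add i3, fun r hr τ hτ hΓτ => ?_⟩
  rw [e2 r hr τ hτ, indicator_of_mem hr, indicator_of_mem hτ, indicator_of_mem hr,
    indicator_of_mem hτ, rate, convInt_eq_pair _ _ hΓτ]
  rfl

/-- The product rule for a weak solution and a comparison function. -/
theorem IsWeakSolution.inner_eq (hΩ : IsOpen Ω) (hΩb : Bornology.IsBounded Ω) (hν : 0 ≤ ν)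
    (hT : 0 < T) (hf : MemZ Ω ν T f) (hv : IsWeakSolution Ω ν T f v₀ v) (hw : MemY Ω ν T w)
    (hw' : HasWeakTimeDeriv T w w') (hS : ∀ᵐ t ∂timeMeasure T, ∃ φ C, SymApprox Ω φ C (w t)) :
    IntegrableOn (fun r => rate ν (f r) (v r) (w r)) (Ioo 0 T) ∧
    ∃ c, ∀ᵐ t ∂timeMeasure T, ⟪v t, w t⟫ =
      c + ∫ r in (0 : ℝ)..t, (rate ν (f r) (v r) (w r) + ⟪v r, w' r⟫) := by
  obtain ⟨hgrad, -, Γ, hΓ, hΓw⟩ := hw.memL1W1inf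
  have hIoo : MeasurableSet (Ioo 0 T) := measurableSet_Ioo
  obtain ⟨n, hdiag, hint, heq⟩ := exists_diagonal_rate hf hv.memX hw.memX hΓ
  have hnr : ∀ᵐ r ∂timeMeasure T, n r r = rate ν (f r) (v r) (w r) := by
    filter_upwards [hΓw, ae_restrict_mem hIoo] with r h1 h2
    exact heq r h2 r h2 h1
  refine ⟨hint.integrableOn.congr hnr, ?_⟩
  obtain ⟨G, hG, hGv⟩ := hv.exists_full_set hΩ hν hT hf
  obtain ⟨c, hc⟩ := product_rule hT hv.memX.memLp_top hw.memX.memLp_top hw'.memLp_one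
    (fun φ hφ => hw'.integral_eq φ hφ.1 hφ.2.1 hφ.2.2) hint.integrableOn hdiag hG (by
      filter_upwards [hgrad, hΓw, hS, ae_restrict_mem hIoo] with τ h1 h2 h3 hτ s hs t ht hsT htT hst
      obtain ⟨φ, C, hφ⟩ := h3
      have hr := integrableOn_rate hv.memX hf h2
      have h0 : (0 : ℝ) ∈ Icc 0 T := ⟨le_rfl, hT.le⟩
      -- The field w τ is frozen while v evolves from s to t: it serves as a time-independent test
      -- field in the integrated equation.
      rw [inner_sub_left,
        inner_eq_of_symApprox hΩ hΩb hf hv.memX htT (fun ψ hψ => hGv ψ hψ t ht htT) hφ h1 h2,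
        inner_eq_of_symApprox hΩ hΩb hf hv.memX hsT (fun ψ hψ => hGv ψ hψ s hs hsT) hφ h1 h2,
        add_sub_add_left_eq_sub, intervalIntegral.integral_interval_sub_left
          (intervalIntegrable_of_integrableOn_Ioo hr h0 (Ioo_subset_Icc_self htT))
          (intervalIntegrable_of_integrableOn_Ioo hr h0 (Ioo_subset_Icc_self hsT))]
      refine intervalIntegral.integral_congr fun r hr => ?_
      rw [uIcc_of_le hst] at hr
      exact (heq r ⟨hsT.1.trans_le hr.1, hr.2.trans_lt htT.2⟩ τ hτ h2).symm)
  refine ⟨c, ?_⟩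
  filter_upwards [hc, ae_restrict_mem hIoo] with t ht htT
  rw [ht]
  congr 1
  rw [intervalIntegral.integral_of_le htT.1.le, intervalIntegral.integral_of_le htT.1.le]
  have hsub : Ioc 0 t ⊆ Ioo 0 T := fun s hs => ⟨hs.1, hs.2.trans_lt htT.2⟩
  refine integral_congr_ae ?_
  filter_upwards [ae_restrict_of_ae_restrict_of_subset hsub hnr] with r hr
  rw [hr]

end ProductRule

/-! ### The relative energy inequality -/

section RelativeEnergy

variable {d : ℕ} {Ω : Set (Vec d)} {ν T : ℝ} {f : ℝ → Hm1 Ω × L2 Ω (Fin d)}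
  {v w w' : ℝ → L2 Ω (Fin d)} {v₀ : L2 Ω (Fin d)} {K : L2 Ω (Fin d) → ℝ≥0∞}

theorem MemX.integrableOn_pairing (hν : 0 ≤ ν) (hv : MemX Ω ν T v) (hf : MemZ Ω ν T f) :
    IntegrableOn (fun t => pairing (f t) (v t)) (Ioo 0 T) := by
  have h2 : IntegrableOn (fun t => ⟪(f t).2, v t⟫) (Ioo 0 T) :=
    memLp_one_iff_integrable.1
      ((innerSL ℝ).memLp_of_bilin (q := ⊤) 1 hf.memLp_snd hv.memLp_top)
  have h1 : IntegrableOn (fun t => (f t).1 (h10Lift (v t))) (Ioo 0 T) := by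
    rcases hν.eq_or_lt with h0 | hpos
    · refine (integrable_zero ℝ ℝ (timeMeasure T)).congr ?_
      filter_upwards [hf.fst_eq_zero h0.symm] with t ht
      rw [ht]
      rfl
    · exact integrable_dual_apply (E := H10 Ω) (hf.memLp_fst hpos) (hv.memLp_h10Lift hpos)
  simp only [pairing_eq]
  exact h1.add h2

theorem MemX.integrableOn_dissipation (hν : 0 ≤ ν) (hv : MemX Ω ν T v) :
    IntegrableOn (fun t => ν * ‖wgrad (v t)‖ ^ 2) (Ioo 0 T) := by
  rcases hν.eq_or_lt with h0 | hpos
  · simp [← h0]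
  · exact ((hv.memLp_grad hpos).integrable_norm_pow (by norm_num)).const_mul ν

theorem WeakApprox.sub {φ ψ : ℕ → Vec d → Vec d} {u v : L2 Ω (Fin d)}
    {g k : L2 Ω (Fin d × Fin d)} (hu : WeakApprox Ω φ u g) (hv : WeakApprox Ω ψ v k) :
    WeakApprox Ω (fun n x => φ n x + (-1 : ℝ) • ψ n x) (u - v) (g - k) := by
  have hneg := fun n => (hv.isSolTest n).const_smul (-1)
  refine ⟨fun n => (hu.isSolTest n).add (hneg n), ?_, fun h => ?_⟩
  · have e : ∀ n, toL2 Ω (fun x => φ n x + (-1 : ℝ) • ψ n x) = toL2 Ω (φ n) - toL2 Ω (ψ n) := by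
      intro n
      rw [toL2_add ((hu.isSolTest n).1.memLp 2 _) ((hneg n).1.memLp 2 _),
        toL2_const_smul _ ((hv.isSolTest n).1.memLp 2 _), neg_one_smul, sub_eq_add_neg]
    simp only [e]
    exact hu.tendsto.sub hv.tendsto
  · have e : ∀ n, toL2 Ω (gradField fun x => φ n x + (-1 : ℝ) • ψ n x) =
        toL2 Ω (gradField (φ n)) - toL2 Ω (gradField (ψ n)) := by
      intro n
      rw [gradField_add (hu.isSolTest n).1.differentiable (hneg n).1.differentiable,
        gradField_const_smul _ (hv.isSolTest n).1.differentiable,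
        toL2_add ((hu.isSolTest n).1.gradField.memLp 2 _)
          (((hv.isSolTest n).1.gradField.const_smul _).memLp 2 _),
        toL2_const_smul _ ((hv.isSolTest n).1.gradField.memLp 2 _), neg_one_smul, sub_eq_add_neg]
    simp only [e, inner_sub_left]
    exact (hu.tendsto_grad h).sub (hv.tendsto_grad h)

/-- The integrand of the relative energy inequality. -/
theorem relForm_add_sysOp_eq (hΩ : IsOpen Ω) (hν : 0 ≤ ν) {F : Hm1 Ω × L2 Ω (Fin d)}
    {v w w' : L2 Ω (Fin d)} (hv : v ∈ L2sigma Ω) (hw : w ∈ L2sigma Ω)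
    (hvH : 0 < ν → v ∈ H10sigma Ω) (hwH : 0 < ν → w ∈ H10sigma Ω) (hF : ν = 0 → F.1 = 0)
    (hvisc : viscDual ν F v (h10Lift w) = F.1 (h10Lift w) - ν * ⟪wgrad v, wgrad w⟫)
    {φ : ℕ → Vec d → Vec d} (hφ : WeakApprox Ω φ w (wgrad w)) (hg : HasWeakGrad Ω w (wgrad w))
    {V : Lp (Vec d) ⊤ (volume.restrict Ω)} (hV : V =ᵐ[volume.restrict Ω] w)
    {Γ : Lp (Mat d) ⊤ (volume.restrict Ω)} (hΓ : Γ =ᵐ[volume.restrict Ω] wgrad w) :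
    relForm ν K v w + sysOp ν F w w' (v - w) - (K w).toReal * (relEnergy v w + 0) =
      ν * ‖wgrad v‖ ^ 2 - pairing F v + (rate ν F v w + ⟪v, w'⟫) - ⟪w', w⟫ := by
  have hsub : v - w ∈ L2sigma Ω := by
    rw [mem_L2sigma_iff] at *
    exact Submodule.sub_mem _ hv hw
  -- By bilinearity the left-hand side is ∫(v·∇)w·(v − w), and ∫(v·∇)w·w = 0 by antisymmetry with
  -- both fields equal to w.
  have hconv : convInt (v - w) (wgrad w) (v - w) + convInt w (wgrad w) (v - w) =
      convInt v (wgrad w) v := by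
    have h0 : convInt v (wgrad w) w = 0 := by
      have := convInt_antisymm hv hφ hg hV hΓ
      linarith
    rw [convInt_eq_pair _ _ hΓ] at h0
    simp only [convInt_eq_pair _ _ hΓ, map_sub, sub_apply]
    linarith
  have hrel : relForm ν K v w = ν * ‖wgrad v - wgrad w‖ ^ 2 +
      convInt (v - w) (wgrad w) (v - w) + (K w).toReal * relEnergy v w := by
    -- For ν > 0 antisymmetry turns −∫(u·∇)u·w into ∫(u·∇)w·u; for ν = 0 this is the symmetric form
    -- already. Both cases thus share one expression.
    rw [relForm]
    split_ifs with hpos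
    · obtain ⟨ψ, hψ⟩ := exists_weakApprox_of_mem_H10sigma (hvH hpos)
      rw [convInt_antisymm hsub (hψ.sub hφ) hg hV hΓ]
      ring
    · rw [symInt_eq_convInt, le_antisymm (not_lt.1 hpos) hν]
      ring
  have hpair : pairing F (v - w) = pairing F v - pairing F w := by
    simp only [pairing_eq, inner_sub_right]
    rcases hν.eq_or_lt with h0 | hpos
    · simp [hF h0.symm]
    · rw [h10Lift_sub (mem_H10_of_mem_H10sigma (hvH hpos)) (mem_H10_of_mem_H10sigma (hwH hpos))
        (((hasWeakGrad_of_mem_H10sigma (hvH hpos)).sub hg).wgrad_eq hΩ), map_sub]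
      ring
  have hvis : ν * ‖wgrad v - wgrad w‖ ^ 2 + ν * ⟪wgrad w, wgrad (v - w)⟫ =
      ν * ‖wgrad v‖ ^ 2 - ν * ⟪wgrad v, wgrad w⟫ := by
    rcases hν.eq_or_lt with h0 | hpos
    · simp [← h0]
    · rw [((hasWeakGrad_of_mem_H10sigma (hvH hpos)).sub hg).wgrad_eq hΩ, norm_sub_sq_real,
        inner_sub_right, real_inner_self_eq_norm_sq, real_inner_comm (wgrad v) (wgrad w)]
      ring
  rw [hrel, sysOp, hpair, rate, hvisc, pairing_eq F w, inner_sub_right, real_inner_comm v w']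
  linarith

/-- Weak solutions with the strong energy inequality satisfy the relative energy inequality for
all comparison functions with an approximation by test fields. -/
theorem IsWeakSolution.relative_energy_inequality (hΩ : IsOpen Ω) (hΩb : Bornology.IsBounded Ω)
    (hν : 0 ≤ ν) (hT : 0 < T) (hf : MemZ Ω ν T f) (hv : IsWeakSolution Ω ν T f v₀ v)
    (hw : MemY Ω ν T w) (hw' : HasWeakTimeDeriv T w w')
    (hS : ∀ᵐ t ∂timeMeasure T, ∃ φ C, SymApprox Ω φ C (w t)) :
    IntegrableOn (fun τ => relForm ν K (v τ) (w τ) + sysOp ν (f τ) (w τ) (w' τ) (v τ - w τ)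
      - (K (w τ)).toReal * (relEnergy (v τ) (w τ) + 0)) (Ioo 0 T) ∧
    ∀ᵐ s ∂timeMeasure T, ∀ᵐ t ∂timeMeasure T, s < t →
      relEnergy (v t) (w t) + 0 + ∫ τ in s..t, (relForm ν K (v τ) (w τ)
        + sysOp ν (f τ) (w τ) (w' τ) (v τ - w τ)
        - (K (w τ)).toReal * (relEnergy (v τ) (w τ) + 0)) ≤ relEnergy (v s) (w s) + 0 := by
  obtain ⟨hgrad, ⟨V, -, hVw⟩, Γ, -, hΓw⟩ := hw.memL1W1inf
  have hX := hv.memX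
  have hev : ∀ {P : ℝ → Prop}, (0 < ν → ∀ᵐ t ∂timeMeasure T, P t) →
      ∀ᵐ t ∂timeMeasure T, 0 < ν → P t := fun {P} h => by
    by_cases hpos : 0 < ν
    · filter_upwards [h hpos] with t ht _ using ht
    · exact ae_of_all _ fun t h => (hpos h).elim
  have hF0 : ∀ᵐ t ∂timeMeasure T, ν = 0 → (f t).1 = 0 := by
    by_cases h0 : ν = 0
    · filter_upwards [hf.fst_eq_zero h0] with t ht _ using ht
    · exact ae_of_all _ fun t h => (h0 h).elim
  have hJ : (fun τ => relForm ν K (v τ) (w τ) + sysOp ν (f τ) (w τ) (w' τ) (v τ - w τ)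
      - (K (w τ)).toReal * (relEnergy (v τ) (w τ) + 0)) =ᵐ[timeMeasure T]
      fun τ => ν * ‖wgrad (v τ)‖ ^ 2 - pairing (f τ) (v τ) +
        (rate ν (f τ) (v τ) (w τ) + ⟪v τ, w' τ⟫) - ⟪w' τ, w τ⟫ := by
    filter_upwards [hgrad, hVw, hΓw, hS, hX.mem_L2sigma, hw.memX.mem_L2sigma,
      hev hX.mem_H10sigma, hev hw.memX.mem_H10sigma, hF0, viscDual_apply (v := v) hν hf]
      with t h1 h2 h3 h4 h5 h6 h7 h8 h9 h10
    obtain ⟨φ, C, hφ⟩ := h4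
    exact relForm_add_sysOp_eq hΩ hν h5 h6 h7 h8 h9
      (h10 _ fun hpos => mem_H10_of_mem_H10sigma (h8 hpos)) (hφ.weakApprox hΩb hΩ h1) h1 h2 h3
  obtain ⟨irate, c₁, hc₁⟩ := hv.inner_eq hΩ hΩb hν hT hf hw hw' hS
  obtain ⟨c₂, hc₂⟩ := hw'.norm_sq_eq hT hw.memX.memLp_top
  have i1 := hX.integrableOn_dissipation hν
  have i2 := hX.integrableOn_pairing hν hf
  have i3 : IntegrableOn (fun t => ⟪v t, w' t⟫) (Ioo 0 T) :=
    memLp_one_iff_integrable.1 ((innerSL ℝ).memLp_of_bilin (q := 1) 1 hX.memLp_top hw'.memLp_one)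
  have i4 : IntegrableOn (fun t => ⟪w' t, w t⟫) (Ioo 0 T) :=
    memLp_one_iff_integrable.1
      ((innerSL ℝ).memLp_of_bilin (q := ⊤) 1 hw'.memLp_one hw.memX.memLp_top)
  have i13 : IntegrableOn (fun t => rate ν (f t) (v t) (w t) + ⟪v t, w' t⟫) (Ioo 0 T) :=
    irate.add i3
  refine ⟨(((i1.sub i2).add i13).sub i4).congr hJ.symm, ?_⟩
  have hIoo : MeasurableSet (Ioo 0 T) := measurableSet_Ioo
  have h0 : (0 : ℝ) ∈ Icc 0 T := ⟨le_rfl, hT.le⟩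
  filter_upwards [hv.energy_inequality, hc₁, hc₂, ae_restrict_mem hIoo] with s e1 e2 e3 hs
  filter_upwards [e1, hc₁, hc₂, ae_restrict_mem hIoo] with t g1 g2 g3 ht hst
  have hs' := Ioo_subset_Icc_self hs
  have ht' := Ioo_subset_Icc_self ht
  have hii : ∀ {I : ℝ → ℝ}, IntegrableOn I (Ioo 0 T) → IntervalIntegrable I volume s t :=
    fun h => intervalIntegrable_of_integrableOn_Ioo h hs' ht'
  have hadd : ∀ {I : ℝ → ℝ}, IntegrableOn I (Ioo 0 T) →
      ∫ r in (0 : ℝ)..t, I r = (∫ r in (0 : ℝ)..s, I r) + ∫ r in s..t, I r := fun h =>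
    (intervalIntegral.integral_add_adjacent_intervals
      (intervalIntegrable_of_integrableOn_Ioo h h0 hs') (hii h)).symm
  have hsub : Ioc s t ⊆ Ioo 0 T := fun r hr => ⟨hs.1.trans hr.1, hr.2.trans_lt ht.2⟩
  have hJi : ∫ τ in s..t, (relForm ν K (v τ) (w τ)
        + sysOp ν (f τ) (w τ) (w' τ) (v τ - w τ)
        - (K (w τ)).toReal * (relEnergy (v τ) (w τ) + 0)) =
      (∫ τ in s..t, ν * ‖wgrad (v τ)‖ ^ 2) - (∫ τ in s..t, pairing (f τ) (v τ)) +
        (∫ τ in s..t, (rate ν (f τ) (v τ) (w τ) + ⟪v τ, w' τ⟫)) - ∫ τ in s..t, ⟪w' τ, w τ⟫ := by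
    rw [← intervalIntegral.integral_sub (hii i1) (hii i2),
      ← intervalIntegral.integral_add ((hii i1).sub (hii i2)) (hii i13),
      ← intervalIntegral.integral_sub (((hii i1).sub (hii i2)).add (hii i13)) (hii i4),
      intervalIntegral.integral_of_le hst.le, intervalIntegral.integral_of_le hst.le]
    exact integral_congr_ae (ae_restrict_of_ae_restrict_of_subset hsub hJ)
  have g1' := g1 hst
  rw [hadd i13] at g2
  rw [hadd i4] at g3
  -- The squares are expanded: the energy inequality handles ½‖v‖², the two product rules handle
  -- −⟪v, w⟫ and ½‖w‖².
  rw [hJi, relEnergy, relEnergy, norm_sub_sq_real, norm_sub_sq_real]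
  linarith

end RelativeEnergy

end FluidEV

end

/-! ### The proposition -/

theorem proposition2 {d : ℕ} (hd : 2 ≤ d) (Ω : Set (FluidEV.Vec d))
    (hΩ : FluidEV.IsBoundedLipschitzDomain Ω) (ν : ℝ) (hν : 0 ≤ ν) (T : ℝ) (hT : 0 < T)
    (f : ℝ → FluidEV.Hm1 Ω × FluidEV.L2 Ω (Fin d)) (hf : FluidEV.MemZ Ω ν T f)
    (v₀ : FluidEV.L2 Ω (Fin d)) (hv₀ : v₀ ∈ FluidEV.L2sigma Ω)
    (v : ℝ → FluidEV.L2 Ω (Fin d)) (hv : FluidEV.IsWeakSolution Ω ν T f v₀ v) :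
    FluidEV.IsEnergyVariationalSolution Ω ν T f v₀ v (fun _ => 0) := by
  refine ⟨hv.memX, MemLp.zero', fun _ _ => le_rfl, fun K hK w w' hw hKw hw' => ?_,
    hv.tendsto_initial hΩ.isOpen hν hT hf hv₀⟩
  -- The approximants come from admissibility of K for ν = 0, and from the Lipschitz boundary and
  -- the W^{1,∞} regularity of w for ν > 0.
  have hS : ∀ᵐ t ∂FluidEV.timeMeasure T, ∃ φ C, FluidEV.SymApprox Ω φ C (w t) := by
    rcases hν.eq_or_lt with rfl | hpos
    · exact hK.exists_symApprox hd hΩ.isOpen hT hKw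
    · obtain ⟨-, ⟨V, -, hVw⟩, Γ, -, hΓw⟩ := hw.memL1W1inf
      filter_upwards [hw.memX.mem_H10sigma hpos, hVw, hΓw] with t h1 h2 h3
      exact hΩ.exists_symApprox h1 h2 h3
  obtain ⟨hint, hineq⟩ := hv.relative_energy_inequality (K := K) hΩ.isOpen hΩ.isBounded hν hT hf
    hw hw' hS
  obtain ⟨C, hC⟩ := hv.memX.exists_bound
  obtain ⟨C', hC'⟩ := hw.memX.exists_bound
  refine ⟨hint, FluidEV.exists_oneSided_limits (C := 1 / 2 * (C + C') ^ 2) hT hint ?_ hineq⟩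
  filter_upwards [hC, hC'] with t h1 h2
  rw [FluidEV.relEnergy, add_zero, abs_of_nonneg (by positivity)]
  gcongr
  exact (norm_sub_le _ _).trans (add_le_add h1 h2)
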